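/- \textbf{Definitions.} A \emph{Frobenius pair} $(R,l)$ over $\mathbb C$ is a finite-dimensional unital associative algebra $R$ with a linear functional $l$ such that the bilinear form $(x,y)=l(xy)$ is symmetric and non-degenerate. A \emph{complex equipped Cardy--Frobenius algebra} $((A,l_A),(B,l_B),\phi,U,\star)$ consists of a commutative Frobenius pair $(A,l_A)$, a Frobenius pair $(B,l_B)$, a unital algebra homomorphism $\phi:A\to B$ with central image satisfying the Cardy condition $l_A(\phi^*(b')\phi^*(b''))=\operatorname{Tr}(b\mapsto b'bb'')$ for all $b',b''\in B$ (where $\phi^*:B\to A$ is dual to $\phi$, i.e. $l_A(\phi^*(b)a)=l_B(b\,\phi(a))$), involutive linear anti-automorphisms $\star$ of $A$ and of $B$ with $l_A(x^\star)=l_A(x)$, $l_B(x^\star)=l_B(x)$, $\phi(x^\star)=\phi(x)^\star$, and an element $U\in A$ with $U^2=\sum_{i,j}F_A^{ij}\alpha_i\alpha_j^\star$ and $\phi(U)=\sum_{i,j}F_B^{ij}\beta_i\beta_j^\star$, where $(\alpha_i)$, $(\beta_i)$ are bases of $A$, $B$ and $F_A$, $F_B$ are the inverses of the Gram matrices $(l_A(\alpha_i\alpha_j))$,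 $(l_B(\beta_i\beta_j))$. It is \emph{semi-simple} if the algebras $A$ and $B$ are semi-simple. Direct sums are componentwise; an isomorphism is a pair of algebra isomorphisms of the $A$'s and of the $B$'s respecting $l_A,l_B,\phi,U,\star$. Let $\rho$ be a finite-dimensional real representation of a finite group $G$ with a non-degenerate symmetric $G$-invariant bilinear form $\beta$, and let $\mu\in Z(\mathbb C[G])$ be invertible and invariant under the linear map $g\mapsto g^{-1}$. Then $H^\rho_\mu$ (formed using $\beta$) is the following data: $A=Z(\mathbb C[G])$ with $l_A(x)=(\mu^2x)(1)/|G|$; $B=\operatorname{End}_G(\rho)\otimes_{\mathbb R}\mathbb C=\operatorname{End}_G(\rho\otimes_{\mathbb R}\mathbb C)$ with $l_B(x)=\operatorname{Tr}(\mu x)/|G|$, the trace being taken on $\rho\otimes_{\mathbb R}\mathbb C$; $\phi$ is the action of $A$ on $\rho\otimes_{\mathbb R}\mathbb C$; $\star$ is induced on $A$ by $g\mapsto g^{-1}$ and is on $B$ the adjoint with respect to the complex-bilinear extension of $\beta$; and $U=\mu^{-1}\sum_{g\in G}g^2$. \textbf{Corollary.} Every semi-simple complex equipped Cardy--Frobenius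 algebra $H$ can be constructed from a real representation of a finite group, as a direct summand: there are a finite group $G$, which can be taken to be a product $(Q_8\times\mathbb Z/3\mathbb Z)^k$ of finitely many copies of $Q_8\times\mathbb Z/3\mathbb Z$, a finite-dimensional real representation $\rho$ of $G$ with a form $\beta$ as above, an invertible invariant $\mu\in Z(\mathbb C[G])$, and a semi-simple complex equipped Cardy--Frobenius algebra $H'$ such that $H^\rho_\mu\cong H\oplus H'$. -/

import Mathlib

open scoped TensorProduct

noncomputable section

namespace KleinTFT

universe u v w u' v'

/-! ### Equipped Cardy-Frobenius algebras -/

section Frobenius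

variable {𝕜 : Type w} [Field 𝕜] {R : Type u} [Ring R] [Algebra 𝕜 R]

/-- `(R, l)` is a Frobenius pair: the invariant bilinear form `(x, y) = l (x * y)` on the unital
algebra `R` is symmetric and non-degenerate. -/
structure IsFrobeniusPair (l : R →ₗ[𝕜] 𝕜) : Prop where
  symm : ∀ x y : R, l (x * y) = l (y * x)
  nondegenerate : ∀ x : R, (∀ y : R, l (x * y) = 0) → x = 0

/-- The Gram matrix `(l (bᵢ * bⱼ))ᵢⱼ` of the form `(x, y) = l (x * y)` in a basis `b`. -/
def gram {ι : Type*} (l : R →ₗ[𝕜] 𝕜) (b : Module.Basis ι 𝕜 R) : Matrix ι ι 𝕜 :=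
  Matrix.of fun i j => l (b i * b j)

/-- The twisted Casimir element `∑ᵢⱼ Fᵢⱼ bᵢ * s bⱼ`, where `F` is the inverse of the Gram matrix
of `(x, y) = l (x * y)` in a basis `b`. When the form is non-degenerate, this element does not
depend on the basis. -/
def casimirStar [FiniteDimensional 𝕜 R] (l : R →ₗ[𝕜] 𝕜) (s : R →ₗ[𝕜] R) : R :=
  let b := Module.finBasis 𝕜 R
  ∑ i, ∑ j, (gram l b)⁻¹ i j • (b i * s (b j))

end Frobenius

/-- The underlying data `((A, l_A), (B, l_B), φ, U, ⋆)` of an equipped Cardy-Frobenius algebra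
over `𝕜`; the axioms are stated in `IsEquippedCardyFrobenius`. -/
structure EquippedData (𝕜 : Type w) [Field 𝕜] where
  A : Type u
  B : Type v
  [commRingA : CommRing A]
  [ringB : Ring B]
  [algebraA : Algebra 𝕜 A]
  [algebraB : Algebra 𝕜 B]
  [finiteA : FiniteDimensional 𝕜 A]
  [finiteB : FiniteDimensional 𝕜 B]
  lA : A →ₗ[𝕜] 𝕜
  lB : B →ₗ[𝕜] 𝕜
  φ : A →ₐ[𝕜] B
  U : A
  starA : A →ₗ[𝕜] A
  starB : B →ₗ[𝕜] B

attribute [instance] EquippedData.commRingA EquippedData.ringB EquippedData.algebraA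
  EquippedData.algebraB EquippedData.finiteA EquippedData.finiteB

section Axioms

variable {𝕜 : Type w} [Field 𝕜]

/-- `((A, l_A), (B, l_B), φ)` is a Cardy-Frobenius algebra. In the Cardy condition, `φs` is the
map `φ* : B → A` dual to `φ` with respect to the two bilinear forms (it is unique, because the
form on `A` is non-degenerate), and `b'`, `b''` give the operator `b ↦ b' b b''` on `B`. -/
structure IsCardyFrobenius (H : EquippedData.{u, v} 𝕜) : Prop where
  frobeniusA : IsFrobeniusPair H.lA
  frobeniusB : IsFrobeniusPair H.lB
  central : ∀ (a : H.A) (b : H.B), H.φ a * b = b * H.φ a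
  cardy : ∃ φs : H.B →ₗ[𝕜] H.A,
    (∀ (b : H.B) (a : H.A), H.lA (φs b * a) = H.lB (b * H.φ a)) ∧
    ∀ b' b'' : H.B, H.lA (φs b' * φs b'') =
      LinearMap.trace 𝕜 H.B (LinearMap.mulLeft 𝕜 b' ∘ₗ LinearMap.mulRight 𝕜 b'')

/-- `((A, l_A), (B, l_B), φ, U, ⋆)` is an equipped Cardy-Frobenius algebra. -/
structure IsEquippedCardyFrobenius (H : EquippedData.{u, v} 𝕜) : Prop
    extends IsCardyFrobenius H where
  starA_starA : ∀ a : H.A, H.starA (H.starA a) = a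
  starB_starB : ∀ b : H.B, H.starB (H.starB b) = b
  starA_mul : ∀ a a' : H.A, H.starA (a * a') = H.starA a' * H.starA a
  starB_mul : ∀ b b' : H.B, H.starB (b * b') = H.starB b' * H.starB b
  lA_star : ∀ a : H.A, H.lA (H.starA a) = H.lA a
  lB_star : ∀ b : H.B, H.lB (H.starB b) = H.lB b
  φ_star : ∀ a : H.A, H.φ (H.starA a) = H.starB (H.φ a)
  U_sq : H.U ^ 2 = casimirStar H.lA H.starA
  φ_U : H.φ H.U = casimirStar H.lB H.starB

/-- Semi-simplicity: both algebras `A` and `B` are semi-simple. -/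
def IsSemisimple (H : EquippedData.{u, v} 𝕜) : Prop :=
  IsSemisimpleRing H.A ∧ IsSemisimpleRing H.B

/-- Isomorphisms: pairs of algebra isomorphisms that respect all the structure. -/
structure Iso (H : EquippedData.{u, v} 𝕜) (H' : EquippedData.{u', v'} 𝕜) where
  eA : H.A ≃ₐ[𝕜] H'.A
  eB : H.B ≃ₐ[𝕜] H'.B
  lA_eq : ∀ a, H'.lA (eA a) = H.lA a
  lB_eq : ∀ b, H'.lB (eB b) = H.lB b
  φ_eq : ∀ a, H'.φ (eA a) = eB (H.φ a)
  U_eq : eA H.U = H'.U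
  starA_eq : ∀ a, H'.starA (eA a) = eA (H.starA a)
  starB_eq : ∀ b, H'.starB (eB b) = eB (H.starB b)

/-- The direct sum, with all operations componentwise and `l (x, y) = l x + l y`. -/
def directSum (H : EquippedData.{u, v} 𝕜) (H' : EquippedData.{u', v'} 𝕜) :
    EquippedData.{max u u', max v v'} 𝕜 where
  A := H.A × H'.A
  B := H.B × H'.B
  lA := H.lA.coprod H'.lA
  lB := H.lB.coprod H'.lB
  φ := H.φ.prodMap H'.φ
  U := (H.U, H'.U)
  starA := H.starA.prodMap H'.starA
  starB := H.starB.prodMap H'.starB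

end Axioms

/-! ### The centre of the group algebra -/

section Center

variable (𝕜 : Type w) [Field 𝕜] (G : Type u) [Group G]

/-- The centre `Z(𝕜[G])` of the group algebra. -/
abbrev GroupCenter : Subalgebra 𝕜 (MonoidAlgebra 𝕜 G) :=
  Subalgebra.center 𝕜 (MonoidAlgebra 𝕜 G)

/-- The linear map `∑ c_g g ↦ ∑ c_g g⁻¹` on `𝕜[G]`. -/
def groupInv : MonoidAlgebra 𝕜 G →ₗ[𝕜] MonoidAlgebra 𝕜 G :=
  Finsupp.lsum 𝕜 (fun g : G => MonoidAlgebra.lsingle g⁻¹) ∘ₗ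
    (MonoidAlgebra.coeffLinearEquiv 𝕜).toLinearMap

variable {𝕜 G}

theorem groupInv_single (g : G) (c : 𝕜) :
    groupInv 𝕜 G (MonoidAlgebra.single g c) = MonoidAlgebra.single g⁻¹ c := by
  simp [groupInv]

theorem groupInv_mul (x y : MonoidAlgebra 𝕜 G) :
    groupInv 𝕜 G (x * y) = groupInv 𝕜 G y * groupInv 𝕜 G x := by
  induction x using MonoidAlgebra.induction_linear with
  | zero => simp
  | add x x' hx hx' => simp [add_mul, mul_add, hx, hx']
  | single g c =>
    induction y using MonoidAlgebra.induction_linear with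
    | zero => simp
    | add y y' hy hy' => simp [add_mul, mul_add, hy, hy']
    | single h d =>
      simp [groupInv_single, MonoidAlgebra.single_mul_single, mul_comm]

theorem groupInv_groupInv (x : MonoidAlgebra 𝕜 G) :
    groupInv 𝕜 G (groupInv 𝕜 G x) = x := by
  induction x using MonoidAlgebra.induction_linear with
  | zero => simp
  | add x x' hx hx' => simp [hx, hx']
  | single g c => simp [groupInv_single]

theorem groupInv_mem (x : MonoidAlgebra 𝕜 G) (hx : x ∈ GroupCenter 𝕜 G) :
    groupInv 𝕜 G x ∈ GroupCenter 𝕜 G := by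
  rw [Subalgebra.mem_center_iff] at hx ⊢
  intro y
  have h := congrArg (groupInv 𝕜 G) (hx (groupInv 𝕜 G y))
  rw [groupInv_mul, groupInv_mul, groupInv_groupInv] at h
  exact h.symm

variable (𝕜 G)

/-- The involution of `Z(𝕜[G])` induced by `g ↦ g⁻¹`. -/
def centerStar : GroupCenter 𝕜 G →ₗ[𝕜] GroupCenter 𝕜 G :=
  ((groupInv 𝕜 G) ∘ₗ (GroupCenter 𝕜 G).toSubmodule.subtype).codRestrict
    (GroupCenter 𝕜 G).toSubmodule (fun x => groupInv_mem x.1 x.2)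

variable [Fintype G]

theorem sumSquares_mem :
    (∑ g : G, MonoidAlgebra.single (g ^ 2) (1 : 𝕜)) ∈ GroupCenter 𝕜 G := by
  rw [Subalgebra.mem_center_iff]
  intro y
  induction y using MonoidAlgebra.induction_linear with
  | zero => simp
  | add y y' hy hy' => simp [add_mul, mul_add, hy, hy']
  | single h d =>
    simp only [Finset.mul_sum, Finset.sum_mul, MonoidAlgebra.single_mul_single, mul_one, one_mul]
    refine Fintype.sum_equiv (MulAut.conj h).toEquiv _ _ (fun g => ?_)
    simp [pow_two, mul_assoc]

/-- The element `∑_{g ∈ G} g²` of `Z(𝕜[G])`. -/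
def sumSquares : GroupCenter 𝕜 G :=
  ⟨∑ g : G, MonoidAlgebra.single (g ^ 2) (1 : 𝕜), sumSquares_mem 𝕜 G⟩

variable {𝕜 G}

/-- The functional `x ↦ (value of μ² x at the unit of G) / |G|` on `Z(𝕜[G])`. -/
def centerFunctional (μ : (GroupCenter 𝕜 G)ˣ) : GroupCenter 𝕜 G →ₗ[𝕜] 𝕜 :=
  (Fintype.card G : 𝕜)⁻¹ •
    (Finsupp.lapply (1 : G) ∘ₗ (MonoidAlgebra.coeffLinearEquiv 𝕜).toLinearMap ∘ₗ
      (GroupCenter 𝕜 G).toSubmodule.subtype ∘ₗ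
        LinearMap.mulLeft 𝕜 ((μ : GroupCenter 𝕜 G) ^ 2))

end Center

/-! ### Intertwining operators -/

section Intertwining

variable {𝕜 : Type w} [Field 𝕜] {G : Type u} [Group G]
variable {V : Type v} [AddCommGroup V] [Module 𝕜 V]

/-- The algebra `End_G(σ)` of intertwining operators. -/
abbrev intertwiners (σ : Representation 𝕜 G V) : Subalgebra 𝕜 (Module.End 𝕜 V) :=
  Subalgebra.centralizer 𝕜 (Set.range σ)

theorem asAlgebraHom_mem (σ : Representation 𝕜 G V) (x : GroupCenter 𝕜 G) :
    σ.asAlgebraHom x.1 ∈ intertwiners σ := by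
  rw [Subalgebra.mem_centralizer_iff]
  rintro _ ⟨g, rfl⟩
  have h := (Subalgebra.mem_center_iff.1 x.2) (MonoidAlgebra.of 𝕜 G g)
  have h' := congrArg σ.asAlgebraHom h
  simpa only [map_mul, Representation.asAlgebraHom_of] using h'

/-- The action `Z(𝕜[G]) → End_G(σ)` of the centre of the group algebra. -/
def centerAction (σ : Representation 𝕜 G V) : GroupCenter 𝕜 G →ₐ[𝕜] intertwiners σ :=
  (σ.asAlgebraHom.comp (GroupCenter 𝕜 G).val).codRestrict _ (asAlgebraHom_mem σ)

/-- The functional `x ↦ Tr (μ x) / |G|` on `End_G(σ)`. -/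
def intertwinerFunctional [Fintype G] (σ : Representation 𝕜 G V) (μ : (GroupCenter 𝕜 G)ˣ) :
    intertwiners σ →ₗ[𝕜] 𝕜 :=
  (Fintype.card G : 𝕜)⁻¹ •
    (LinearMap.trace 𝕜 V ∘ₗ (intertwiners σ).toSubmodule.subtype ∘ₗ
      LinearMap.mulLeft 𝕜 (centerAction σ (μ : GroupCenter 𝕜 G)))

variable [FiniteDimensional 𝕜 V]

/-- The adjoint `x ↦ x^τ` with respect to a non-degenerate bilinear form,
see `adjointMap_apply`. -/
def adjointMap (γ : LinearMap.BilinForm 𝕜 V) (hγ : γ.Nondegenerate) :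
    Module.End 𝕜 V →ₗ[𝕜] Module.End 𝕜 V :=
  (γ.toDual hγ).symm.conj.toLinearMap ∘ₗ Module.Dual.transpose

theorem adjointMap_apply (γ : LinearMap.BilinForm 𝕜 V) (hγ : γ.Nondegenerate)
    (x : Module.End 𝕜 V) (a b : V) : γ (adjointMap γ hγ x a) b = γ a (x b) := by
  rw [← LinearMap.BilinForm.toDual_def hγ]
  simp [adjointMap, LinearEquiv.conj_apply, Module.Dual.transpose_apply,
    LinearMap.BilinForm.toDual_def]

theorem adjointMap_mem (σ : Representation 𝕜 G V) (γ : LinearMap.BilinForm 𝕜 V)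
    (hγ : γ.Nondegenerate) (hinv : ∀ g a b, γ (σ g a) (σ g b) = γ a b)
    (x : Module.End 𝕜 V) (hx : x ∈ intertwiners σ) : adjointMap γ hγ x ∈ intertwiners σ := by
  rw [Subalgebra.mem_centralizer_iff] at hx ⊢
  rintro _ ⟨g, rfl⟩
  have hinv' : ∀ a b, γ (σ g a) b = γ a (σ g⁻¹ b) := fun a b => by
    rw [← hinv g a (σ g⁻¹ b), Representation.self_inv_apply]
  refine LinearMap.ext fun a => (γ.toDual hγ).injective (LinearMap.ext fun b => ?_)
  have hxg : x (σ g⁻¹ b) = σ g⁻¹ (x b) := by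
    have := LinearMap.congr_fun (hx (σ g⁻¹) ⟨g⁻¹, rfl⟩) b
    exact this.symm
  rw [LinearMap.BilinForm.toDual_def, LinearMap.BilinForm.toDual_def, Module.End.mul_apply,
    Module.End.mul_apply, hinv', adjointMap_apply, adjointMap_apply, hinv', hxg]

/-- The map `⋆ : End_G(σ) → End_G(σ)` sending an operator to its adjoint with respect to a
non-degenerate invariant bilinear form. -/
def intertwinerStar (σ : Representation 𝕜 G V) (γ : LinearMap.BilinForm 𝕜 V)
    (hγ : γ.Nondegenerate) (hinv : ∀ g a b, γ (σ g a) (σ g b) = γ a b) :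
    intertwiners σ →ₗ[𝕜] intertwiners σ :=
  (adjointMap γ hγ ∘ₗ (intertwiners σ).toSubmodule.subtype).codRestrict
    (intertwiners σ).toSubmodule (fun x => adjointMap_mem σ γ hγ hinv x.1 x.2)

end Intertwining

/-! ### The construction attached to a real representation -/

section RealRepresentation

variable {G : Type u} [Group G] {V : Type v} [AddCommGroup V] [Module ℝ V]

/-- A non-degenerate symmetric invariant bilinear form on a real representation. -/
structure InvariantForm (ρ : Representation ℝ G V) where
  form : LinearMap.BilinForm ℝ V
  symm : form.IsSymm
  nondegenerate : form.Nondegenerate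
  invariant : ∀ (g : G) (a b : V), form (ρ g a) (ρ g b) = form a b

/-- The complexification `ℂ ⊗ ρ` of a real representation. -/
def complexify (ρ : Representation ℝ G V) : Representation ℂ G (ℂ ⊗[ℝ] V) :=
  (Module.End.baseChangeHom ℝ ℂ V).toMonoidHom.comp ρ

theorem complexify_tmul (ρ : Representation ℝ G V) (g : G) (z : ℂ) (a : V) :
    complexify ρ g (z ⊗ₜ[ℝ] a) = z ⊗ₜ[ℝ] ρ g a := rfl

theorem complexify_invariant (ρ : Representation ℝ G V) (β : InvariantForm ρ) (g : G)
    (a b : ℂ ⊗[ℝ] V) :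
    (β.form.baseChange ℂ) (complexify ρ g a) (complexify ρ g b) = (β.form.baseChange ℂ) a b := by
  induction a using TensorProduct.induction_on with
  | zero => simp
  | add a a' ha ha' => simp [ha, ha']
  | tmul z a =>
    induction b using TensorProduct.induction_on with
    | zero => simp
    | add b b' hb hb' => simp [hb, hb']
    | tmul z' b => simp [complexify_tmul, LinearMap.BilinForm.baseChange_tmul, β.invariant]

theorem baseChange_nondegenerate [FiniteDimensional ℝ V] (β : LinearMap.BilinForm ℝ V)
    (hβ : β.Nondegenerate) : (β.baseChange ℂ).Nondegenerate := by
  let b := Module.finBasis ℝ V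
  have h := (LinearMap.BilinForm.nondegenerate_iff_det_ne_zero b).1 hβ
  refine (LinearMap.BilinForm.nondegenerate_iff_det_ne_zero (b.baseChange ℂ)).2 ?_
  have hm : LinearMap.BilinForm.toMatrix (b.baseChange ℂ) (β.baseChange ℂ) =
      (LinearMap.BilinForm.toMatrix b β).map (algebraMap ℝ ℂ) := by
    ext i j
    simp [LinearMap.BilinForm.toMatrix_apply, LinearMap.BilinForm.baseChange_tmul]
  rw [hm, ← RingHom.mapMatrix_apply, ← RingHom.map_det]
  exact (map_ne_zero _).2 h

/-- The data `H^ρ_μ` over `ℂ` attached to a real representation `ρ` of a finite group `G`, a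
non-degenerate symmetric invariant bilinear form `β` on `ρ`, and an invertible `μ ∈ Z(ℂ[G])`
(which is meant to satisfy `centerStar ℂ G μ = μ`):
`A = Z(ℂ[G])`, `B = End_G(ℂ ⊗ ρ) = ℂ ⊗ End_G(ρ)`, `φ` is the action of `A`, the involution on `A`
is `g ↦ g⁻¹`, the involution on `B` is the adjoint with respect to the complex-bilinear extension
of `β`, and `U = μ⁻¹ ∑ g²`. -/
def representationAlgebra [Fintype G] [FiniteDimensional ℝ V] (ρ : Representation ℝ G V)
    (β : InvariantForm ρ) (μ : (GroupCenter ℂ G)ˣ) : EquippedData.{u, v} ℂ where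
  A := GroupCenter ℂ G
  B := intertwiners (complexify ρ)
  finiteA := inferInstance
  finiteB := inferInstance
  lA := centerFunctional μ
  lB := intertwinerFunctional (complexify ρ) μ
  φ := centerAction (complexify ρ)
  U := (↑μ⁻¹ : GroupCenter ℂ G) * sumSquares ℂ G
  starA := centerStar ℂ G
  starB := intertwinerStar (complexify ρ) (β.form.baseChange ℂ)
    (baseChange_nondegenerate β.form β.nondegenerate) (complexify_invariant ρ β)

end RealRepresentation

/-- The product of `k` copies of `Q₈ × ℤ/3ℤ`. -/
abbrev Q8Z3Power (k : ℕ) : Type :=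
  Fin k → QuaternionGroup 2 × Multiplicative (ZMod 3)

end KleinTFT

end

open scoped TensorProduct

noncomputable section

namespace KleinTFT

universe u v w

/-! ### Casimir elements of Frobenius pairs -/

section Casimir

variable {𝕜 : Type w} [Field 𝕜] {R : Type u} [Ring R] [Algebra 𝕜 R]

/-! Since `A` is semi-simple and commutative over `ℂ`, it is the algebra of functions on its
finitely many characters `x`, with minimal idempotents `idem x`. So `H` splits into blocks `φ(idem
x) B`, and everything can be compared one character at a time.

The Cardy condition makes each block rigid (`exists_block`). It is zero or a single matrix algebra
`M_m(ℂ)`, and on it `l_B = c_x · tr` with `c_x² = l_A(idem x)`. If the block is zero, either square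
root serves as `c_x`. The involution `⋆` permutes the characters, and `c` can be taken constant on
its orbits (`exists_blocks`). At a character that is not fixed, `x(U) = 0` and `⋆` swaps two blocks.
At a fixed one, `c_x x(U) = ±1`, and if the block is nonzero `⋆` is the adjoint for a form that is
symmetric or skew according to this sign (`exists_form_of_block`). The sign plays the role of a
Frobenius–Schur indicator.

These three cases are the real, quaternionic and complex types of irreducible real representations,
and `Q₈ × ℤ/3ℤ` has one of each: a sign character, the quaternions under left multiplication, and
the plane rotated by a character of order six. The complexified commutants of their multiples are
`M_m(ℂ)` with transposition, `M_r(M_2(ℂ))` with the symplectic adjoint, and `M_m(ℂ × ℂ)` with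
transposition and swap. After a change of basis bringing the form to normal form, each orbit of
blocks is such a commutant (`exists_realization_re`, `exists_realization_qu`,
`exists_realization_cp`).

To have enough different irreducibles, one factor of `G = (Q₈ × ℤ/3ℤ)^n` is used per orbit. In each
representation chosen some group element acts by `-1`. This makes the central characters pulled back
from different factors distinct, and forces intertwiners of the external sum to be block diagonal.
The result is an injection `ψ` of the characters of `A` in those of `Z(ℂ[G])`, compatible with the
involutions.

Finally `μ` adjusts the scalars. At an irreducible of degree `d`, the group side has `l_A(idem) = (μ
d / |G|)²` (`centerFunctional_idem_factorChar`), and `∑ g²` acts by the indicator times `|G| / d` if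
it is self-dual. The choice `ψ_x(μ) = c_x |G| / d` therefore matches `l_A`, `l_B` and `U` together.
The characters of `Z(ℂ[G])` outside the image of `ψ` do not occur in `ρ`; they make up `H'`, whose
algebra `B` is zero. -/

theorem IsFrobeniusPair.isUnit_det_gram {l : R →ₗ[𝕜] 𝕜} (hl : IsFrobeniusPair l)
    {ι : Type*} [Fintype ι] [DecidableEq ι] (b : Module.Basis ι 𝕜 R) :
    IsUnit (gram l b).det := by
  rw [isUnit_iff_ne_zero]
  intro h
  obtain ⟨v, hv, hv0⟩ := Matrix.exists_mulVec_eq_zero_iff.2 h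
  apply hv
  have hr : ∑ j, v j • b j = 0 := by
    apply hl.nondegenerate
    intro y
    rw [hl.symm, ← b.sum_repr y, Finset.sum_mul, map_sum]
    refine Finset.sum_eq_zero fun i _ => ?_
    have := congrFun hv0 i
    simp only [Matrix.mulVec, dotProduct, gram, Matrix.of_apply, Pi.zero_apply] at this
    simp only [Finset.mul_sum, map_sum, smul_mul_assoc, mul_smul_comm, map_smul, smul_eq_mul]
    calc _ = b.repr y i * ∑ j, l (b i * b j) * v j := by
          rw [Finset.mul_sum]
          exact Finset.sum_congr rfl fun j _ => by ring
      _ = 0 := by rw [this, mul_zero]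
  ext j
  exact Fintype.linearIndependent_iff.1 b.linearIndependent v hr j

/-- The twisted Casimir element can be computed from any family reproducing the multiplication
by an element `e`. -/
theorem IsFrobeniusPair.sum_mul_eq_mul_casimirStar [FiniteDimensional 𝕜 R] {l : R →ₗ[𝕜] 𝕜}
    (hl : IsFrobeniusPair l) (s : R →ₗ[𝕜] R) {T : Type*} [Fintype T] (x y : T → R) (e : R)
    (h : ∀ r, ∑ t, l (y t * r) • x t = e * r) :
    ∑ t, x t * s (y t) = e * casimirStar l s := by
  set b := Module.finBasis 𝕜 R with hb
  have hdet := hl.isUnit_det_gram b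
  -- The dual basis, `l (d i * b k) = δᵢₖ`. In these terms the Casimir element is `∑ bᵢ * s dᵢ`, and
  -- every `r` expands as `∑ l (r * bᵢ) dᵢ`.
  set d : Fin (Module.finrank 𝕜 R) → R := fun i => ∑ j, (gram l b)⁻¹ i j • b j with hd
  have hdb : ∀ i k, l (d i * b k) = (1 : Matrix _ _ 𝕜) i k := by
    intro i k
    rw [← Matrix.nonsing_inv_mul _ hdet, Matrix.mul_apply]
    simp [hd, Finset.sum_mul, gram]
  have hexp : ∀ r, r = ∑ i, l (r * b i) • d i := by
    intro r
    rw [← sub_eq_zero]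
    apply hl.nondegenerate
    intro y
    rw [← b.sum_repr y, Finset.mul_sum, map_sum]
    refine Finset.sum_eq_zero fun k _ => ?_
    have : l ((r - ∑ i, l (r * b i) • d i) * b k) = 0 := by
      simp [sub_mul, Finset.sum_mul, hdb, Matrix.one_apply]
    rw [mul_smul_comm, map_smul, this, smul_zero]
  have hcas : casimirStar l s = ∑ i, b i * s (d i) := by
    simp only [casimirStar, hd, map_sum, map_smul, Finset.mul_sum, mul_smul_comm, ← hb]
  calc ∑ t, x t * s (y t) = ∑ t, ∑ i, (l (y t * b i) • x t) * s (d i) := by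
        refine Finset.sum_congr rfl fun t _ => ?_
        conv_lhs => rw [hexp (y t)]
        simp [map_sum, Finset.mul_sum]
    _ = ∑ i, (e * b i) * s (d i) := by
        rw [Finset.sum_comm]
        refine Finset.sum_congr rfl fun i _ => ?_
        rw [← h, Finset.sum_mul]
    _ = e * casimirStar l s := by
        rw [hcas, Finset.mul_sum]
        exact Finset.sum_congr rfl fun i _ => mul_assoc _ _ _

end Casimir

/-! ### Finite-dimensional reduced commutative complex algebras -/

section Gelfand

variable (A : Type u) [CommRing A] [Algebra ℂ A]

/-- Evaluation of the elements of `A` at the characters of `A`. -/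
def evalCharacters : A →ₐ[ℂ] ((A →ₐ[ℂ] ℂ) → ℂ) :=
  AlgHom.pi fun x => x

variable {A}

@[simp]
theorem evalCharacters_apply (a : A) (x : A →ₐ[ℂ] ℂ) : evalCharacters A a x = x a := rfl

variable [FiniteDimensional ℂ A]

/-- The nilradical is zero, so some prime misses `a`. It is maximal because `A` is Artinian, and its
residue field is finite over `ℂ`, hence equal to `ℂ`. -/
theorem exists_character_ne_zero [IsReduced A] {a : A} (ha : a ≠ 0) :
    ∃ x : A →ₐ[ℂ] ℂ, x a ≠ 0 := by
  have hart : IsArtinianRing A := IsArtinianRing.of_finite ℂ A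
  have h : ∃ p : Ideal A, p.IsPrime ∧ a ∉ p := by
    by_contra! hcon
    have : a ∈ nilradical A := by
      rw [nilradical_eq_sInf]
      exact (Submodule.mem_sInf).2 fun p hp => hcon p hp
    rw [nilradical_eq_zero] at this
    exact ha this
  obtain ⟨p, hp, hap⟩ := h
  have hmax : p.IsMaximal := inferInstance
  let _ : Field (A ⧸ p) := Ideal.Quotient.field p
  have hbij : Function.Bijective (algebraMap ℂ (A ⧸ p)) :=
    IsAlgClosed.algebraMap_bijective_of_isIntegral
  let e : ℂ ≃ₐ[ℂ] (A ⧸ p) := AlgEquiv.ofBijective (Algebra.ofId ℂ (A ⧸ p)) hbij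
  refine ⟨(e.symm : (A ⧸ p) →ₐ[ℂ] ℂ).comp (Ideal.Quotient.mkₐ ℂ p), ?_⟩
  simpa [Ideal.Quotient.eq_zero_iff_mem] using hap

/-- For surjectivity: a functional vanishing on the image is a linear relation between distinct
characters, and these are linearly independent. -/
theorem evalCharacters_bijective [IsReduced A] : Function.Bijective (evalCharacters A) := by
  classical
  have : Fintype (A →ₐ[ℂ] ℂ) := Fintype.ofFinite _
  constructor
  · rw [injective_iff_map_eq_zero]
    intro a ha
    by_contra hne
    obtain ⟨x, hx⟩ := exists_character_ne_zero hne
    exact hx (congrFun ha x)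
  · change Function.Surjective (evalCharacters A).toLinearMap
    rw [← LinearMap.range_eq_top]
    by_contra hne
    obtain ⟨f, hf0, hf⟩ := Submodule.exists_le_ker_of_lt_top _ (lt_top_iff_ne_top.2 hne)
    apply hf0
    have hli := linearIndependent_algHom_toLinearMap ℂ A ℂ
    have key : ∑ x, f (Pi.single x 1) • (x : A →ₐ[ℂ] ℂ).toLinearMap = 0 := by
      ext a
      have h1 : f (evalCharacters A a) = 0 := hf ⟨a, rfl⟩
      rw [← Finset.univ_sum_single (evalCharacters A a)] at h1
      simp only [LinearMap.sum_apply, LinearMap.smul_apply, smul_eq_mul]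
      rw [map_sum] at h1
      simp only [LinearMap.zero_apply]
      rw [← h1]
      refine Finset.sum_congr rfl fun x _ => ?_
      have : (Pi.single x (evalCharacters A a x) : (A →ₐ[ℂ] ℂ) → ℂ) =
          (x a) • Pi.single x 1 := by
        rw [← Pi.single_smul]; simp
      rw [this, map_smul, smul_eq_mul, mul_comm]
      rfl
    have h2 := Fintype.linearIndependent_iff.1 hli _ key
    refine LinearMap.pi_ext' fun x => ?_
    ext
    simpa using h2 x

/-- A reduced finite-dimensional commutative complex algebra is the algebra of functions on its
characters. -/
def gelfand [IsReduced A] : A ≃ₐ[ℂ] ((A →ₐ[ℂ] ℂ) → ℂ) :=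
  AlgEquiv.ofBijective (evalCharacters A) evalCharacters_bijective

variable [IsReduced A]

@[simp]
theorem gelfand_apply (a : A) (x : A →ₐ[ℂ] ℂ) : gelfand a x = x a := rfl

@[simp]
theorem character_gelfand_symm (x : A →ₐ[ℂ] ℂ) (f : (A →ₐ[ℂ] ℂ) → ℂ) :
    x (gelfand.symm f) = f x := by
  rw [← gelfand_apply, AlgEquiv.apply_symm_apply]

theorem ext_character {a b : A} (h : ∀ x : A →ₐ[ℂ] ℂ, x a = x b) : a = b :=
  gelfand.injective (funext h)

open Classical in
/-- The minimal idempotent of `A` at a character. -/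
def idem (x : A →ₐ[ℂ] ℂ) : A := gelfand.symm (Pi.single x 1)

open Classical in
theorem character_idem (x y : A →ₐ[ℂ] ℂ) : y (idem x) = if y = x then 1 else 0 := by
  rw [idem, character_gelfand_symm, Pi.single_apply]

@[simp]
theorem character_idem_self (x : A →ₐ[ℂ] ℂ) : x (idem x) = 1 := by
  rw [character_idem, if_pos rfl]

theorem character_idem_of_ne {x y : A →ₐ[ℂ] ℂ} (h : y ≠ x) : y (idem x) = 0 := by
  rw [character_idem, if_neg h]

theorem mul_idem (a : A) (x : A →ₐ[ℂ] ℂ) : a * idem x = x a • idem x := by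
  apply ext_character
  intro y
  by_cases h : y = x
  · simp [h]
  · simp [character_idem_of_ne h]

theorem idem_mul_self (x : A →ₐ[ℂ] ℂ) : idem x * idem x = idem x := by
  rw [mul_idem, character_idem_self, one_smul]

theorem idem_mul_of_ne {x y : A →ₐ[ℂ] ℂ} (h : x ≠ y) : idem x * idem y = 0 := by
  rw [mul_idem, character_idem_of_ne h.symm, zero_smul]

theorem sum_smul_idem [Fintype (A →ₐ[ℂ] ℂ)] (a : A) : ∑ x : A →ₐ[ℂ] ℂ, x a • idem x = a := by
  apply ext_character
  intro y
  rw [map_sum, Finset.sum_eq_single y]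
  · simp
  · intro x _ hx
    simp [character_idem_of_ne hx.symm]
  · simp

theorem sum_idem [Fintype (A →ₐ[ℂ] ℂ)] : ∑ x : A →ₐ[ℂ] ℂ, idem x = 1 := by
  rw [← sum_smul_idem (1 : A)]
  simp

theorem apply_eq_sum [Fintype (A →ₐ[ℂ] ℂ)] (l : A →ₗ[ℂ] ℂ) (a : A) :
    l a = ∑ x : A →ₐ[ℂ] ℂ, x a * l (idem x) := by
  conv_lhs => rw [← sum_smul_idem a]
  simp [map_sum]

theorem IsFrobeniusPair.apply_idem_ne_zero {l : A →ₗ[ℂ] ℂ} (hl : IsFrobeniusPair l)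
    (x : A →ₐ[ℂ] ℂ) : l (idem x) ≠ 0 := by
  intro h
  have h0 : idem x = 0 := by
    apply hl.nondegenerate
    intro y
    rw [mul_comm, mul_idem, map_smul, h, smul_zero]
  have := character_idem_self x
  rw [h0, map_zero] at this
  exact zero_ne_one this

/-- The one-element family `idem x`, with dual `(l (idem x))⁻¹ • idem x`, reproduces multiplication
by `idem x`, so it computes the component of the Casimir element at `x`. -/
theorem IsFrobeniusPair.character_casimirStar {l : A →ₗ[ℂ] ℂ} (hl : IsFrobeniusPair l)
    (s : A →ₗ[ℂ] A) (x : A →ₐ[ℂ] ℂ) :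
    x (casimirStar l s) = (l (idem x))⁻¹ * x (s (idem x)) := by
  have h := hl.sum_mul_eq_mul_casimirStar s (T := Unit) (fun _ => idem x)
    (fun _ => (l (idem x))⁻¹ • idem x) (idem x) (fun r => by
      simp only [Finset.univ_unique, Finset.sum_singleton]
      rw [smul_mul_assoc, map_smul, mul_comm, mul_idem, map_smul]
      congr 1
      have := hl.apply_idem_ne_zero x
      simp only [smul_eq_mul]
      field_simp)
  have h' := congrArg x h
  simpa using h'.symm

end Gelfand

/-! ### The centre of the group algebra as a Frobenius algebra -/

section GroupCenter

variable {G : Type u} [Group G]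

theorem coeff_conj (z : GroupCenter ℂ G) (a c : G) :
    z.1.coeff (a * c * a⁻¹) = z.1.coeff c := by
  have h := Subalgebra.mem_center_iff.1 z.2 (MonoidAlgebra.single a 1)
  have h' := congrArg (fun w => w.coeff (a * c)) h
  simp only [MonoidAlgebra.coeff_single_mul_apply, MonoidAlgebra.coeff_mul_single_apply] at h'
  simpa using h'.symm

theorem centerStar_coe (z : GroupCenter ℂ G) :
    (centerStar ℂ G z : MonoidAlgebra ℂ G) = groupInv ℂ G z := rfl

theorem centerStar_centerStar (z : GroupCenter ℂ G) :
    centerStar ℂ G (centerStar ℂ G z) = z :=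
  Subtype.ext (groupInv_groupInv _)

theorem centerStar_mul (z w : GroupCenter ℂ G) :
    centerStar ℂ G (z * w) = centerStar ℂ G z * centerStar ℂ G w := by
  rw [mul_comm z w]
  exact Subtype.ext (groupInv_mul _ _)

theorem centerStar_one : centerStar ℂ G 1 = 1 := by
  apply Subtype.ext
  rw [centerStar_coe, OneMemClass.coe_one, MonoidAlgebra.one_def, groupInv_single, inv_one]

variable [Fintype G]

theorem sum_single_conj_mem (c : G) :
    (∑ a : G, MonoidAlgebra.single (a * c * a⁻¹) (1 : ℂ)) ∈ GroupCenter ℂ G := by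
  rw [Subalgebra.mem_center_iff]
  intro y
  induction y using MonoidAlgebra.induction_linear with
  | zero => simp
  | add y y' hy hy' => simp [add_mul, mul_add, hy, hy']
  | single h d =>
    simp only [Finset.mul_sum, Finset.sum_mul, MonoidAlgebra.single_mul_single, mul_one, one_mul]
    refine Fintype.sum_equiv (Equiv.mulLeft h) _ _ (fun g => ?_)
    simp [mul_assoc]

/-- The sum of all conjugates of `c`, with multiplicities. -/
def conjSum (c : G) : GroupCenter ℂ G :=
  ⟨∑ a : G, MonoidAlgebra.single (a * c * a⁻¹) (1 : ℂ), sum_single_conj_mem c⟩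

theorem conjSum_conj (a c : G) : conjSum (a * c * a⁻¹) = conjSum c := by
  apply Subtype.ext
  refine Fintype.sum_equiv (Equiv.mulRight a) _ _ (fun g => ?_)
  simp [mul_assoc]

theorem centerStar_conjSum (c : G) : centerStar ℂ G (conjSum c) = conjSum c⁻¹ := by
  apply Subtype.ext
  rw [centerStar_coe]
  simp [conjSum, groupInv_single, mul_assoc]

theorem coeff_conjSum_inv_mul (c : G) (z : GroupCenter ℂ G) :
    (conjSum c⁻¹ * z : GroupCenter ℂ G).1.coeff 1 = Fintype.card G * z.1.coeff c := by
  rw [Subalgebra.coe_mul]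
  simp only [conjSum, Finset.sum_mul, MonoidAlgebra.coeff_sum, Finsupp.finsetSum_apply,
    MonoidAlgebra.coeff_single_mul_apply, mul_one, one_mul]
  have : ∀ a : G, z.1.coeff (a * c⁻¹ * a⁻¹)⁻¹ = z.1.coeff c := fun a => by
    rw [← coeff_conj z a c]
    congr 1
    group
  rw [Finset.sum_congr rfl fun a _ => this a]
  simp

theorem eq_sum_single (z : MonoidAlgebra ℂ G) :
    z = ∑ c, z.coeff c • MonoidAlgebra.single c (1 : ℂ) := by
  ext g
  simp [MonoidAlgebra.coeff_sum, MonoidAlgebra.smul_single]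

theorem sum_coeff_smul_conjSum (z : GroupCenter ℂ G) :
    ∑ c, z.1.coeff c • conjSum c = (Fintype.card G : ℂ) • z := by
  apply Subtype.ext
  have h : ((∑ c, z.1.coeff c • conjSum c : GroupCenter ℂ G) : MonoidAlgebra ℂ G) =
      ∑ c, z.1.coeff c • ∑ a : G, MonoidAlgebra.single (a * c * a⁻¹) (1 : ℂ) := by
    simp [conjSum]
  rw [h]
  simp only [Finset.smul_sum]
  rw [Finset.sum_comm]
  have h2 : ∀ a : G, ∑ c, z.1.coeff c • MonoidAlgebra.single (a * c * a⁻¹) (1 : ℂ) = z.1 := by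
    intro a
    conv_rhs => rw [eq_sum_single z.1]
    refine Fintype.sum_equiv (MulAut.conj a).toEquiv _ _ (fun c => ?_)
    simp [coeff_conj]
  simp only [h2]
  simp [Nat.cast_smul_eq_nsmul]

theorem card_ne_zero_complex : (Fintype.card G : ℂ) ≠ 0 :=
  Nat.cast_ne_zero.2 Fintype.card_ne_zero

theorem centerFunctional_apply (μ : (GroupCenter ℂ G)ˣ) (z : GroupCenter ℂ G) :
    centerFunctional μ z =
      (Fintype.card G : ℂ)⁻¹ * ((μ : GroupCenter ℂ G) ^ 2 * z).1.coeff 1 := rfl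

/-- The elements `μ⁻² conjSum c⁻¹` represent the coefficient functionals. Together with
`sum_coeff_smul_conjSum`, this makes the conjugation sums a reproducing family for multiplication by
`|G|`, from which the Casimir element is computed. -/
theorem centerFunctional_conjSum (μ : (GroupCenter ℂ G)ˣ) (c : G) (z : GroupCenter ℂ G) :
    centerFunctional μ (((↑μ⁻¹ : GroupCenter ℂ G) ^ 2 * conjSum c⁻¹) * z) = z.1.coeff c := by
  have h : (μ : GroupCenter ℂ G) ^ 2 * (((↑μ⁻¹ : GroupCenter ℂ G) ^ 2 * conjSum c⁻¹) * z) =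
      conjSum c⁻¹ * z := by
    have h1 : (μ : GroupCenter ℂ G) * (↑μ⁻¹ : GroupCenter ℂ G) = 1 := Units.mul_inv μ
    calc _ = ((μ : GroupCenter ℂ G) * (↑μ⁻¹ : GroupCenter ℂ G)) ^ 2 * (conjSum c⁻¹ * z) := by ring
      _ = _ := by rw [h1, one_pow, one_mul]
  rw [centerFunctional_apply, h, coeff_conjSum_inv_mul, inv_mul_cancel_left₀ card_ne_zero_complex]

theorem isFrobeniusPair_centerFunctional (μ : (GroupCenter ℂ G)ˣ) :
    IsFrobeniusPair (centerFunctional μ) where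
  symm x y := by rw [mul_comm]
  nondegenerate x hx := by
    have h := sum_coeff_smul_conjSum x
    have h0 : ∀ c, x.1.coeff c = 0 := fun c => by
      rw [← centerFunctional_conjSum μ c x, mul_comm, hx]
    simp only [h0, zero_smul, Finset.sum_const_zero] at h
    exact ((smul_eq_zero.1 h.symm).resolve_left card_ne_zero_complex)

theorem card_smul_casimirStar (μ : (GroupCenter ℂ G)ˣ) (s : GroupCenter ℂ G →ₗ[ℂ] GroupCenter ℂ G) :
    (Fintype.card G : ℂ) • casimirStar (centerFunctional μ) s =
      ∑ c, conjSum c * s ((↑μ⁻¹ : GroupCenter ℂ G) ^ 2 * conjSum c⁻¹) := by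
  rw [(isFrobeniusPair_centerFunctional μ).sum_mul_eq_mul_casimirStar s conjSum
    (fun c => (↑μ⁻¹ : GroupCenter ℂ G) ^ 2 * conjSum c⁻¹) ((Fintype.card G : ℂ) • 1)]
  · rw [smul_mul_assoc, one_mul]
  · intro r
    simp only [centerFunctional_conjSum, sum_coeff_smul_conjSum, smul_mul_assoc, one_mul]

/-- Substituting `c = ab` in `∑ a² b²` gives `∑ a c a⁻¹ c`, that is `∑ conjSum c * c`. As `conjSum`
is a class function, the second factor may be averaged over its conjugates. -/
theorem card_smul_sumSquares_sq :
    (Fintype.card G : ℂ) • sumSquares ℂ G ^ 2 = ∑ c : G, conjSum c ^ 2 := by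
  apply Subtype.ext
  have h1 : ((sumSquares ℂ G ^ 2 : GroupCenter ℂ G) : MonoidAlgebra ℂ G) =
      ∑ c : G, (conjSum c).1 * MonoidAlgebra.single c 1 := by
    have h3 : ((sumSquares ℂ G ^ 2 : GroupCenter ℂ G) : MonoidAlgebra ℂ G) =
        ∑ a : G, ∑ b : G, MonoidAlgebra.single (a ^ 2 * b ^ 2) (1 : ℂ) := by
      rw [sq, Subalgebra.coe_mul]
      simp only [sumSquares, Finset.sum_mul_sum, MonoidAlgebra.single_mul_single, mul_one]
    have h4 : ∑ c : G, (conjSum c).1 * MonoidAlgebra.single c 1 =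
        ∑ c : G, ∑ a : G, MonoidAlgebra.single (a * c * a⁻¹ * c) (1 : ℂ) := by
      simp only [conjSum, Finset.sum_mul, MonoidAlgebra.single_mul_single, mul_one]
    rw [h3, h4, Finset.sum_comm (f := fun c a => MonoidAlgebra.single (a * c * a⁻¹ * c) (1 : ℂ))]
    refine Finset.sum_congr rfl fun a _ => ?_
    refine Fintype.sum_equiv (Equiv.mulLeft a) _ _ (fun b => ?_)
    simp [sq, mul_assoc]
  have h2 : ∀ a : G, ∑ c : G, (conjSum c).1 * MonoidAlgebra.single (a * c * a⁻¹) 1 =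
      ∑ c : G, (conjSum c).1 * MonoidAlgebra.single c 1 := by
    intro a
    refine Fintype.sum_equiv (MulAut.conj a).toEquiv _ _ (fun c => ?_)
    simp [conjSum_conj]
  calc _ = (Fintype.card G : ℂ) • ∑ c : G, (conjSum c).1 * MonoidAlgebra.single c 1 := by
        rw [← h1]; rfl
    _ = ∑ a : G, ∑ c : G, (conjSum c).1 * MonoidAlgebra.single (a * c * a⁻¹) 1 := by
        simp [h2, Nat.cast_smul_eq_nsmul]
    _ = ∑ c : G, (conjSum c).1 * (conjSum c).1 := by
        rw [Finset.sum_comm]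
        refine Finset.sum_congr rfl fun c _ => ?_
        rw [← Finset.mul_sum]; rfl
    _ = _ := by simp [sq]

/-- The involution fixes `μ⁻²` and sends `conjSum c⁻¹` to `conjSum c`, so `|G|` times the Casimir
element is `μ⁻² ∑ (conjSum c)²`. -/
theorem sq_eq_casimirStar (μ : (GroupCenter ℂ G)ˣ)
    (hμ : centerStar ℂ G (μ : GroupCenter ℂ G) = μ) :
    ((↑μ⁻¹ : GroupCenter ℂ G) * sumSquares ℂ G) ^ 2 =
      casimirStar (centerFunctional μ) (centerStar ℂ G) := by
  have hinv : centerStar ℂ G (↑μ⁻¹ : GroupCenter ℂ G) = (↑μ⁻¹ : GroupCenter ℂ G) := by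
    have h : centerStar ℂ G (↑μ⁻¹ : GroupCenter ℂ G) * μ = 1 := by
      have h1 := centerStar_mul (↑μ⁻¹ : GroupCenter ℂ G) μ
      rw [hμ] at h1
      rw [← h1, Units.inv_mul, centerStar_one]
    exact (Units.inv_eq_of_mul_eq_one_left h).symm
  have h := card_smul_casimirStar μ (centerStar ℂ G)
  have h' : ∑ c : G, conjSum c * centerStar ℂ G ((↑μ⁻¹ : GroupCenter ℂ G) ^ 2 * conjSum c⁻¹) =
      (Fintype.card G : ℂ) • ((↑μ⁻¹ : GroupCenter ℂ G) * sumSquares ℂ G) ^ 2 := by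
    rw [mul_pow, ← mul_smul_comm, card_smul_sumSquares_sq, Finset.mul_sum]
    refine Finset.sum_congr rfl fun c _ => ?_
    rw [centerStar_mul, sq, centerStar_mul, hinv, centerStar_conjSum, inv_inv]
    ring
  rw [h'] at h
  exact (smul_right_injective _ (card_ne_zero_complex (G := G)) h).symm

/-- A central nilpotent element generates a nil left ideal, so it lies in the Jacobson radical,
which vanishes by Maschke's theorem. -/
instance isReduced_groupCenter : IsReduced (GroupCenter ℂ G) where
  eq_zero z hz := by
    have hss : IsSemisimpleRing (MonoidAlgebra ℂ G) := by
      have : NeZero (Nat.card G : ℂ) := ⟨by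
        rw [Nat.card_eq_fintype_card]; exact card_ne_zero_complex⟩
      infer_instance
    have hj : z.1 ∈ Ring.jacobson (MonoidAlgebra ℂ G) := by
      rw [← Ideal.jacobson_bot, Ideal.mem_jacobson_iff]
      intro y
      have hn : IsNilpotent (y * z.1) := by
        obtain ⟨n, hn⟩ := hz
        have hn' : z.1 ^ n = 0 := by rw [← Subalgebra.coe_pow, hn]; rfl
        have hcomm : Commute y z.1 := Subalgebra.mem_center_iff.1 z.2 y
        exact ⟨n, by rw [hcomm.mul_pow, hn', mul_zero]⟩
      obtain ⟨u, hu⟩ := hn.isUnit_one_add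
      refine ⟨(↑u⁻¹ : MonoidAlgebra ℂ G), ?_⟩
      have : (↑u⁻¹ : MonoidAlgebra ℂ G) * y * z.1 + (↑u⁻¹ : MonoidAlgebra ℂ G) - 1 = 0 := by
        have h := Units.inv_mul u
        rw [hu, mul_add, mul_one, ← mul_assoc] at h
        rw [← h]
        abel
      rw [this]
      exact Submodule.zero_mem _
    rw [IsSemisimpleRing.jacobson_eq_bot] at hj
    exact Subtype.ext hj

/-- The untwisted Casimir element is used because the one twisted by `⋆` vanishes at characters that
are not self-dual and says nothing about `l_A (idem x)` there. -/
theorem character_casimirStar_id_of_linear (μ : (GroupCenter ℂ G)ˣ) (η : G →* ℂ)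
    (x : GroupCenter ℂ G →ₐ[ℂ] ℂ)
    (hx : ∀ z : GroupCenter ℂ G, x z = MonoidAlgebra.lift ℂ ℂ G η z.1) :
    x (casimirStar (centerFunctional μ) LinearMap.id) =
      (Fintype.card G : ℂ) ^ 2 * (x (μ : GroupCenter ℂ G) ^ 2)⁻¹ := by
  have hc : ∀ c, x (conjSum c) = Fintype.card G * η c := fun c => by
    rw [hx]
    simp only [conjSum, map_sum, MonoidAlgebra.lift_single, one_smul]
    simp only [map_mul]
    have : ∀ a : G, η a * η c * η a⁻¹ = η c := fun a => by
      rw [mul_comm, ← mul_assoc, ← map_mul, inv_mul_cancel, map_one, one_mul]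
    rw [Finset.sum_congr rfl fun a _ => this a]
    simp
  have hinv : x (↑μ⁻¹ : GroupCenter ℂ G) = (x (μ : GroupCenter ℂ G))⁻¹ := by
    apply eq_inv_of_mul_eq_one_left
    rw [← map_mul, Units.inv_mul, map_one]
  have h := congrArg x (card_smul_casimirStar μ LinearMap.id)
  simp only [map_smul, map_sum, map_mul, map_pow, LinearMap.id_apply, hc, hinv, smul_eq_mul] at h
  have hη : ∀ c : G, η c * η c⁻¹ = 1 := fun c => by rw [← map_mul, mul_inv_cancel, map_one]
  have h' : ∀ c : G, (Fintype.card G : ℂ) * η c * ((x (μ : GroupCenter ℂ G))⁻¹ ^ 2 *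
      (Fintype.card G * η c⁻¹)) = (Fintype.card G : ℂ) ^ 2 * ((x (μ : GroupCenter ℂ G)) ^ 2)⁻¹ := by
    intro c
    calc _ = (Fintype.card G : ℂ) ^ 2 * (x (μ : GroupCenter ℂ G))⁻¹ ^ 2 * (η c * η c⁻¹) := by ring
      _ = _ := by rw [hη, mul_one, inv_pow]
  simp only [h', Finset.sum_const, Finset.card_univ, nsmul_eq_mul] at h
  exact mul_left_cancel₀ card_ne_zero_complex h

end GroupCenter

/-! ### Matrix algebras -/

section Matrices

variable {ι : Type*} [Fintype ι] [DecidableEq ι]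

/-- Off-diagonal matrix units are commutators, and the diagonal ones differ by commutators. -/
theorem exists_eq_mul_trace (l : Matrix ι ι ℂ →ₗ[ℂ] ℂ) (hl : ∀ x y, l (x * y) = l (y * x)) :
    ∃ c : ℂ, ∀ x, l x = c * x.trace := by
  rcases isEmpty_or_nonempty ι with h | ⟨⟨i₀⟩⟩
  · exact ⟨0, fun x => by rw [Subsingleton.elim x 0]; simp⟩
  refine ⟨l (Matrix.single i₀ i₀ 1), fun x => ?_⟩
  have hdiag : ∀ i, l (Matrix.single i i 1) = l (Matrix.single i₀ i₀ 1) := fun i => by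
    have h := hl (Matrix.single i i₀ 1) (Matrix.single i₀ i 1)
    simpa using h
  have hoff : ∀ i j, i ≠ j → l (Matrix.single i j 1) = 0 := fun i j hij => by
    have h := hl (Matrix.single i i 1) (Matrix.single i j 1)
    rw [Matrix.single_mul_single_same, Matrix.single_mul_single_of_ne _ _ _ _ hij.symm] at h
    simpa using h
  conv_lhs => rw [Matrix.matrix_eq_sum_single x]
  simp only [map_sum]
  have hs : ∀ i j, Matrix.single i j (x i j) = x i j • Matrix.single i j (1 : ℂ) := fun i j => by
    simp
  simp only [hs, map_smul, smul_eq_mul, Matrix.trace, Matrix.diag, Finset.mul_sum]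
  refine Finset.sum_congr rfl fun i _ => ?_
  rw [Finset.sum_eq_single i]
  · rw [hdiag, mul_comm]
  · intro j _ hj
    rw [hoff i j hj.symm, mul_zero]
  · simp

theorem exists_eq_smul_one (x : Matrix ι ι ℂ) (hx : ∀ y, x * y = y * x) :
    ∃ c : ℂ, x = c • (1 : Matrix ι ι ℂ) := by
  have h : x ∈ Set.range (Matrix.scalar ι) :=
    Matrix.mem_range_scalar_iff_commute_single'.2 fun i j => hx _ |>.symm
  obtain ⟨c, rfl⟩ := h
  exact ⟨c, by rw [Matrix.scalar_apply, Matrix.smul_one_eq_diagonal]⟩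

theorem eq_zero_or_eq_one_of_central (x : Matrix ι ι ℂ) (hx : ∀ y, x * y = y * x)
    (hxx : x * x = x) : x = 0 ∨ x = 1 := by
  rcases isEmpty_or_nonempty ι with h | ⟨⟨i₀⟩⟩
  · exact Or.inl (Subsingleton.elim _ _)
  obtain ⟨c, rfl⟩ := exists_eq_smul_one x hx
  have h := congrFun (congrFun hxx i₀) i₀
  have h' : c * c = c := by simpa using h
  have hc : c = 0 ∨ c = 1 := by
    have h2 : c * (c - 1) = 0 := by rw [mul_sub, h', mul_one, sub_self]
    exact (mul_eq_zero.1 h2).imp_right sub_eq_zero.1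
  rcases hc with rfl | rfl
  · left; rw [zero_smul]
  · right; rw [one_smul]

/-- The homomorphism to a trivial algebra. -/
def toSubsingleton (R S : Type*) [Ring R] [Algebra ℂ R] [Ring S] [Algebra ℂ S] [Subsingleton S] :
    R →ₐ[ℂ] S where
  toFun _ := 0
  map_one' := Subsingleton.elim _ _
  map_mul' _ _ := Subsingleton.elim _ _
  map_zero' := Subsingleton.elim _ _
  map_add' _ _ := Subsingleton.elim _ _
  commutes' _ := Subsingleton.elim _ _

end Matrices

/-! ### The blocks of a semi-simple Cardy-Frobenius algebra -/

section Blocks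

variable {H : EquippedData.{u, v} ℂ}

/-- An element `b` of the block at `x` is orthogonal to `φ (idem y)` for `y ≠ x`, so `φ* b` has only
an `x` component; pairing with `idem x` gives its coefficient. -/
theorem cardy_dual_eq [IsReduced H.A] (hH : IsCardyFrobenius H) (φs : H.B →ₗ[ℂ] H.A)
    (hφs : ∀ (b : H.B) (a : H.A), H.lA (φs b * a) = H.lB (b * H.φ a))
    (x : H.A →ₐ[ℂ] ℂ) (b : H.B) (hb : b * H.φ (idem x) = b) :
    φs b = ((H.lA (idem x))⁻¹ * H.lB b) • idem x := by
  apply ext_character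
  intro y
  have h := hφs b (idem y)
  rw [mul_idem, map_smul, smul_eq_mul] at h
  have hy := hH.frobeniusA.apply_idem_ne_zero y
  by_cases hxy : y = x
  · subst hxy
    rw [hb] at h
    simp only [map_smul, character_idem_self, smul_eq_mul, mul_one]
    rw [← h]
    field_simp
  · have h0 : b * H.φ (idem y) = 0 := by
      rw [← hb, mul_assoc, ← map_mul, idem_mul_of_ne (Ne.symm hxy), map_zero, mul_zero]
    rw [h0, map_zero] at h
    rw [map_smul, character_idem_of_ne hxy, smul_zero]
    exact (mul_eq_zero.1 h).resolve_right hy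

/-- The central idempotent `φ (idem x)` is 0 or 1 on each Wedderburn factor of `B`. Apply the Cardy
condition to rank-one idempotents `E`, `E'` of factors where it is 1. The left side is a nonzero
product, while `b ↦ E b E'` is zero for two different factors, so there is at most one factor. For
`E = E'` the operator has trace one, which gives `c² = l_A (idem x)`. -/
theorem exists_block [IsReduced H.A] (hH : IsCardyFrobenius H) [IsSemisimpleRing H.B]
    (x : H.A →ₐ[ℂ] ℂ) :
    ∃ (m : ℕ) (p : H.B →ₐ[ℂ] Matrix (Fin m) (Fin m) ℂ), Function.Surjective p ∧
      (∀ b, p b = 0 ↔ H.φ (idem x) * b = 0) ∧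
      (m ≠ 0 → ∃ c : ℂ, c ^ 2 = H.lA (idem x) ∧
        ∀ b, H.lB (H.φ (idem x) * b) = c * (p b).trace) := by
  obtain ⟨N, d, hd, ⟨e⟩⟩ := IsSemisimpleRing.exists_algEquiv_pi_matrix_of_isAlgClosed ℂ H.B
  have hP : ∀ j, e (H.φ (idem x)) j = 0 ∨ e (H.φ (idem x)) j = 1 := by
    intro j
    apply eq_zero_or_eq_one_of_central
    · intro y
      have h := congrArg e (hH.central (idem x) (e.symm (Pi.single j y)))
      rw [map_mul, map_mul, AlgEquiv.apply_symm_apply] at h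
      have := congrFun h j
      simpa using this
    · rw [← Pi.mul_apply, ← map_mul, ← map_mul, idem_mul_self]
  by_cases hex : ∃ j, e (H.φ (idem x)) j = 1
  · obtain ⟨j, hj⟩ := hex
    obtain ⟨φs, hφs, hcardy⟩ := hH.cardy
    let inc : ∀ j, Matrix (Fin (d j)) (Fin (d j)) ℂ →ₗ[ℂ] H.B := fun j =>
      e.symm.toLinearMap ∘ₗ LinearMap.single ℂ (fun i => Matrix (Fin (d i)) (Fin (d i)) ℂ) j
    have hinc : ∀ j X, inc j X = e.symm (Pi.single j X) := fun j X => rfl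
    have hincmul : ∀ j X b, inc j X * b = inc j (X * e b j) := by
      intro j X b
      apply e.injective
      rw [hinc, hinc, map_mul, AlgEquiv.apply_symm_apply, AlgEquiv.apply_symm_apply]
      ext i : 1
      by_cases hi : i = j
      · subst hi; simp
      · simp [Pi.single_eq_of_ne hi]
    have hmulinc : ∀ j X b, b * inc j X = inc j (e b j * X) := by
      intro j X b
      apply e.injective
      rw [hinc, hinc, map_mul, AlgEquiv.apply_symm_apply, AlgEquiv.apply_symm_apply]
      ext i : 1
      by_cases hi : i = j
      · subst hi; simp
      · simp [Pi.single_eq_of_ne hi]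
    have hc : ∀ j, ∃ c : ℂ, ∀ X, H.lB (inc j X) = c * X.trace := by
      intro j
      refine exists_eq_mul_trace (H.lB ∘ₗ inc j) fun X Y => ?_
      simp only [LinearMap.comp_apply]
      have h1 : ∀ X Y, inc j X * inc j Y = inc j (X * Y) := fun X Y => by
        rw [hincmul, hinc j Y, AlgEquiv.apply_symm_apply, Pi.single_eq_same]
      rw [← h1, ← h1, hH.frobeniusB.symm]
    choose c hc using hc
    have hc0 : ∀ j, c j ≠ 0 := by
      intro j h
      have h0 : inc j 1 = 0 := by
        apply hH.frobeniusB.nondegenerate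
        intro y
        rw [hincmul, hc, h, zero_mul]
      rw [hinc, map_eq_zero_iff _ e.symm.injective, Pi.single_eq_zero_iff] at h0
      exact one_ne_zero h0
    let E : ∀ j, Matrix (Fin (d j)) (Fin (d j)) ℂ := fun j => Matrix.single 0 0 1
    have htrE : ∀ j, (E j).trace = 1 := fun j => by simp [E]
    have hdual : ∀ j, e (H.φ (idem x)) j = 1 →
        φs (inc j (E j)) = ((H.lA (idem x))⁻¹ * c j) • idem x := by
      intro j hj
      rw [cardy_dual_eq hH φs hφs x _ (by rw [hincmul, hj, mul_one]), hc, htrE, mul_one]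
    have hlx := hH.frobeniusA.apply_idem_ne_zero x
    have hpair : ∀ j j', e (H.φ (idem x)) j = 1 → e (H.φ (idem x)) j' = 1 →
        H.lA (φs (inc j (E j)) * φs (inc j' (E j'))) = c j * c j' * (H.lA (idem x))⁻¹ := by
      intro j j' h h'
      rw [hdual j h, hdual j' h', smul_mul_smul_comm, idem_mul_self, map_smul, smul_eq_mul]
      field_simp
    have huniq : ∀ j', j' ≠ j → e (H.φ (idem x)) j' = 0 := by
      intro j' hne
      refine (hP j').resolve_right fun hj' => ?_
      have h1 := hpair j' j hj' hj
      rw [hcardy] at h1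
      -- Multiplying on the left by factor `j'` and on the right by factor `j` annihilates
      -- everything.
      have h0 : LinearMap.mulLeft ℂ (inc j' (E j')) ∘ₗ LinearMap.mulRight ℂ (inc j (E j)) = 0 := by
        ext b
        simp only [LinearMap.comp_apply, LinearMap.mulLeft_apply, LinearMap.mulRight_apply,
          LinearMap.zero_apply]
        rw [hmulinc, hincmul, hinc j, AlgEquiv.apply_symm_apply, Pi.single_eq_of_ne hne, mul_zero,
          map_zero]
      rw [h0, map_zero] at h1
      exact mul_ne_zero (mul_ne_zero (hc0 j') (hc0 j)) (inv_ne_zero hlx) h1.symm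
    have hφ : H.φ (idem x) = inc j 1 := by
      apply e.injective
      rw [hinc, AlgEquiv.apply_symm_apply]
      ext i : 1
      by_cases hi : i = j
      · subst hi; simp [hj]
      · rw [huniq i hi, Pi.single_eq_of_ne hi]
    refine ⟨d j, (Pi.evalAlgHom ℂ (fun i => Matrix (Fin (d i)) (Fin (d i)) ℂ) j).comp (e : H.B →ₐ[ℂ] _), ?_, ?_, fun _ => ⟨c j, ?_, ?_⟩⟩
    · intro X
      exact ⟨inc j X, by simp [hinc]⟩
    · intro b
      rw [hφ, hincmul, one_mul, hinc, map_eq_zero_iff _ e.symm.injective, Pi.single_eq_zero_iff]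
      rfl
    · have h1 := hpair j j hj hj
      rw [hcardy] at h1
      -- The operator `b ↦ E b E` is `b ↦ f b • E`, of rank one and trace `f E = 1`.
      let f : H.B →ₗ[ℂ] ℂ := Matrix.entryLinearMap ℂ ℂ 0 0 ∘ₗ LinearMap.proj j ∘ₗ e.toLinearMap
      have hf : ∀ b, f b = e b j 0 0 := fun b => rfl
      have h0 : LinearMap.mulLeft ℂ (inc j (E j)) ∘ₗ LinearMap.mulRight ℂ (inc j (E j)) =
          f.smulRight (inc j (E j)) := by
        ext b
        simp only [LinearMap.comp_apply, LinearMap.mulLeft_apply, LinearMap.mulRight_apply,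
          LinearMap.smulRight_apply]
        rw [hmulinc, hincmul, hinc j (e b j * E j), AlgEquiv.apply_symm_apply, Pi.single_eq_same, hf,
          ← map_smul]
        congr 1
        rw [← mul_assoc, Matrix.single_mul_mul_single]
        simp [E]
      rw [h0, LinearMap.trace_smulRight, hf, hinc, AlgEquiv.apply_symm_apply, Pi.single_eq_same] at h1
      simp only [E, Matrix.single_apply_same] at h1
      field_simp at h1
      exact h1.symm
    · intro b
      rw [hφ, hincmul, one_mul, hc]
      rfl
  · push Not at hex
    have h0 : H.φ (idem x) = 0 := by
      apply e.injective
      rw [map_zero]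
      ext j : 1
      exact (hP j).resolve_right (hex j)
    refine ⟨0, toSubsingleton _ _, fun X => ⟨0, Subsingleton.elim _ _⟩, fun b => ?_, fun h => absurd rfl h⟩
    rw [h0, zero_mul]
    exact iff_of_true (Subsingleton.elim _ _) rfl

end Blocks

/-! ### Skolem–Noether for surjections onto a matrix algebra. -/

section Conjugate

variable {R : Type*} [Ring R] [Algebra ℂ R] {ι : Type*} [Fintype ι] [DecidableEq ι]

/-- The map `q` factors through `p`; the induced surjective endomorphism of the matrix algebra is an
automorphism by dimension, hence inner. -/
theorem exists_conj_of_ker_le (p q : R →ₐ[ℂ] Matrix ι ι ℂ) (hp : Function.Surjective p)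
    (hq : Function.Surjective q) (h : ∀ b, p b = 0 → q b = 0) :
    ∃ K L : Matrix ι ι ℂ, K * L = 1 ∧ L * K = 1 ∧ ∀ b, q b = K * p b * L := by
  let ψ : Matrix ι ι ℂ →ₐ[ℂ] Matrix ι ι ℂ :=
    (Ideal.Quotient.liftₐ (RingHom.ker p) q fun a ha => h a ha).comp
      (Ideal.quotientKerAlgEquivOfSurjective hp).symm.toAlgHom
  have hψ : ∀ b, ψ (p b) = q b := fun b => by
    have : (Ideal.quotientKerAlgEquivOfSurjective hp).symm (p b) =
        Ideal.Quotient.mk (RingHom.ker p) b := by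
      rw [AlgEquiv.symm_apply_eq]; rfl
    simp only [ψ, AlgHom.comp_apply]
    erw [this]
    rfl
  have hsurj : Function.Surjective ψ := fun X => by
    obtain ⟨b, rfl⟩ := hq X
    exact ⟨p b, hψ b⟩
  have hinj : Function.Injective ψ := LinearMap.injective_iff_surjective (f := ψ.toLinearMap) |>.2 hsurj
  let e : Matrix ι ι ℂ ≃ₐ[ℂ] Matrix ι ι ℂ := AlgEquiv.ofBijective ψ ⟨hinj, hsurj⟩
  let t : Matrix ι ι ℂ ≃ₐ[ℂ] Module.End ℂ (ι → ℂ) := Matrix.toLinAlgEquiv'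
  obtain ⟨T, hT⟩ := ((t.symm.trans e).trans t).eq_linearEquivConjAlgEquiv
  refine ⟨t.symm T.toLinearMap, t.symm T.symm.toLinearMap, ?_, ?_, fun b => ?_⟩
  · rw [← map_mul, Module.End.mul_eq_comp, LinearEquiv.comp_coe, LinearEquiv.symm_trans_self]
    exact map_one t.symm
  · rw [← map_mul, Module.End.mul_eq_comp, LinearEquiv.comp_coe, LinearEquiv.self_trans_symm]
    exact map_one t.symm
  · have h1 := congrArg t.symm (AlgEquiv.congr_fun hT (t (p b)))
    simp only [AlgEquiv.trans_apply, AlgEquiv.symm_apply_apply] at h1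
    rw [← hψ b]
    change e (p b) = _
    rw [h1]
    apply t.injective
    rw [map_mul, map_mul]
    simp only [AlgEquiv.apply_symm_apply]
    rfl

end Conjugate

/-! ### The involution on characters and on self-dual blocks. -/

section Involution

variable {H : EquippedData.{u, v} ℂ} (hH : IsEquippedCardyFrobenius H)

include hH in
theorem starA_one : H.starA 1 = 1 := by
  have h := hH.starA_mul (H.starA 1) 1
  rwa [mul_one, hH.starA_starA, mul_one, eq_comm] at h

include hH in
theorem starB_one : H.starB 1 = 1 := by
  have h := hH.starB_mul (H.starB 1) 1
  rwa [mul_one, hH.starB_starB, mul_one, eq_comm] at h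

/-- The involution of `A` as an algebra homomorphism. -/
def starAHom : H.A →ₐ[ℂ] H.A :=
  AlgHom.ofLinearMap H.starA (starA_one hH) fun a b => by rw [hH.starA_mul, mul_comm]

@[simp]
theorem starAHom_apply (a : H.A) : starAHom hH a = H.starA a := rfl

/-- The representation `b ↦ p (b⋆)ᵀ`. -/
def dualHom {ι : Type*} [Fintype ι] [DecidableEq ι] (p : H.B →ₐ[ℂ] Matrix ι ι ℂ) :
    H.B →ₐ[ℂ] Matrix ι ι ℂ :=
  AlgHom.ofLinearMap ((Matrix.transposeLinearEquiv ι ι ℂ ℂ).toLinearMap ∘ₗ p.toLinearMap ∘ₗ H.starB)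
    (by simp [starB_one hH]) (fun a b => by simp [hH.starB_mul])

@[simp]
theorem dualHom_apply {ι : Type*} [Fintype ι] [DecidableEq ι] (p : H.B →ₐ[ℂ] Matrix ι ι ℂ)
    (b : H.B) : dualHom hH p b = (p (H.starB b)).transpose := rfl

variable [IsReduced H.A]

theorem star_idem (x : H.A →ₐ[ℂ] ℂ) : H.starA (idem x) = idem (x.comp (starAHom hH)) := by
  apply ext_character
  intro y
  have h1 : y (H.starA (idem x)) = (y.comp (starAHom hH)) (idem x) := rfl
  rw [h1]
  by_cases h : y = x.comp (starAHom hH)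
  · have h' : y.comp (starAHom hH) = x := by
      rw [h]; ext a; simp [hH.starA_starA]
    rw [h', h, character_idem_self, character_idem_self]
  · have h' : y.comp (starAHom hH) ≠ x := by
      rintro rfl
      apply h
      ext a; simp [hH.starA_starA]
    rw [character_idem_of_ne h, character_idem_of_ne h']

theorem block_φ {x : H.A →ₐ[ℂ] ℂ} {ι : Type*} [Fintype ι] [DecidableEq ι]
    {p : H.B →ₐ[ℂ] Matrix ι ι ℂ} (hker : ∀ b, p b = 0 ↔ H.φ (idem x) * b = 0) (a : H.A) :
    p (H.φ a) = x a • 1 := by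
  have h : p (H.φ a - x a • 1) = 0 := by
    rw [hker, mul_sub, ← map_mul, mul_comm, mul_idem, mul_smul_comm, mul_one, map_smul, sub_self]
  rw [map_sub, map_smul, map_one, sub_eq_zero] at h
  exact h

/-- This sum turns the Casimir element of a block twisted by an adjoint into a comparison of the
form with its transpose. -/
theorem sum_single_mul_mul_single {ι : Type*} [Fintype ι] [DecidableEq ι] (Y : Matrix ι ι ℂ) :
    ∑ k : ι × ι, Matrix.single k.1 k.2 (1 : ℂ) * Y * Matrix.single k.1 k.2 1 = Y.transpose := by
  rw [Matrix.matrix_eq_sum_single Y.transpose, Fintype.sum_prod_type]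
  simp [Matrix.single_mul_mul_single]

include hH in
/-- On a block fixed by the involution, `⋆` is the adjoint with respect to a form which is
symmetric or skew-symmetric, and the element `U` knows which. -/
theorem exists_form_of_block {x : H.A →ₐ[ℂ] ℂ} (hx : x.comp (starAHom hH) = x) {m : ℕ}
    {p : H.B →ₐ[ℂ] Matrix (Fin m) (Fin m) ℂ} (hp : Function.Surjective p)
    (hker : ∀ b, p b = 0 ↔ H.φ (idem x) * b = 0) (c : ℂ) (hc0 : c ≠ 0)
    (hc : ∀ b, H.lB (H.φ (idem x) * b) = c * (p b).trace) :
    ∃ K L : Matrix (Fin m) (Fin m) ℂ, K * L = 1 ∧ L * K = 1 ∧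
      (∀ b, p (H.starB b) = L * (p b).transpose * K) ∧
      (m ≠ 0 → (c * x H.U) ^ 2 = 1 ∧ K.transpose = (c * x H.U) • K) := by
  have hstar : ∀ b, p b = 0 → p (H.starB b) = 0 := by
    intro b hb
    rw [hker] at hb ⊢
    have h := congrArg H.starB hb
    rwa [hH.starB_mul, ← hH.φ_star, star_idem hH, hx, map_zero, ← hH.central] at h
  -- The representations `p` and `b ↦ p (b⋆)ᵀ` are both onto, and the second vanishes on the kernel
  -- of the first because `⋆` fixes `idem x`. The intertwiner between them is, up to transposition,
  -- the matrix of the form.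
  obtain ⟨P, Q, hPQ, hQP, hconj⟩ := exists_conj_of_ker_le p (dualHom hH p) hp
    (fun X => by
      obtain ⟨b, hb⟩ := hp X.transpose
      exact ⟨H.starB b, by simp [hH.starB_starB, hb]⟩)
    (fun b hb => by simp [hstar b hb])
  have hPQ' : Q.transpose * P.transpose = 1 := by
    rw [← Matrix.transpose_mul, hPQ, Matrix.transpose_one]
  have hQP' : P.transpose * Q.transpose = 1 := by
    rw [← Matrix.transpose_mul, hQP, Matrix.transpose_one]
  have hps : ∀ b, p (H.starB b) = Q.transpose * (p b).transpose * P.transpose := by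
    intro b
    have h := congrArg Matrix.transpose (hconj b)
    rw [dualHom_apply, Matrix.transpose_transpose] at h
    rw [h, Matrix.transpose_mul, Matrix.transpose_mul, mul_assoc]
  refine ⟨P.transpose, Q.transpose, hQP', hPQ', hps, fun hm => ?_⟩
  have : NeZero m := ⟨hm⟩
  -- the operator comparing the form with its transpose is central
  have hcomm : ∀ b, (Q.transpose * P) * p b = p b * (Q.transpose * P) := by
    intro b
    have h : p b = Q.transpose * (P * p b * Q) * P.transpose := by
      conv_lhs => rw [← hH.starB_starB b, hps, hps]
      simp [Matrix.transpose_mul, mul_assoc]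
    have h2 : p b * (Q.transpose * P) =
        Q.transpose * P * p b * (Q * (P.transpose * Q.transpose) * P) := by
      conv_lhs => rw [h]
      simp only [mul_assoc]
    rw [h2, hQP', mul_one, hQP, mul_one]
  obtain ⟨ε, hε⟩ := exists_eq_smul_one (Q.transpose * P) fun Y => by
    obtain ⟨b, rfl⟩ := hp Y
    exact hcomm b
  have hP : P = ε • P.transpose := by
    calc P = P.transpose * (Q.transpose * P) := by rw [← mul_assoc, hQP', one_mul]
      _ = ε • P.transpose := by rw [hε, mul_smul_comm, mul_one]
  have hP' : P.transpose = ε • P := by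
    conv_lhs => rw [hP]
    rw [Matrix.transpose_smul, Matrix.transpose_transpose]
  -- Transposing twice multiplies the form by `ε²`.
  have hεε : ε ^ 2 = 1 := by
    have h : ε ^ 2 • (1 : Matrix (Fin m) (Fin m) ℂ) = (1 : ℂ) • 1 := by
      rw [one_smul]
      calc ε ^ 2 • (1 : Matrix (Fin m) (Fin m) ℂ) = Q * (ε • ε • P) := by
            rw [smul_smul, mul_smul_comm, hQP, sq]
        _ = 1 := by rw [← hP', ← hP, hQP]
    have h' := congrFun (congrFun h 0) 0
    simpa using h'
  choose s hs using hp
  -- Lifts of the matrix units `Eᵢⱼ` have duals `c⁻¹ Eⱼᵢ` for the form `c · tr`, so they compute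
  -- `φ(U)` on this block.
  have hcas := hH.frobeniusB.sum_mul_eq_mul_casimirStar H.starB (T := Fin m × Fin m)
    (fun k => H.φ (idem x) * s (Matrix.single k.1 k.2 1))
    (fun k => c⁻¹ • (H.φ (idem x) * s (Matrix.single k.2 k.1 1))) (H.φ (idem x)) (by
      intro r
      have h1 : ∀ k : Fin m × Fin m,
          H.lB (c⁻¹ • (H.φ (idem x) * s (Matrix.single k.2 k.1 1)) * r) = p r k.1 k.2 := by
        intro k
        rw [smul_mul_assoc, map_smul, mul_assoc, hc, map_mul, hs, Matrix.trace_single_mul,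
          smul_eq_mul, inv_mul_cancel_left₀ hc0]
        simp
      simp only [h1]
      simp only [← mul_smul_comm, ← Finset.mul_sum]
      rw [← sub_eq_zero, ← mul_sub, ← hker, map_sub, sub_eq_zero, map_sum]
      simp only [map_smul, hs]
      conv_rhs => rw [Matrix.matrix_eq_sum_single (p r)]
      rw [Fintype.sum_prod_type]
      simp)
  have hone : p (H.φ (idem x)) = 1 := by
    rw [block_φ hker, character_idem_self, one_smul]
  have hU : c * x H.U = ε := by
    have h := congrArg p hcas
    rw [map_mul, hone, one_mul, ← hH.φ_U, block_φ hker, map_sum] at h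
    simp only [map_mul, map_smul, hs, hps, hone, one_mul, Matrix.transpose_single,
      mul_smul_comm] at h
    rw [← Finset.smul_sum] at h
    -- Thus `x(U)` acts as `c⁻¹ Q Pᵀ = c⁻¹ ε Q P = c⁻¹ ε`.
    have h2 : ∑ k : Fin m × Fin m, Matrix.single k.1 k.2 (1 : ℂ) *
        (Q.transpose * Matrix.single k.1 k.2 1 * P.transpose) = Q * P.transpose := by
      simp only [← mul_assoc, ← Finset.sum_mul]
      rw [sum_single_mul_mul_single, Matrix.transpose_transpose]
    rw [h2, hP', mul_smul_comm, hQP] at h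
    have h3 := congrFun (congrFun h 0) 0
    simp only [Matrix.smul_apply, Matrix.one_apply_eq, smul_eq_mul, mul_one] at h3
    rw [← h3, mul_inv_cancel_left₀ hc0]
  rw [hU]
  exact ⟨hεε, by rw [Matrix.transpose_transpose]; exact hP⟩

end Involution

/-! ### Normal forms of symmetric and skew-symmetric complex forms -/

section NormalForms

/-- Non-degenerate complex quadratic forms of equal rank are equivalent; `P` is the matrix of an
isometry from `K` to the standard form. -/
theorem exists_eq_transpose_mul_self {m : ℕ} {K L : Matrix (Fin m) (Fin m) ℂ} (hKL : K * L = 1)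
    (hK : K.transpose = K) :
    ∃ P : Matrix (Fin m) (Fin m) ℂ, K = P.transpose * P := by
  let B : LinearMap.BilinForm ℂ (Fin m → ℂ) := Matrix.toBilin' K
  let B₁ : LinearMap.BilinForm ℂ (Fin m → ℂ) := Matrix.toBilin' 1
  have hs : ∀ (M : Matrix (Fin m) (Fin m) ℂ), M.transpose = M →
      QuadraticMap.associated (R := ℂ) (Matrix.toBilin' M).toQuadraticMap = Matrix.toBilin' M := by
    intro M hM
    apply QuadraticMap.associated_left_inverse
    intro x y
    simp only [Matrix.toBilin'_apply']
    rw [Matrix.dotProduct_mulVec, ← Matrix.mulVec_transpose, hM, dotProduct_comm]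
  have hsep : ∀ (M N : Matrix (Fin m) (Fin m) ℂ), M * N = 1 →
      (Matrix.toBilin' M).SeparatingLeft := by
    intro M N hMN
    have hdet : M.det ≠ 0 := fun h => by
      have := congrArg Matrix.det hMN
      simp [h] at this
    exact (Matrix.nondegenerate_toBilin'_iff.2 (Matrix.nondegenerate_of_det_ne_zero hdet)).1
  obtain ⟨e⟩ := QuadraticForm.equivalent_of_isAlgClosed B.toQuadraticMap B₁.toQuadraticMap
    (by rw [hs K hK]; exact hsep K L hKL) (by
      rw [hs 1 Matrix.transpose_one]; exact hsep 1 1 (one_mul 1))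
  have he : ∀ v w, B₁ (e v) (e w) = B v w := by
    intro v w
    have h1 := hs K hK
    have h2 := hs 1 Matrix.transpose_one
    change QuadraticMap.associated (R := ℂ) B.toQuadraticMap = B at h1
    change QuadraticMap.associated (R := ℂ) B₁.toQuadraticMap = B₁ at h2
    have h3 : B₁ (e v) (e w) = QuadraticMap.associated (R := ℂ) B₁.toQuadraticMap (e v) (e w) := by
      rw [h2]
    have h4 : B v w = QuadraticMap.associated (R := ℂ) B.toQuadraticMap v w := by rw [h1]
    rw [h3, h4]
    simp only [QuadraticMap.associated_apply, ← map_add, QuadraticMap.IsometryEquiv.map_app]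
  refine ⟨LinearMap.toMatrix' e.toLinearEquiv.toLinearMap, ?_⟩
  apply Matrix.toBilin'.injective
  refine LinearMap.ext₂ fun v w => ?_
  have h := he v w
  change B v w = _
  rw [← h]
  simp only [B₁, Matrix.toBilin'_apply', Matrix.one_mulVec, ← Matrix.mulVec_mulVec,
    Matrix.dotProduct_mulVec, Matrix.vecMul_transpose, LinearMap.toMatrix'_mulVec]
  rfl

/-- The standard symplectic matrix of size two. -/
def sympl : Matrix (Fin 2) (Fin 2) ℂ := !![0, 1; -1, 0]

/-- A hyperbolic family that does not yet span can be enlarged by one pair. If none spanned there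
would be families of every length, contradicting the linear independence of the `eᵢ`. -/
theorem exists_symplectic_family {V : Type*} [AddCommGroup V] [Module ℂ V] [FiniteDimensional ℂ V]
    (ω : LinearMap.BilinForm ℂ V) (hskew : ∀ x y, ω x y = -ω y x)
    (hnd : ∀ x, (∀ y, ω x y = 0) → x = 0) :
    ∃ (r : ℕ) (e f : Fin r → V), (∀ i j, ω (e i) (e j) = 0) ∧ (∀ i j, ω (f i) (f j) = 0) ∧
      (∀ i j, ω (e i) (f j) = if i = j then 1 else 0) ∧
      ∀ v, v = ∑ i, (ω v (f i) • e i - ω v (e i) • f i) := by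
  by_contra hcon
  push Not at hcon
  have hall : ∀ r : ℕ, ∃ (e f : Fin r → V), (∀ i j, ω (e i) (e j) = 0) ∧
      (∀ i j, ω (f i) (f j) = 0) ∧ (∀ i j, ω (e i) (f j) = if i = j then 1 else 0) := by
    intro r
    induction r with
    | zero => exact ⟨Fin.elim0, Fin.elim0, fun i => i.elim0, fun i => i.elim0, fun i => i.elim0⟩
    | succ r ih =>
      obtain ⟨e, f, hee, hff, hef⟩ := ih
      obtain ⟨v, hv⟩ := hcon r e f hee hff hef
      have hfe : ∀ i j, ω (f i) (e j) = if i = j then -1 else 0 := fun i j => by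
        rw [hskew, hef]
        by_cases h : i = j
        · simp [h]
        · simp [h, Ne.symm h]
      -- The projection to the orthogonal complement of the family. A vector outside the span has
      -- nonzero projection, and a partner of it can be projected as well without changing the
      -- pairing.
      let pr : V → V := fun v => v - ∑ i, (ω v (f i) • e i - ω v (e i) • f i)
      have hpre : ∀ v j, ω (pr v) (e j) = 0 := fun v j => by
        simp [pr, hee, hfe, LinearMap.sum_apply]
      have hprf : ∀ v j, ω (pr v) (f j) = 0 := fun v j => by
        simp [pr, hff, hef, LinearMap.sum_apply]
      have hpv : pr v ≠ 0 := fun h => hv (sub_eq_zero.1 h)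
      obtain ⟨w, hw⟩ : ∃ w, ω (pr v) w ≠ 0 := by
        by_contra! h
        exact hpv (hnd _ h)
      have hw' : ω (pr v) (pr w) = ω (pr v) w := by
        conv_lhs => rw [show pr w = w - ∑ i, (ω w (f i) • e i - ω w (e i) • f i) from rfl]
        simp [hpre, hprf, map_sum]
      have hself : ∀ x, ω x x = 0 := fun x => by
        have := hskew x x
        exact self_eq_neg.1 this
      refine ⟨Fin.cons (pr v) e, Fin.cons ((ω (pr v) w)⁻¹ • pr w) f, ?_, ?_, ?_⟩
      · intro i j
        refine Fin.cases ?_ (fun i => ?_) i <;> refine Fin.cases ?_ (fun j => ?_) j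
        · simp [hself]
        · simp [hpre]
        · rw [hskew]; simp [hpre]
        · simp [hee]
      · intro i j
        refine Fin.cases ?_ (fun i => ?_) i <;> refine Fin.cases ?_ (fun j => ?_) j
        · simp [hself]
        · simp [hprf]
        · rw [hskew]; simp [hprf]
        · simp [hff]
      · intro i j
        refine Fin.cases ?_ (fun i => ?_) i <;> refine Fin.cases ?_ (fun j => ?_) j
        · simp [hw', hw]
        · simp [hprf, (Fin.succ_ne_zero j).symm]
        · rw [hskew]; simp [hpre, Fin.succ_ne_zero i]
        · simp [hef]
  obtain ⟨e, f, -, -, hef⟩ := hall (Module.finrank ℂ V + 1)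
  have hli : LinearIndependent ℂ e := by
    rw [Fintype.linearIndependent_iff]
    intro g hg j
    have h := congrArg (fun x => ω x (f j)) hg
    simpa [LinearMap.sum_apply, hef] using h
  have := hli.fintype_card_le_finrank
  simp at this

theorem exists_eq_transpose_sympl_mul {m : ℕ} {K L : Matrix (Fin m) (Fin m) ℂ} (hKL : K * L = 1)
    (hK : K.transpose = -K) :
    ∃ (r : ℕ) (P : Matrix (Fin r × Fin 2) (Fin m) ℂ) (P' : Matrix (Fin m) (Fin r × Fin 2) ℂ),
      P * P' = 1 ∧ P' * P = 1 ∧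
      K = P.transpose * Matrix.kroneckerMap (· * ·) (1 : Matrix (Fin r) (Fin r) ℂ) sympl * P := by
  let ω : LinearMap.BilinForm ℂ (Fin m → ℂ) := Matrix.toBilin' K
  have hskew : ∀ x y, ω x y = -ω y x := fun x y => by
    simp only [ω, Matrix.toBilin'_apply']
    rw [Matrix.dotProduct_mulVec, ← Matrix.mulVec_transpose, hK, dotProduct_comm, Matrix.neg_mulVec,
      dotProduct_neg]
  obtain ⟨r, e, f, hee, hff, hef, hspan⟩ := exists_symplectic_family ω hskew (by
    have hdet : K.det ≠ 0 := fun h => by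
      have := congrArg Matrix.det hKL
      simp [h] at this
    exact (Matrix.nondegenerate_toBilin'_iff.2 (Matrix.nondegenerate_of_det_ne_zero hdet)).1)
  have hfe : ∀ i j, ω (f i) (e j) = if i = j then -1 else 0 := fun i j => by
    rw [hskew, hef]
    by_cases h : i = j
    · simp [h]
    · simp [h, Ne.symm h]
  -- `P` takes coordinates in the symplectic basis, by pairing with `fᵢ` and with `-eᵢ`; the columns
  -- of `P'` are the basis vectors.
  let P : Matrix (Fin r × Fin 2) (Fin m) ℂ := Matrix.of fun p k =>
    if p.2 = 0 then ω (Pi.single k 1) (f p.1) else -ω (Pi.single k 1) (e p.1)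
  let P' : Matrix (Fin m) (Fin r × Fin 2) ℂ := Matrix.of fun k p =>
    if p.2 = 0 then e p.1 k else f p.1 k
  have hω : ∀ v w, ω v w = ∑ k, v k * ω (Pi.single k 1) w := fun v w => by
    conv_lhs => rw [pi_eq_sum_univ' v]
    simp [LinearMap.sum_apply, map_sum]
  refine ⟨r, P, P', ?_, ?_, ?_⟩
  · ext ⟨i, s⟩ ⟨j, t⟩
    rw [Matrix.mul_apply]
    fin_cases s <;> fin_cases t
    · have h := hω (e j) (f i)
      rw [hef] at h
      simp only [P, P', Matrix.of_apply, Matrix.one_apply]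
      simp [mul_comm, ← h, eq_comm]
    · have h := hω (f j) (f i)
      rw [hff] at h
      simp only [P, P', Matrix.of_apply, Matrix.one_apply]
      simp [mul_comm, ← h, eq_comm]
    · have h := hω (e j) (e i)
      rw [hee] at h
      simp only [P, P', Matrix.of_apply, Matrix.one_apply]
      simp [mul_comm, ← h, eq_comm]
    · have h := hω (f j) (e i)
      rw [hfe] at h
      simp only [P, P', Matrix.of_apply, Matrix.one_apply]
      simp [mul_comm, ← h, eq_comm]
      split_ifs <;> simp
  · ext k l
    have h := congrFun (hspan (Pi.single l 1)) k
    rw [Matrix.mul_apply, Fintype.sum_prod_type]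
    simp only [P, P', Matrix.of_apply, Fin.sum_univ_two]
    rw [Matrix.one_apply, ← Pi.single_apply, h, Finset.sum_apply]
    refine Finset.sum_congr rfl fun i _ => ?_
    simp
    ring
  · ext k l
    have hkl : K k l = ω (Pi.single k 1) (Pi.single l 1) := by
      simp [ω, Matrix.toBilin'_apply']
    rw [hkl]
    conv_lhs => rw [hspan (Pi.single k 1)]
    rw [Matrix.mul_assoc, Matrix.mul_apply, Fintype.sum_prod_type, map_sum, LinearMap.sum_apply]
    refine Finset.sum_congr rfl fun i _ => ?_
    simp only [Fin.sum_univ_two, Matrix.mul_apply, Fintype.sum_prod_type, Matrix.kroneckerMap_apply,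
      Matrix.one_apply, Matrix.transpose_apply]
    simp [sympl, P]
    rw [hskew (e i), hskew (f i)]
    ring

end NormalForms

/-! ### The representations of `Q₈ × ℤ/3ℤ` -/

section BaseGroup

/-- The group `Q₈ × ℤ/3ℤ`. -/
abbrev Q8Z3 : Type := QuaternionGroup 2 × Multiplicative (ZMod 3)

/-- A non-trivial real character of `Q₈`. -/
def quaternionSign : QuaternionGroup 2 →* ℤ where
  toFun
    | .a _ => 1
    | .xa _ => -1
  map_one' := rfl
  map_mul' := by rintro (i | i) (j | j) <;> rfl

/-- Left multiplication of quaternions by `i`. -/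
def quaternionI : Matrix (Fin 4) (Fin 4) ℤ :=
  !![0, -1, 0, 0; 1, 0, 0, 0; 0, 0, 0, -1; 0, 0, 1, 0]

/-- Left multiplication of quaternions by `j`. -/
def quaternionJ : Matrix (Fin 4) (Fin 4) ℤ :=
  !![0, 0, -1, 0; 0, 0, 0, 1; 1, 0, 0, 0; 0, -1, 0, 0]

/-- The action of `Q₈` on the quaternions by left multiplications. -/
def quaternionRep : QuaternionGroup 2 →* Matrix (Fin 4) (Fin 4) ℤ where
  toFun
    | .a i => quaternionI ^ (ZMod.val i)
    | .xa i => quaternionJ * quaternionI ^ (ZMod.val i)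
  map_one' := by decide +kernel
  map_mul' := by decide +kernel

theorem quaternionRep_transpose (g : QuaternionGroup 2) :
    (quaternionRep g).transpose * quaternionRep g = 1 := by
  revert g; decide +kernel

theorem quaternionRep_inv (g : QuaternionGroup 2) :
    quaternionRep g⁻¹ = (quaternionRep g).transpose := by
  revert g; decide +kernel

/-- A complex character of order six. -/
def sextic : Q8Z3 →* ℂ :=
  ((Int.castRingHom ℂ).toMonoidHom.comp (quaternionSign.comp (MonoidHom.fst _ _))) *
    ((ZMod.stdAddChar (N := 3)).toMonoidHom.comp (MonoidHom.snd _ _))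

theorem sextic_apply (g : Q8Z3) : sextic g = (quaternionSign g.1 : ℂ) *
    ZMod.stdAddChar (N := 3) (Multiplicative.toAdd g.2) := rfl

theorem star_sextic (g : Q8Z3) : (starRingEnd ℂ) (sextic g) = sextic g⁻¹ := by
  rw [sextic_apply, sextic_apply, map_mul, map_intCast, ZMod.stdAddChar_apply,
    ← Circle.coe_inv_eq_conj, ← AddChar.map_neg_eq_inv, ← ZMod.stdAddChar_apply]
  congr 2
  change quaternionSign g.1 = quaternionSign g.1⁻¹
  generalize g.1 = q
  revert q
  decide +kernel

theorem sextic_mul_star (g : Q8Z3) : sextic g * (starRingEnd ℂ) (sextic g) = 1 := by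
  rw [star_sextic, ← map_mul, mul_inv_cancel, map_one]

theorem exists_sextic_im_ne_zero : ∃ g, (sextic g).im ≠ 0 := by
  refine ⟨(1, Multiplicative.ofAdd 1), fun h => ?_⟩
  have h1 := Complex.conj_eq_iff_im.2 h
  rw [star_sextic, sextic_apply, sextic_apply] at h1
  simp only [Prod.fst_inv, inv_one, map_one, Int.cast_one, one_mul] at h1
  have h2 := ZMod.injective_stdAddChar h1
  revert h2
  decide +kernel

/-- The complex character of `Q₈ × ℤ/3ℤ` given by `quaternionSign`. -/
def signChar : Q8Z3 →* ℂ :=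
  (Int.castRingHom ℂ).toMonoidHom.comp (quaternionSign.comp (MonoidHom.fst _ _))

theorem signChar_apply (g : Q8Z3) : signChar g = (quaternionSign g.1 : ℂ) := rfl

theorem signChar_inv (g : Q8Z3) : signChar g⁻¹ = signChar g := by
  rw [signChar_apply, signChar_apply]
  congr 1
  generalize g = q
  obtain ⟨q, r⟩ := q
  change quaternionSign q⁻¹ = quaternionSign q
  revert q
  decide +kernel

theorem signChar_sq (g : Q8Z3) : signChar (g ^ 2) = 1 := by
  rw [sq, map_mul]
  nth_rewrite 1 [← signChar_inv]
  rw [← map_mul, inv_mul_cancel, map_one]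

/-- The complexified action of `Q₈ × ℤ/3ℤ` on the quaternions. -/
def quaternionRepC : Q8Z3 →* Matrix (Fin 4) (Fin 4) ℂ :=
  ((Int.castRingHom ℂ).mapMatrix.toMonoidHom.comp quaternionRep).comp (MonoidHom.fst _ _)

theorem quaternionRepC_apply (g : Q8Z3) :
    quaternionRepC g = (quaternionRep g.1).map (Int.cast : ℤ → ℂ) := rfl

/-- The algebra of all endomorphisms of the complexified quaternions commuting with the left
multiplications, as a linear image of the algebra of matrices of size two. -/
def rightMulLinear (y : Matrix (Fin 2) (Fin 2) ℂ) : Matrix (Fin 4) (Fin 4) ℂ :=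
  -- Here `y = α + βi + γj + δk` under the isomorphism of `M₂(ℂ)` with the complexified quaternions.
  -- The matrix is right multiplication by `α + βi + γj - δk`: the anti-automorphism negating `k`
  -- makes right multiplications multiplicative in the given order.
  let α := (y 0 0 + y 1 1) / 2
  let β := -Complex.I * (y 0 0 - y 1 1) / 2
  let γ := (y 0 1 - y 1 0) / 2
  let δ := -Complex.I * (y 0 1 + y 1 0) / 2
  !![α, -β, -γ, δ; β, α, -δ, -γ; γ, δ, α, β; -δ, γ, -β, α]

theorem rightMulLinear_mul (x y : Matrix (Fin 2) (Fin 2) ℂ) :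
    rightMulLinear (x * y) = rightMulLinear x * rightMulLinear y := by
  ext i j
  fin_cases i <;> fin_cases j <;>
    simp [rightMulLinear, Matrix.mul_apply, Fin.sum_univ_succ] <;> ring_nf <;>
    simp only [Complex.I_sq] <;> ring

/-- The right multiplications of the complexified quaternions. -/
def rightMul : Matrix (Fin 2) (Fin 2) ℂ →ₐ[ℂ] Matrix (Fin 4) (Fin 4) ℂ :=
  AlgHom.ofLinearMap
    { toFun := rightMulLinear
      map_add' := fun x y => by
        ext i j
        fin_cases i <;> fin_cases j <;> simp [rightMulLinear] <;> ring
      map_smul' := fun c y => by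
        ext i j
        fin_cases i <;> fin_cases j <;> simp [rightMulLinear] <;> ring }
    (by
      ext i j
      fin_cases i <;> fin_cases j <;> simp [rightMulLinear])
    rightMulLinear_mul

theorem rightMul_apply (y : Matrix (Fin 2) (Fin 2) ℂ) : rightMul y = rightMulLinear y := rfl

theorem rightMul_injective : Function.Injective rightMul := by
  rw [injective_iff_map_eq_zero]
  intro y hy
  have h := fun k => congrFun (congrFun hy k) 0
  have h0 := h 0
  have h1 := h 1
  have h2 := h 2
  have h3 := h 3
  simp [rightMul_apply, rightMulLinear] at h0 h1 h2 h3
  ext i j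
  fin_cases i <;> fin_cases j <;> simp <;> grind

theorem neg_sympl_mul_transpose_mul_sympl (y : Matrix (Fin 2) (Fin 2) ℂ) :
    -sympl * y.transpose * sympl = !![y 1 1, -y 0 1; -y 1 0, y 0 0] := by
  rw [Matrix.eta_fin_two y.transpose]
  simp [sympl]

/-- Right multiplication by a quaternion is transposed by quaternion conjugation, which on `M₂(ℂ)`
is the adjugate, that is the symplectic adjoint. -/
theorem rightMul_transpose (y : Matrix (Fin 2) (Fin 2) ℂ) :
    (rightMul y).transpose = rightMul (-sympl * y.transpose * sympl) := by
  rw [neg_sympl_mul_transpose_mul_sympl]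
  ext i j
  fin_cases i <;> fin_cases j <;> simp [rightMul_apply, rightMulLinear] <;> ring

theorem trace_rightMul (y : Matrix (Fin 2) (Fin 2) ℂ) :
    (rightMul y).trace = 2 * y.trace := by
  simp [rightMul_apply, rightMulLinear, Matrix.trace, Fin.sum_univ_succ]
  ring

theorem rightMul_commute (y : Matrix (Fin 2) (Fin 2) ℂ) (g : Q8Z3) :
    rightMul y * quaternionRepC g = quaternionRepC g * rightMul y := by
  have hI : Commute (rightMul y) (quaternionI.map (Int.cast : ℤ → ℂ)) := by
    ext i j
    fin_cases i <;> fin_cases j <;>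
      simp [rightMul_apply, rightMulLinear, quaternionI, Matrix.mul_apply, Fin.sum_univ_succ]
  have hJ : Commute (rightMul y) (quaternionJ.map (Int.cast : ℤ → ℂ)) := by
    ext i j
    fin_cases i <;> fin_cases j <;>
      simp [rightMul_apply, rightMulLinear, quaternionJ, Matrix.mul_apply, Fin.sum_univ_succ]
  have hpow : ∀ n : ℕ, Commute (rightMul y) ((quaternionI ^ n).map (Int.cast : ℤ → ℂ)) := by
    intro n
    have : (quaternionI ^ n).map (Int.cast : ℤ → ℂ) = (quaternionI.map (Int.cast : ℤ → ℂ)) ^ n :=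
      map_pow (Int.castRingHom ℂ).mapMatrix quaternionI n
    rw [this]
    exact hI.pow_right n
  obtain ⟨q, r⟩ := g
  rw [quaternionRepC_apply]
  rcases q with i | i
  · exact hpow _
  · have h : (quaternionRep (.xa i)).map (Int.cast : ℤ → ℂ) =
        quaternionJ.map (Int.cast : ℤ → ℂ) * (quaternionI ^ (ZMod.val i)).map (Int.cast : ℤ → ℂ) :=
      map_mul (Int.castRingHom ℂ).mapMatrix quaternionJ _
    rw [h]
    exact hJ.mul_right (hpow _)

theorem exists_rightMul_eq (T : Matrix (Fin 4) (Fin 4) ℂ)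
    (hT : ∀ g, T * quaternionRepC g = quaternionRepC g * T) : ∃ y, rightMul y = T := by
  have hI : T * quaternionI.map (Int.cast : ℤ → ℂ) = quaternionI.map (Int.cast : ℤ → ℂ) * T := by
    have h := hT (.a 1, 1)
    have h1 : quaternionRep (.a 1) = quaternionI := by decide +kernel
    rwa [quaternionRepC_apply, h1] at h
  have hJ : T * quaternionJ.map (Int.cast : ℤ → ℂ) = quaternionJ.map (Int.cast : ℤ → ℂ) * T := by
    have h := hT (.xa 0, 1)
    have h1 : quaternionRep (.xa 0) = quaternionJ := by decide +kernel
    rwa [quaternionRepC_apply, h1] at h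
  -- An operator commuting with left multiplications is determined by its value at `1`, the first
  -- column `(α, β, γ, -δ)`.
  refine ⟨!![T 0 0 + Complex.I * T 1 0, T 2 0 - Complex.I * T 3 0;
    -T 2 0 - Complex.I * T 3 0, T 0 0 - Complex.I * T 1 0], ?_⟩
  have h1 := fun k => congrFun (congrFun hI k) 0
  have h2 := fun k => congrFun (congrFun hJ k) 0
  have h3 := fun k => congrFun (congrFun hI k) 2
  simp [quaternionI, quaternionJ, Matrix.mul_apply, Fin.sum_univ_succ, Fin.forall_fin_succ] at h1 h2 h3
  ext i j
  fin_cases i <;> fin_cases j <;> simp [rightMul_apply, rightMulLinear] <;> grind [Complex.I_sq]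

end BaseGroup

/-! ### Central characters of `Q₈ × ℤ/3ℤ` -/

section CentralCharacters

section Linear

variable {G : Type u} [Group G]

/-- The character of the centre of the group algebra given by a linear character. -/
def linChar (η : G →* ℂ) : GroupCenter ℂ G →ₐ[ℂ] ℂ :=
  (MonoidAlgebra.lift ℂ ℂ G η).comp (GroupCenter ℂ G).val

theorem linChar_apply (η : G →* ℂ) (z : GroupCenter ℂ G) :
    linChar η z = MonoidAlgebra.lift ℂ ℂ G η z.1 := rfl

theorem linChar_centerStar {η η' : G →* ℂ} (h : ∀ g, η g⁻¹ = η' g) (z : GroupCenter ℂ G) :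
    linChar η (centerStar ℂ G z) = linChar η' z := by
  rw [linChar_apply, linChar_apply, centerStar_coe]
  generalize z.1 = x
  induction x using MonoidAlgebra.induction_linear with
  | zero => simp
  | add x y hx hy => simp only [map_add, hx, hy]
  | single g c => rw [groupInv_single, MonoidAlgebra.lift_single, MonoidAlgebra.lift_single, h]

variable [Fintype G]

theorem linChar_conjSum (η : G →* ℂ) (c : G) :
    linChar η (conjSum c) = Fintype.card G * η c := by
  rw [linChar_apply]
  simp only [conjSum, map_sum, MonoidAlgebra.lift_single, one_smul]
  simp only [map_mul]
  have : ∀ a : G, η a * η c * η a⁻¹ = η c := fun a => by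
    rw [mul_comm, ← mul_assoc, ← map_mul, inv_mul_cancel, map_one, one_mul]
  rw [Finset.sum_congr rfl fun a _ => this a]
  simp

end Linear

/-- The action of the centre on the complexified quaternions. -/
def quaternionTrace : GroupCenter ℂ Q8Z3 →ₗ[ℂ] ℂ :=
  (4 : ℂ)⁻¹ • (Matrix.traceLinearMap (Fin 4) ℂ ℂ ∘ₗ
    (MonoidAlgebra.lift ℂ (Matrix (Fin 4) (Fin 4) ℂ) Q8Z3 quaternionRepC).toLinearMap ∘ₗ
      (GroupCenter ℂ Q8Z3).toSubmodule.subtype)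

theorem quaternionTrace_apply (z : GroupCenter ℂ Q8Z3) : quaternionTrace z =
    (4 : ℂ)⁻¹ * (MonoidAlgebra.lift ℂ (Matrix (Fin 4) (Fin 4) ℂ) Q8Z3 quaternionRepC z.1).trace :=
  rfl

/-- A central element acts by an operator commuting with left and right multiplications: a right
multiplication by an element central in `M₂(ℂ)`, hence a scalar. -/
theorem lift_quaternionRepC (z : GroupCenter ℂ Q8Z3) :
    MonoidAlgebra.lift ℂ (Matrix (Fin 4) (Fin 4) ℂ) Q8Z3 quaternionRepC z.1 =
      quaternionTrace z • 1 := by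
  obtain ⟨y, hy⟩ := exists_rightMul_eq
    (MonoidAlgebra.lift ℂ (Matrix (Fin 4) (Fin 4) ℂ) Q8Z3 quaternionRepC z.1) fun g => by
      have h := Subalgebra.mem_center_iff.1 z.2 (MonoidAlgebra.single g 1)
      have h' := congrArg (MonoidAlgebra.lift ℂ (Matrix (Fin 4) (Fin 4) ℂ) Q8Z3 quaternionRepC) h
      simpa using h'.symm
  have hcomm : ∀ w (x : MonoidAlgebra ℂ Q8Z3), rightMul w *
      MonoidAlgebra.lift ℂ (Matrix (Fin 4) (Fin 4) ℂ) Q8Z3 quaternionRepC x =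
      MonoidAlgebra.lift ℂ (Matrix (Fin 4) (Fin 4) ℂ) Q8Z3 quaternionRepC x * rightMul w := by
    intro w x
    induction x using MonoidAlgebra.induction_linear with
    | zero => simp
    | add x y hx hy => rw [map_add, mul_add, add_mul, hx, hy]
    | single g c =>
      rw [MonoidAlgebra.lift_single, mul_smul_comm, smul_mul_assoc, rightMul_commute]
  obtain ⟨c, rfl⟩ := exists_eq_smul_one y fun w => by
    apply rightMul_injective
    rw [map_mul, map_mul, hy, hcomm]
  rw [map_smul, map_one] at hy
  rw [quaternionTrace_apply, ← hy, Matrix.trace_smul, Matrix.trace_one, Fintype.card_fin]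
  congr 1
  rw [smul_eq_mul]
  push_cast
  ring

/-- The character of the centre given by the quaternionic representation. -/
def quaternionChar : GroupCenter ℂ Q8Z3 →ₐ[ℂ] ℂ :=
  AlgHom.ofLinearMap quaternionTrace
    (by
      rw [quaternionTrace_apply, OneMemClass.coe_one, map_one]
      simp)
    (fun z w => by
      rw [quaternionTrace_apply (z * w), Subalgebra.coe_mul, map_mul, lift_quaternionRepC,
        lift_quaternionRepC, smul_mul_smul_comm, one_mul, Matrix.trace_smul, Matrix.trace_one]
      simp
      ring)

theorem quaternionChar_apply (z : GroupCenter ℂ Q8Z3) : quaternionChar z = quaternionTrace z := rfl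

theorem quaternionRepC_inv (g : Q8Z3) : quaternionRepC g⁻¹ = (quaternionRepC g).transpose := by
  rw [quaternionRepC_apply, quaternionRepC_apply, ← Matrix.transpose_map]
  congr 1
  exact quaternionRep_inv g.1

theorem trace_quaternionRepC (g : Q8Z3) :
    (quaternionRepC g).trace = ((quaternionRep g.1).trace : ℂ) := by
  simp [quaternionRepC_apply, Matrix.trace]

theorem quaternionChar_centerStar (z : GroupCenter ℂ Q8Z3) :
    quaternionChar (centerStar ℂ _ z) = quaternionChar z := by
  rw [quaternionChar_apply, quaternionChar_apply, quaternionTrace_apply, quaternionTrace_apply,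
    centerStar_coe]
  congr 1
  generalize z.1 = x
  induction x using MonoidAlgebra.induction_linear with
  | zero => simp
  | add x y hx hy => simp only [map_add, Matrix.trace_add, hx, hy]
  | single g c =>
    rw [groupInv_single, MonoidAlgebra.lift_single, MonoidAlgebra.lift_single, Matrix.trace_smul,
      Matrix.trace_smul, quaternionRepC_inv, Matrix.trace_transpose]

/-- The types of the irreducible representations used in the construction. -/
inductive CharType
  | re
  | qu
  | cp
  | cm

/-- The complex conjugate type. -/
def CharType.conj : CharType → CharType
  | .re => .re
  | .qu => .qu
  | .cp => .cm
  | .cm => .cp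

/-- The degree of the irreducible representation. -/
def CharType.degree : CharType → ℂ
  | .qu => 2
  | _ => 1

theorem CharType.degree_conj (t : CharType) : t.conj.degree = t.degree := by
  cases t <;> rfl

theorem CharType.degree_ne_zero (t : CharType) : t.degree ≠ 0 := by
  cases t <;> simp [CharType.degree]

/-- The complex conjugate of the character of order six. -/
def sexticConj : Q8Z3 →* ℂ := (starRingEnd ℂ).toMonoidHom.comp sextic

theorem sexticConj_apply (g : Q8Z3) : sexticConj g = (starRingEnd ℂ) (sextic g) := rfl

/-- The central character of each type. -/
def centralChar : CharType → (GroupCenter ℂ Q8Z3 →ₐ[ℂ] ℂ)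
  | .re => linChar signChar
  | .qu => quaternionChar
  | .cp => linChar sextic
  | .cm => linChar sexticConj

theorem centralChar_centerStar (t : CharType) (z : GroupCenter ℂ Q8Z3) :
    centralChar t (centerStar ℂ _ z) = centralChar t.conj z := by
  cases t
  · exact linChar_centerStar signChar_inv z
  · exact quaternionChar_centerStar z
  · exact linChar_centerStar (fun g => by rw [sexticConj_apply, star_sextic]) z
  · exact linChar_centerStar (fun g => by rw [sexticConj_apply, star_sextic, inv_inv]) z

/-- An element acting by `-1` in the representation of the given type. -/
def CharType.negOne : CharType → Q8Z3
  | .qu => (.a 2, 1)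
  | _ => (.xa 0, 1)

theorem quaternionSign_xa_zero : quaternionSign (.xa 0) = -1 := rfl

theorem sextic_negOne : sextic (.xa 0, 1) = -1 := by
  rw [sextic_apply]
  simp [quaternionSign_xa_zero]

theorem quaternionRepC_negOne : quaternionRepC (.a 2, 1) = -1 := by
  rw [quaternionRepC_apply]
  have : quaternionRep (.a 2) = -1 := by decide +kernel
  rw [this]
  ext i j
  simp [Matrix.one_apply]

/-- The value differs in sign from that at the identity; this separates the factors of the product
group in `eq_of_factorChar_eq`. -/
theorem centralChar_conjSum_negOne (t : CharType) :
    centralChar t (conjSum t.negOne) = -Fintype.card Q8Z3 := by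
  cases t
  · refine (linChar_conjSum _ _).trans ?_
    have h : CharType.re.negOne = (.xa 0, 1) := rfl
    rw [h, signChar_apply, quaternionSign_xa_zero]
    push_cast
    ring
  · change quaternionTrace _ = _
    rw [quaternionTrace_apply]
    have h : ∀ a : Q8Z3, quaternionRepC (a * CharType.qu.negOne * a⁻¹) = -1 := fun a => by
      rw [map_mul, map_mul, CharType.negOne, quaternionRepC_negOne, mul_neg, neg_mul, mul_one,
        ← map_mul, mul_inv_cancel, map_one]
    simp only [conjSum, map_sum, MonoidAlgebra.lift_single, one_smul, h]
    rw [Finset.sum_const, Finset.card_univ, Matrix.trace_smul, Matrix.trace_neg, Matrix.trace_one,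
      Fintype.card_fin, nsmul_eq_mul]
    push_cast
    ring
  · refine (linChar_conjSum _ _).trans ?_
    have h : CharType.cp.negOne = (.xa 0, 1) := rfl
    rw [h, sextic_negOne]
    ring
  · refine (linChar_conjSum _ _).trans ?_
    have h : CharType.cm.negOne = (.xa 0, 1) := rfl
    rw [h, sexticConj_apply, sextic_negOne]
    simp

theorem centralChar_cp_ne_cm : centralChar .cp ≠ centralChar .cm := by
  intro h
  obtain ⟨g, hg⟩ := exists_sextic_im_ne_zero
  have h1 := AlgHom.congr_fun h (conjSum g)
  change linChar _ _ = linChar _ _ at h1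
  rw [linChar_conjSum, linChar_conjSum] at h1
  have h2 := mul_left_cancel₀ card_ne_zero_complex h1
  exact hg (Complex.conj_eq_iff_im.1 h2.symm)

theorem centralChar_re_sumSquares :
    centralChar .re (sumSquares ℂ Q8Z3) = Fintype.card Q8Z3 := by
  change linChar _ _ = _
  rw [linChar_apply]
  simp only [sumSquares, map_sum, MonoidAlgebra.lift_single, one_smul, signChar_sq]
  simp

/-- This is Frobenius–Schur indicator `-1` over degree 2. Of the 24 squares, 6 act by `1` and 18 by
`-1`, for a total trace of `-48`. -/
theorem centralChar_qu_sumSquares :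
    centralChar .qu (sumSquares ℂ Q8Z3) = -Fintype.card Q8Z3 / 2 := by
  change quaternionTrace _ = _
  rw [quaternionTrace_apply]
  simp only [sumSquares, map_sum, MonoidAlgebra.lift_single, one_smul, Matrix.trace_sum,
    trace_quaternionRepC]
  have h1 : ∑ g : Q8Z3, ((quaternionRep (g ^ 2).1).trace : ℂ) = -48 := by
    have h : ∑ g : Q8Z3, (quaternionRep (g ^ 2).1).trace = -48 := by decide +kernel
    exact_mod_cast congrArg (Int.cast : ℤ → ℂ) h
  have h2 : Fintype.card Q8Z3 = 24 := by decide +kernel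
  rw [h1, h2]
  norm_num

end CentralCharacters

/-! ### Realization of blocks by representations of `Q₈ × ℤ/3ℤ` -/

section MatrixRepresentations

variable {G : Type*} [Group G] {ι : Type*} [Fintype ι] [DecidableEq ι]

/-- The complexification of a real matrix representation. -/
def complexifyRep (R : G →* Matrix ι ι ℝ) : G →* Matrix ι ι ℂ :=
  Complex.ofRealHom.mapMatrix.toMonoidHom.comp R

theorem complexifyRep_apply (R : G →* Matrix ι ι ℝ) (g : G) :
    complexifyRep R g = (R g).map Complex.ofReal := rfl

/-- The multiple `1 ⊗ L` of a matrix representation. -/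
def multiple {𝕜 : Type*} [CommSemiring 𝕜] (κ : Type*) [Fintype κ] [DecidableEq κ]
    (L : G →* Matrix ι ι 𝕜) : G →* Matrix (κ × ι) (κ × ι) 𝕜 :=
  ((Matrix.compRingEquiv κ ι 𝕜 : _ →+* _).comp (Matrix.scalar κ)).toMonoidHom.comp L

theorem multiple_apply {𝕜 : Type*} [CommSemiring 𝕜] (κ : Type*) [Fintype κ] [DecidableEq κ]
    (L : G →* Matrix ι ι 𝕜) (g : G) :
    multiple κ L g = Matrix.comp κ κ ι ι 𝕜 (Matrix.scalar κ (L g)) := rfl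

theorem complexifyRep_multiple (κ : Type*) [Fintype κ] [DecidableEq κ] (L : G →* Matrix ι ι ℝ) :
    complexifyRep (multiple κ L) = multiple κ (complexifyRep L) := by
  ext g ⟨i, s⟩ ⟨j, t⟩
  rw [complexifyRep_apply, multiple_apply, multiple_apply, complexifyRep_apply]
  by_cases h : i = j
  · subst h; simp
  · simp [h]

theorem multiple_transpose (κ : Type*) [Fintype κ] [DecidableEq κ] (L : G →* Matrix ι ι ℝ)
    (hL : ∀ g, (L g).transpose * L g = 1) (g : G) :
    (multiple κ L g).transpose * multiple κ L g = 1 := by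
  have h : (multiple κ L g).transpose =
      Matrix.compRingEquiv κ ι ℝ (Matrix.scalar κ (L g).transpose) := by
    ext ⟨i, s⟩ ⟨j, t⟩
    rw [multiple_apply]
    by_cases h : i = j
    · subst h; simp
    · simp [h, Ne.symm h]
  rw [h]
  change _ * Matrix.compRingEquiv κ ι ℝ (Matrix.scalar κ (L g)) = 1
  rw [← map_mul, ← map_mul, hL, map_one, map_one]

theorem lift_multiple (κ : Type*) [Fintype κ] [DecidableEq κ] (L : G →* Matrix ι ι ℂ)
    (x : MonoidAlgebra ℂ G) :
    MonoidAlgebra.lift ℂ _ G (multiple κ L) x =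
      Matrix.compRingEquiv κ ι ℂ (Matrix.scalar κ (MonoidAlgebra.lift ℂ _ G L x)) := by
  induction x using MonoidAlgebra.induction_linear with
  | zero => simp only [map_zero]
  | add x y hx hy => simp only [map_add, hx, hy]
  | single g c =>
    rw [MonoidAlgebra.lift_single, MonoidAlgebra.lift_single]
    ext ⟨i, s⟩ ⟨j, t⟩
    rw [multiple_apply]
    by_cases h : i = j
    · subst h; simp
    · simp [h]

end MatrixRepresentations

/-! ### Realizations, and commutants of multiples of a representation. -/

section Realization

/-- A realization of the blocks of `H` over a set `S` of characters of `A` by a real orthogonal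
representation `R` of `Q₈ × ℤ/3ℤ`: the algebra of intertwining operators of the complexification
of `R` is the sum of these blocks. -/
structure Realization (H : EquippedData.{u, v} ℂ) [IsReduced H.A] (S : Finset (H.A →ₐ[ℂ] ℂ))
    (t : (H.A →ₐ[ℂ] ℂ) → CharType) (c : (H.A →ₐ[ℂ] ℂ) → ℂ) where
  ι : Type
  [fintype : Fintype ι]
  [decEq : DecidableEq ι]
  R : Q8Z3 →* Matrix ι ι ℝ
  orthogonal : ∀ g, (R g).transpose * R g = 1
  -- Needed so that intertwiners of an external sum of realizations are block diagonal.
  neg : ∃ h, R h = -1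
  Ψ : H.B →ₐ[ℂ] Matrix ι ι ℂ
  commute : ∀ b g, Ψ b * complexifyRep R g = complexifyRep R g * Ψ b
  surj : ∀ T, (∀ g, T * complexifyRep R g = complexifyRep R g * T) → ∃ b, Ψ b = T
  star : ∀ b, Ψ (H.starB b) = (Ψ b).transpose
  ker : ∀ b, Ψ b = 0 ↔ ∀ x ∈ S, H.φ (idem x) * b = 0
  -- The degree appears because the trace of the representation counts each block with that
  -- multiplicity.
  trace : ∀ x ∈ S, ∀ b,
    c x * (Ψ (H.φ (idem x) * b)).trace = (t x).degree * H.lB (H.φ (idem x) * b)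
  center : ∀ z : GroupCenter ℂ Q8Z3, MonoidAlgebra.lift ℂ _ _ (complexifyRep R) z.1 =
    Ψ (H.φ (∑ x ∈ S, centralChar (t x) z • idem x))

attribute [instance] Realization.fintype Realization.decEq

variable {H : EquippedData.{u, v} ℂ} [IsReduced H.A] {S : Finset (H.A →ₐ[ℂ] ℂ)}
  {t : (H.A →ₐ[ℂ] ℂ) → CharType} {c : (H.A →ₐ[ℂ] ℂ) → ℂ}

/-- A realization by a multiple of a representation `L` whose complexification has commutant
isomorphic to an algebra `C`. -/
def Realization.ofCommutant {C : Type*} [Ring C] [Algebra ℂ C] {d r : ℕ}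
    (κ : C →ₐ[ℂ] Matrix (Fin d) (Fin d) ℂ) (hκ : Function.Injective κ)
    (L : Q8Z3 →* Matrix (Fin d) (Fin d) ℝ) (hL : ∀ g, (L g).transpose * L g = 1)
    (hneg : ∃ h, L h = -1)
    (hcomm : ∀ y g, κ y * complexifyRep L g = complexifyRep L g * κ y)
    (hsurj : ∀ T, (∀ g, T * complexifyRep L g = complexifyRep L g * T) → ∃ y, κ y = T)
    (q : H.B →ₐ[ℂ] Matrix (Fin r) (Fin r) C) (hq : Function.Surjective q)
    (hstar : ∀ b i j, κ (q (H.starB b) i j) = (κ (q b j i)).transpose)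
    (hker : ∀ b, q b = 0 ↔ ∀ x ∈ S, H.φ (idem x) * b = 0)
    (htrace : ∀ x ∈ S, ∀ b, c x * ∑ i, (κ (q (H.φ (idem x) * b) i i)).trace =
      (t x).degree * H.lB (H.φ (idem x) * b))
    (hcenter : ∀ z : GroupCenter ℂ Q8Z3, ∃ y, MonoidAlgebra.lift ℂ _ _ (complexifyRep L) z.1 = κ y ∧
      q (H.φ (∑ x ∈ S, centralChar (t x) z • idem x)) = Matrix.scalar (Fin r) y) :
    Realization H S t c where
  ι := Fin r × Fin d
  R := multiple (Fin r) L
  orthogonal := multiple_transpose _ L hL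
  neg := by
    obtain ⟨h, hh⟩ := hneg
    refine ⟨h, ?_⟩
    change Matrix.compRingEquiv _ _ ℝ (Matrix.scalar _ (L h)) = -1
    rw [hh, map_neg, map_neg, map_one, map_one]
  Ψ := ((Matrix.compAlgEquiv (Fin r) (Fin d) ℂ ℂ : _ →ₐ[ℂ] _).comp κ.mapMatrix).comp q
  commute b g := by
    rw [complexifyRep_multiple]
    change Matrix.compRingEquiv _ _ ℂ ((q b).map κ) *
      Matrix.compRingEquiv _ _ ℂ (Matrix.scalar _ (complexifyRep L g)) =
      Matrix.compRingEquiv _ _ ℂ (Matrix.scalar _ (complexifyRep L g)) *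
      Matrix.compRingEquiv _ _ ℂ ((q b).map κ)
    rw [← map_mul, ← map_mul]
    congr 1
    refine Matrix.ext fun i j => ?_
    rw [Matrix.scalar_apply, Matrix.mul_diagonal, Matrix.diagonal_mul]
    exact hcomm _ _
  surj T hT := by
    obtain ⟨X, rfl⟩ := (Matrix.compRingEquiv (Fin r) (Fin d) ℂ).surjective T
    -- Since `L g` acts by a scalar block matrix, commuting with it is a condition on each block of
    -- `T` separately.
    have hX : ∀ i j, ∃ y, κ y = X i j := by
      intro i j
      apply hsurj
      intro g
      have h := hT g
      rw [complexifyRep_multiple] at h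
      change _ * Matrix.compRingEquiv _ _ ℂ (Matrix.scalar _ (complexifyRep L g)) =
        Matrix.compRingEquiv _ _ ℂ (Matrix.scalar _ (complexifyRep L g)) * _ at h
      rw [← map_mul, ← map_mul] at h
      have h' := congrFun (congrFun ((Matrix.compRingEquiv (Fin r) (Fin d) ℂ).injective h) i) j
      rwa [Matrix.scalar_apply, Matrix.mul_diagonal, Matrix.diagonal_mul] at h'
    choose y hy using hX
    obtain ⟨b, hb⟩ := hq (Matrix.of y)
    refine ⟨b, ?_⟩
    change Matrix.compRingEquiv _ _ ℂ ((q b).map κ) = _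
    rw [hb]
    congr 1
    refine Matrix.ext fun i j => ?_
    exact hy i j
  star b := by
    ext ⟨i, s⟩ ⟨j, k⟩
    exact congrFun (congrFun (hstar b i j) s) k
  ker b := by
    rw [← hker]
    constructor
    · intro h
      have h' : (Matrix.compRingEquiv (Fin r) (Fin d) ℂ) ((q b).map κ) = 0 := h
      rw [map_eq_zero_iff _ (Matrix.compRingEquiv (Fin r) (Fin d) ℂ).injective] at h'
      ext i j
      exact (map_eq_zero_iff κ hκ).1 (congrFun (congrFun h' i) j)
    · intro h
      rw [AlgHom.comp_apply, h, map_zero]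
  trace x hx b := by
    rw [← htrace x hx b]
    congr 1
    rw [Matrix.trace, Fintype.sum_prod_type]
    rfl
  center z := by
    obtain ⟨y, hy, hy'⟩ := hcenter z
    rw [complexifyRep_multiple, lift_multiple, hy, AlgHom.comp_apply, hy']
    change _ = Matrix.compRingEquiv _ _ ℂ ((Matrix.scalar (Fin r) y).map κ)
    congr 1
    refine Matrix.ext fun i j => ?_
    by_cases h : i = j
    · subst h; simp
    · simp [h]

/-- The realization of the empty set of blocks. -/
def Realization.empty : Realization H ∅ t c where
  ι := Empty
  R := 1
  orthogonal _ := Subsingleton.elim _ _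
  neg := ⟨1, Subsingleton.elim _ _⟩
  Ψ := toSubsingleton _ _
  commute _ _ := Subsingleton.elim _ _
  surj _ _ := ⟨0, Subsingleton.elim _ _⟩
  star _ := Subsingleton.elim _ _
  ker b := iff_of_true (Subsingleton.elim _ _) (by simp)
  trace x hx := absurd hx (Finset.notMem_empty x)
  center _ := Subsingleton.elim _ _

end Realization

/-! ### Self-dual blocks: real and quaternionic type. -/

section Realizations

variable {H : EquippedData.{u, v} ℂ} [IsReduced H.A]
  {t : (H.A →ₐ[ℂ] ℂ) → CharType} {c : (H.A →ₐ[ℂ] ℂ) → ℂ}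

/-- The representation conjugated by an isomorphism given by two inverse matrices. -/
def conjHom {R : Type*} [Ring R] [Algebra ℂ R] {ι κ : Type*} [Fintype ι] [DecidableEq ι]
    [Fintype κ] [DecidableEq κ] (p : R →ₐ[ℂ] Matrix κ κ ℂ) (P : Matrix ι κ ℂ) (P' : Matrix κ ι ℂ)
    (h : P * P' = 1) (h' : P' * P = 1) : R →ₐ[ℂ] Matrix ι ι ℂ :=
  AlgHom.ofLinearMap
    { toFun := fun b => P * p b * P'
      map_add' := fun a b => by rw [map_add, Matrix.mul_add, Matrix.add_mul]
      map_smul' := fun z b => by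
        rw [map_smul, Matrix.mul_smul, Matrix.smul_mul, RingHom.id_apply] }
    (by
      change P * p 1 * P' = 1
      rw [map_one, Matrix.mul_one, h])
    (fun a b => by
      change P * p (a * b) * P' = P * p a * P' * (P * p b * P')
      have : P * p a * P' * (P * p b * P') = P * p a * (P' * P) * p b * P' := by
        simp only [Matrix.mul_assoc]
      rw [this, h', Matrix.mul_one, map_mul]
      simp only [Matrix.mul_assoc])

section ConjHom

variable {R : Type*} [Ring R] [Algebra ℂ R] {ι κ : Type*} [Fintype ι] [DecidableEq ι]
    [Fintype κ] [DecidableEq κ] {p : R →ₐ[ℂ] Matrix κ κ ℂ} {P : Matrix ι κ ℂ} {P' : Matrix κ ι ℂ}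
    {h : P * P' = 1} {h' : P' * P = 1}

theorem conjHom_apply (b : R) : conjHom p P P' h h' b = P * p b * P' := rfl

theorem conjHom_surjective (hp : Function.Surjective p) :
    Function.Surjective (conjHom p P P' h h') := fun X => by
  obtain ⟨b, hb⟩ := hp (P' * X * P)
  refine ⟨b, ?_⟩
  have : P * (P' * X * P) * P' = P * P' * X * (P * P') := by simp only [Matrix.mul_assoc]
  rw [conjHom_apply, hb, this, h, Matrix.one_mul, Matrix.mul_one]

theorem conjHom_eq_zero_iff (b : R) : conjHom p P P' h h' b = 0 ↔ p b = 0 := by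
  constructor
  · intro hb
    have : P' * (P * p b * P') * P = P' * P * p b * (P' * P) := by simp only [Matrix.mul_assoc]
    rw [h', Matrix.one_mul, Matrix.mul_one] at this
    rw [← this, ← conjHom_apply (h := h) (h' := h'), hb, Matrix.mul_zero, Matrix.zero_mul]
  · intro hb
    rw [conjHom_apply, hb, Matrix.mul_zero, Matrix.zero_mul]

theorem trace_conjHom (b : R) : (conjHom p P P' h h' b).trace = (p b).trace := by
  rw [conjHom_apply, Matrix.trace_mul_comm, ← Matrix.mul_assoc, h', Matrix.one_mul]

end ConjHom

theorem φ_idem_mul (x : H.A →ₐ[ℂ] ℂ) (b : H.B) :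
    H.φ (idem x) * (H.φ (idem x) * b) = H.φ (idem x) * b := by
  rw [← mul_assoc, ← map_mul, idem_mul_self]

theorem block_smul_idem {x : H.A →ₐ[ℂ] ℂ} {ι : Type*} [Fintype ι] [DecidableEq ι]
    {p : H.B →ₐ[ℂ] Matrix ι ι ℂ} (hker : ∀ b, p b = 0 ↔ H.φ (idem x) * b = 0) (w : ℂ) :
    p (H.φ (w • idem x)) = w • 1 := by
  rw [block_φ hker, map_smul, character_idem_self, smul_eq_mul, mul_one]

/-- The one-dimensional real representation given by the sign character. -/
def signRep : Q8Z3 →* Matrix (Fin 1) (Fin 1) ℝ :=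
  (((Matrix.scalar (Fin 1)).comp (Int.castRingHom ℝ)).toMonoidHom.comp quaternionSign).comp
    (MonoidHom.fst _ _)

theorem signRep_apply (g : Q8Z3) : signRep g = Matrix.scalar (Fin 1) (quaternionSign g.1 : ℝ) := rfl

theorem complexifyRep_signRep (g : Q8Z3) :
    complexifyRep signRep g = Matrix.scalar (Fin 1) (signChar g) := by
  rw [complexifyRep_apply, signRep_apply, signChar_apply]
  ext i j
  rw [Subsingleton.elim i 0, Subsingleton.elim j 0, Matrix.map_apply, Matrix.scalar_apply,
    Matrix.scalar_apply, Matrix.diagonal_apply_eq, Matrix.diagonal_apply_eq, Complex.ofReal_intCast]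

theorem scalar_fin_one_surjective (T : Matrix (Fin 1) (Fin 1) ℂ) :
    ∃ y, Algebra.ofId ℂ (Matrix (Fin 1) (Fin 1) ℂ) y = T := by
  refine ⟨T 0 0, ?_⟩
  ext i j
  rw [Subsingleton.elim i 0, Subsingleton.elim j 0]
  simp [Algebra.ofId_apply, Matrix.algebraMap_matrix_apply]

/-- Positive sign means the form is symmetric, `K = PᵀP`, and conjugation by `P` turns `⋆` into
transposition. The block becomes the commutant of `m` copies of the sign character. -/
theorem exists_realization_re (hH : IsEquippedCardyFrobenius H) {x : H.A →ₐ[ℂ] ℂ}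
    (hx : x.comp (starAHom hH) = x) {m : ℕ} {p : H.B →ₐ[ℂ] Matrix (Fin m) (Fin m) ℂ}
    (hp : Function.Surjective p) (hker : ∀ b, p b = 0 ↔ H.φ (idem x) * b = 0) (hc0 : c x ≠ 0)
    (hc : ∀ b, H.lB (H.φ (idem x) * b) = c x * (p b).trace) (hU : c x * x H.U = 1)
    (ht : t x = .re) : Nonempty (Realization H {x} t c) := by
  obtain ⟨K, L, hKL, hLK, hps, hK⟩ := exists_form_of_block hH hx hp hker (c x) hc0 hc
  have hKs : K.transpose = K := by
    rcases Nat.eq_zero_or_pos m with rfl | hm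
    · exact Subsingleton.elim _ _
    · rw [(hK hm.ne').2, hU, one_smul]
  have hLs : L.transpose = L := by
    calc L.transpose = L.transpose * K.transpose * L := by
          rw [hKs, Matrix.mul_assoc, hKL, Matrix.mul_one]
      _ = L := by rw [← Matrix.transpose_mul, hKL, Matrix.transpose_one, Matrix.one_mul]
  obtain ⟨P, hP⟩ := exists_eq_transpose_mul_self hKL hKs
  have h1 : (L * P.transpose) * P = 1 := by rw [Matrix.mul_assoc, ← hP, hLK]
  have h2 : P * (L * P.transpose) = 1 := mul_eq_one_comm.1 h1
  let q := conjHom p P (L * P.transpose) h2 h1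
  have hqs : ∀ b, q (H.starB b) = (q b).transpose := by
    intro b
    simp only [q, conjHom_apply, hps, Matrix.transpose_mul, Matrix.transpose_transpose, hLs]
    have : P * (L * (p b).transpose * K) * (L * P.transpose) =
      P * L * (p b).transpose * (K * L) * P.transpose := by simp only [Matrix.mul_assoc]
    rw [this, hKL, Matrix.mul_one]
    simp only [Matrix.mul_assoc]
  have hker' : ∀ b, q b = 0 ↔ H.φ (idem x) * b = 0 := fun b => by
    rw [conjHom_eq_zero_iff, hker]
  refine ⟨Realization.ofCommutant (C := ℂ) (d := 1) (r := m) (Algebra.ofId ℂ _)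
    (algebraMap ℂ (Matrix (Fin 1) (Fin 1) ℂ)).injective signRep ?_ ?_ ?_ ?_ q
    (conjHom_surjective hp) ?_ ?_ ?_ ?_⟩
  · intro g
    have h : quaternionSign g.1 * quaternionSign g.1 = 1 := by
      generalize g.1 = k
      revert k; decide +kernel
    rw [signRep_apply, Matrix.scalar_apply, Matrix.diagonal_transpose, Matrix.diagonal_mul_diagonal,
      ← Int.cast_mul, h, Int.cast_one, Matrix.diagonal_one]
  · refine ⟨(.xa 0, 1), ?_⟩
    rw [signRep_apply, quaternionSign_xa_zero, Int.cast_neg, Int.cast_one, map_neg, map_one]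
  · intro y g
    exact Algebra.commutes _ _
  · intro T _
    exact scalar_fin_one_surjective T
  · intro b i j
    rw [hqs, Matrix.transpose_apply, Algebra.ofId_apply, Matrix.algebraMap_eq_diagonal,
      Matrix.diagonal_transpose]
  · intro b
    rw [hker']
    simp
  · intro y hy b
    obtain rfl := Finset.mem_singleton.1 hy
    have h3 : ∑ i, (Algebra.ofId ℂ (Matrix (Fin 1) (Fin 1) ℂ) (q (H.φ (idem y) * b) i i)).trace =
        (q (H.φ (idem y) * b)).trace := by
      rw [Matrix.trace]
      refine Finset.sum_congr rfl fun i _ => ?_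
      simp [Algebra.ofId_apply, Matrix.algebraMap_eq_diagonal]
    rw [h3, trace_conjHom, ← hc, φ_idem_mul, ht]
    simp [CharType.degree]
  · intro z
    refine ⟨centralChar .re z, ?_, ?_⟩
    · change _ = Algebra.ofId ℂ _ (linChar signChar z)
      rw [linChar_apply]
      generalize z.1 = a
      induction a using MonoidAlgebra.induction_linear with
      | zero => simp
      | add a b ha hb => simp only [map_add, ha, hb]
      | single g w =>
        rw [MonoidAlgebra.lift_single, MonoidAlgebra.lift_single, map_smul, complexifyRep_signRep]
        rfl
    · rw [Finset.sum_singleton, block_smul_idem hker', ht, Matrix.scalar_apply,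
        Matrix.smul_one_eq_diagonal]

/-- The action of `Q₈ × ℤ/3ℤ` on the real quaternions. -/
def quaternionRepR : Q8Z3 →* Matrix (Fin 4) (Fin 4) ℝ :=
  ((Int.castRingHom ℝ).mapMatrix.toMonoidHom.comp quaternionRep).comp (MonoidHom.fst _ _)

theorem complexifyRep_quaternionRepR : complexifyRep quaternionRepR = quaternionRepC := by
  ext g i j
  rw [complexifyRep_apply, quaternionRepC_apply]
  simp [quaternionRepR]

/-- Negative sign means the form is skew, so `m = 2r` and a symplectic basis turns `⋆` into `X ↦ -J
Xᵀ J`. Seen on `r × r` matrices of quaternions, this is transposition in the commutant of `r` copies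
of the quaternionic representation. -/
theorem exists_realization_qu (hH : IsEquippedCardyFrobenius H) {x : H.A →ₐ[ℂ] ℂ}
    (hx : x.comp (starAHom hH) = x) {m : ℕ} {p : H.B →ₐ[ℂ] Matrix (Fin m) (Fin m) ℂ}
    (hp : Function.Surjective p) (hker : ∀ b, p b = 0 ↔ H.φ (idem x) * b = 0) (hc0 : c x ≠ 0)
    (hc : ∀ b, H.lB (H.φ (idem x) * b) = c x * (p b).trace) (hU : c x * x H.U = -1)
    (ht : t x = .qu) : Nonempty (Realization H {x} t c) := by
  obtain ⟨K, L, hKL, hLK, hps, hK⟩ := exists_form_of_block hH hx hp hker (c x) hc0 hc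
  have hKs : K.transpose = -K := by
    rcases Nat.eq_zero_or_pos m with rfl | hm
    · exact Subsingleton.elim _ _
    · rw [(hK hm.ne').2, hU, neg_one_smul]
  obtain ⟨r, P, P', h2, h1, hP⟩ := exists_eq_transpose_sympl_mul hKL hKs
  let J : Matrix (Fin r × Fin 2) (Fin r × Fin 2) ℂ :=
    Matrix.compRingEquiv (Fin r) (Fin 2) ℂ (Matrix.scalar (Fin r) sympl)
  have hJ : Matrix.kroneckerMap (· * ·) (1 : Matrix (Fin r) (Fin r) ℂ) sympl = J := by
    ext ⟨i, s⟩ ⟨j, k⟩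
    by_cases h : i = j
    · subst h; simp [J]
    · simp [J, h]
  rw [hJ] at hP
  have hJJ : J * J = -1 := by
    have : sympl * sympl = -1 := by
      ext i j
      fin_cases i <;> fin_cases j <;> simp [sympl]
    simp only [J]
    rw [← map_mul, ← map_mul, this, map_neg, map_neg, map_one, map_one]
  let q := conjHom p P P' h2 h1
  -- Obtained from `K = PᵀJP` and `J² = -1`; with `hKP` it evaluates the conjugate of `L (p b)ᵀ K`
  -- by `P`.
  have hPL : P * L = -(J * P'.transpose) := by
    have h3 : P'.transpose * P.transpose = 1 := by
      rw [← Matrix.transpose_mul, h2, Matrix.transpose_one]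
    have h4 : J * (J * (P * L)) = J * P'.transpose := by
      congr 1
      calc J * (P * L) = P'.transpose * P.transpose * J * P * L := by
            rw [h3, Matrix.one_mul, Matrix.mul_assoc]
        _ = P'.transpose * (P.transpose * J * P * L) := by simp only [Matrix.mul_assoc]
        _ = P'.transpose := by rw [← hP, hKL, Matrix.mul_one]
    rw [← Matrix.mul_assoc, hJJ, Matrix.neg_mul, Matrix.one_mul] at h4
    rw [← h4, neg_neg]
  have hKP : K * P' = P.transpose * J := by
    rw [hP, Matrix.mul_assoc, h2, Matrix.mul_one]
  have hqs : ∀ b, q (H.starB b) = -J * (q b).transpose * J := by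
    intro b
    simp only [q, conjHom_apply, hps, Matrix.transpose_mul]
    have : P * (L * (p b).transpose * K) * P' = (P * L) * (p b).transpose * (K * P') := by
      simp only [Matrix.mul_assoc]
    rw [this, hPL, hKP]
    simp only [Matrix.mul_assoc, Matrix.neg_mul]
  have hker' : ∀ b, q b = 0 ↔ H.φ (idem x) * b = 0 := fun b => by
    rw [conjHom_eq_zero_iff, hker]
  let e := Matrix.compAlgEquiv (Fin r) (Fin 2) ℂ ℂ
  refine ⟨Realization.ofCommutant (C := Matrix (Fin 2) (Fin 2) ℂ) (d := 4) (r := r) rightMul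
    rightMul_injective quaternionRepR ?_ ?_ ?_ ?_ ((e.symm : _ →ₐ[ℂ] _).comp q)
    (fun X => by
      obtain ⟨b, hb⟩ := conjHom_surjective (h := h2) (h' := h1) hp (e X)
      refine ⟨b, ?_⟩
      change e.symm (q b) = X
      rw [hb, AlgEquiv.symm_apply_apply]) ?_ ?_ ?_ ?_⟩
  · intro g
    have h := congrArg (Int.castRingHom ℝ).mapMatrix (quaternionRep_transpose g.1)
    rwa [map_mul, map_one] at h
  · refine ⟨(.a 2, 1), ?_⟩
    have h : quaternionRep (.a 2) = -1 := by decide +kernel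
    change (Int.castRingHom ℝ).mapMatrix (quaternionRep (.a 2)) = -1
    rw [h, map_neg, map_one]
  · intro y g
    rw [complexifyRep_quaternionRepR, rightMul_commute]
  · intro T hT
    rw [complexifyRep_quaternionRepR] at hT
    exact exists_rightMul_eq T hT
  · intro b i j
    rw [rightMul_transpose]
    congr 1
    change e.symm (q (H.starB b)) i j = _
    rw [hqs]
    have h3 : e.symm (-J * (q b).transpose * J) =
        -Matrix.scalar (Fin r) sympl * e.symm (q b).transpose * Matrix.scalar (Fin r) sympl := by
      apply e.injective
      rw [AlgEquiv.apply_symm_apply, map_mul, map_mul, map_neg, AlgEquiv.apply_symm_apply]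
      rfl
    rw [h3, ← map_neg, Matrix.scalar_apply, Matrix.scalar_apply, Matrix.mul_diagonal,
      Matrix.diagonal_mul]
    rfl
  · intro b
    change e.symm (q b) = 0 ↔ _
    rw [map_eq_zero_iff _ e.symm.injective, hker']
    simp
  · intro y hy b
    obtain rfl := Finset.mem_singleton.1 hy
    have h3 : ∑ i, (rightMul (e.symm (q (H.φ (idem y) * b)) i i)).trace =
        2 * (q (H.φ (idem y) * b)).trace := by
      rw [Matrix.trace, Fintype.sum_prod_type, Finset.mul_sum]
      refine Finset.sum_congr rfl fun i _ => ?_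
      rw [trace_rightMul]
      rfl
    change c y * ∑ i, (rightMul (e.symm (q (H.φ (idem y) * b)) i i)).trace = _
    have h4 := hc (H.φ (idem y) * b)
    rw [φ_idem_mul] at h4
    rw [h3, trace_conjHom, h4, ht]
    simp only [CharType.degree]
    ring
  · intro z
    refine ⟨centralChar .qu z • 1, ?_, ?_⟩
    · rw [complexifyRep_quaternionRepR, lift_quaternionRepC, map_smul, map_one]
      rfl
    · change e.symm (q _) = _
      rw [Finset.sum_singleton, block_smul_idem hker', ht, map_smul, map_one]
      ext i j : 2
      by_cases h : i = j
      · subst h; simp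
      · simp [h]

end Realizations

/-! ### Pairs of blocks exchanged by the involution: complex type. -/

section ComplexRealization

/-- The rotation matrices in the complexified plane, in terms of their eigenvalues. -/
def planeRotation : (ℂ × ℂ) →ₐ[ℂ] Matrix (Fin 2) (Fin 2) ℂ :=
  AlgHom.ofLinearMap
    { toFun := fun y => !![(y.1 + y.2) / 2, Complex.I * (y.1 - y.2) / 2;
        -Complex.I * (y.1 - y.2) / 2, (y.1 + y.2) / 2]
      map_add' := fun x y => by
        ext i j
        fin_cases i <;> fin_cases j <;> simp <;> ring
      map_smul' := fun z y => by
        ext i j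
        fin_cases i <;> fin_cases j <;> simp <;> ring }
    (by
      ext i j
      fin_cases i <;> fin_cases j <;> simp)
    (fun x y => by
      ext i j
      fin_cases i <;> fin_cases j <;> simp [Matrix.mul_apply, Fin.sum_univ_two] <;> ring_nf <;>
        simp only [Complex.I_sq] <;> ring)

theorem planeRotation_apply (y : ℂ × ℂ) : planeRotation y =
    !![(y.1 + y.2) / 2, Complex.I * (y.1 - y.2) / 2;
      -Complex.I * (y.1 - y.2) / 2, (y.1 + y.2) / 2] := rfl

theorem planeRotation_injective : Function.Injective planeRotation := by
  rw [injective_iff_map_eq_zero]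
  intro y hy
  have h0 := congrFun (congrFun hy 0) 0
  have h1 := congrFun (congrFun hy 0) 1
  simp [planeRotation_apply] at h0 h1
  ext <;> simp <;> grind

theorem planeRotation_transpose (y : ℂ × ℂ) :
    (planeRotation y).transpose = planeRotation y.swap := by
  ext i j
  fin_cases i <;> fin_cases j <;> simp [planeRotation_apply] <;> ring

theorem trace_planeRotation (y : ℂ × ℂ) : (planeRotation y).trace = y.1 + y.2 := by
  simp [planeRotation_apply, Matrix.trace_fin_two]

/-- The representation of `Q₈ × ℤ/3ℤ` by rotations and reflections through the origin of the
plane. -/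
def rotationRep : Q8Z3 →* Matrix (Fin 2) (Fin 2) ℝ where
  toFun g := !![(sextic g).re, -(sextic g).im; (sextic g).im, (sextic g).re]
  map_one' := by
    ext i j
    fin_cases i <;> fin_cases j <;> simp
  map_mul' g h := by
    ext i j
    fin_cases i <;> fin_cases j <;> simp [Matrix.mul_apply, Fin.sum_univ_two] <;> ring

theorem rotationRep_apply (g : Q8Z3) : rotationRep g =
    !![(sextic g).re, -(sextic g).im; (sextic g).im, (sextic g).re] := rfl

theorem complexifyRep_rotationRep (g : Q8Z3) :
    complexifyRep rotationRep g = planeRotation (sextic g, sexticConj g) := by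
  rw [complexifyRep_apply, rotationRep_apply, planeRotation_apply, sexticConj_apply]
  ext i j
  fin_cases i <;> fin_cases j <;> simp [Complex.add_conj, Complex.sub_conj] <;> ring_nf <;>
    simp [Complex.I_sq]

variable {H : EquippedData.{u, v} ℂ}

/-- The pair of representations `p` and `b ↦ p (b⋆)ᵀ`. -/
def pairHom (hH : IsEquippedCardyFrobenius H) {m : ℕ} (p : H.B →ₐ[ℂ] Matrix (Fin m) (Fin m) ℂ) :
    H.B →ₐ[ℂ] Matrix (Fin m) (Fin m) (ℂ × ℂ) :=
  AlgHom.ofLinearMap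
    { toFun := fun b => Matrix.of fun i j => (p b i j, dualHom hH p b i j)
      map_add' := fun a b => by
        rw [map_add, map_add]; rfl
      map_smul' := fun z b => by
        rw [map_smul, map_smul]; rfl }
    (by
      ext i j
      · by_cases h : i = j
        · subst h; simp [starB_one hH]
        · simp [h]
      · by_cases h : i = j
        · subst h; simp [starB_one hH]
        · simp [h, starB_one hH, Ne.symm h])
    (fun a b => by
      ext i j
      · simp [Matrix.mul_apply, Prod.fst_sum]
      · simp only [LinearMap.coe_mk, AddHom.coe_mk, Matrix.of_apply, map_mul, Matrix.mul_apply,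
          Prod.snd_sum, Prod.snd_mul])

theorem pairHom_apply (hH : IsEquippedCardyFrobenius H) {m : ℕ}
    (p : H.B →ₐ[ℂ] Matrix (Fin m) (Fin m) ℂ) (b : H.B) (i j : Fin m) :
    pairHom hH p b i j = (p b i j, p (H.starB b) j i) := rfl

variable [IsReduced H.A] {t : (H.A →ₐ[ℂ] ℂ) → CharType} {c : (H.A →ₐ[ℂ] ℂ) → ℂ}

open Classical in
-- The map `b ↦ (p b, p (b⋆)ᵀ)` identifies the sum of the two blocks with `M_m(ℂ × ℂ)`, and `⋆`
-- becomes transposition combined with the swap. The commutant of the rotations is `ℂ × ℂ`, in which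
-- transposition is the swap.
theorem exists_realization_cp (hH : IsEquippedCardyFrobenius H) {x x' : H.A →ₐ[ℂ] ℂ}
    (hx : x.comp (starAHom hH) = x') (hx' : x'.comp (starAHom hH) = x) (hne : x ≠ x') {m : ℕ}
    {p : H.B →ₐ[ℂ] Matrix (Fin m) (Fin m) ℂ}
    (hp : Function.Surjective p) (hker : ∀ b, p b = 0 ↔ H.φ (idem x) * b = 0)
    (hc : ∀ b, H.lB (H.φ (idem x) * b) = c x * (p b).trace) (hcx : c x' = c x)
    (ht : t x = .cp) (ht' : t x' = .cm) : Nonempty (Realization H {x, x'} t c) := by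
  have hpx : p (H.φ (idem x)) = 1 := by rw [block_φ hker, character_idem_self, one_smul]
  have hpx' : p (H.φ (idem x')) = 0 := by rw [block_φ hker, character_idem_of_ne hne, zero_smul]
  have hs : ∀ b, H.starB (H.φ (idem x) * b) = H.starB b * H.φ (idem x') := fun b => by
    rw [hH.starB_mul, ← hH.φ_star, star_idem hH, hx]
  have hs' : ∀ b, H.starB (H.φ (idem x') * b) = H.starB b * H.φ (idem x) := fun b => by
    rw [hH.starB_mul, ← hH.φ_star, star_idem hH, hx']
  have hker' : ∀ b, p (H.starB b) = 0 ↔ H.φ (idem x') * b = 0 := by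
    intro b
    rw [hker, hH.central, ← hs']
    constructor
    · intro h
      rw [← hH.starB_starB (H.φ (idem x') * b), h, map_zero]
    · intro h
      rw [h, map_zero]
  refine ⟨Realization.ofCommutant (C := ℂ × ℂ) (d := 2) (r := m) planeRotation
    planeRotation_injective rotationRep ?_ ?_ ?_ ?_ (pairHom hH p) ?_ ?_ ?_ ?_ ?_⟩
  · intro g
    have h := sextic_mul_star g
    rw [Complex.mul_conj] at h
    have h' : Complex.normSq (sextic g) = 1 := by exact_mod_cast h
    rw [Complex.normSq_apply] at h'
    rw [rotationRep_apply]
    ext i j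
    fin_cases i <;> fin_cases j <;> simp [Matrix.mul_apply, Fin.sum_univ_two] <;> linarith
  · refine ⟨(.xa 0, 1), ?_⟩
    rw [rotationRep_apply, sextic_negOne]
    ext i j
    fin_cases i <;> fin_cases j <;> simp
  · intro y g
    rw [complexifyRep_rotationRep, ← map_mul, mul_comm, map_mul]
  · intro T hT
    -- Commuting with one rotation by an angle other than `0` and `π` already determines the shape
    -- of `T`.
    obtain ⟨g, hg⟩ := exists_sextic_im_ne_zero
    have h := hT g
    rw [complexifyRep_apply, rotationRep_apply] at h
    have hg' : ((sextic g).im : ℂ) ≠ 0 := by exact_mod_cast hg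
    have h0 := congrFun (congrFun h 0) 0
    have h1 := congrFun (congrFun h 0) 1
    simp [Matrix.mul_apply, Fin.sum_univ_two] at h0 h1
    have e0 : T 1 0 = -T 0 1 := by
      apply mul_left_cancel₀ hg'
      linear_combination h0
    have e1 : T 1 1 = T 0 0 := by
      apply mul_left_cancel₀ hg'
      linear_combination h1
    refine ⟨(T 0 0 - Complex.I * T 0 1, T 0 0 + Complex.I * T 0 1), ?_⟩
    rw [planeRotation_apply]
    ext i j
    fin_cases i <;> fin_cases j <;> simp [e0, e1] <;> ring_nf <;> simp [Complex.I_sq]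
  · intro X
    obtain ⟨b₁, hb₁⟩ := hp (X.map Prod.fst)
    obtain ⟨b₂, hb₂⟩ := hp (X.map Prod.snd).transpose
    -- The first summand lies in the block at `x`, the second in the block at `x'`, so the two
    -- components are prescribed independently.
    refine ⟨H.φ (idem x) * b₁ + H.starB (H.φ (idem x) * b₂), ?_⟩
    have e1 : p (H.φ (idem x) * b₁ + H.starB (H.φ (idem x) * b₂)) = X.map Prod.fst := by
      rw [hs, map_add, map_mul, map_mul, hpx, hpx', one_mul, mul_zero, add_zero, hb₁]
    have e2 : p (H.starB (H.φ (idem x) * b₁ + H.starB (H.φ (idem x) * b₂))) =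
        (X.map Prod.snd).transpose := by
      rw [map_add, hH.starB_starB, hs, map_add, map_mul, map_mul, hpx, hpx', one_mul, mul_zero,
        zero_add, hb₂]
    refine Matrix.ext fun i j => ?_
    rw [pairHom_apply, e1, e2]
    rfl
  · intro b i j
    rw [planeRotation_transpose, pairHom_apply, pairHom_apply, hH.starB_starB]
    rfl
  · intro b
    have : pairHom hH p b = 0 ↔ p b = 0 ∧ p (H.starB b) = 0 := by
      constructor
      · intro h
        exact ⟨Matrix.ext fun i j => congrArg Prod.fst (congrFun (congrFun h i) j),
          Matrix.ext fun i j => congrArg Prod.snd (congrFun (congrFun h j) i)⟩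
      · rintro ⟨h1, h2⟩
        refine Matrix.ext fun i j => ?_
        rw [pairHom_apply, h1, h2]
        rfl
    rw [this, hker, hker']
    simp
  · intro y hy b
    have htr : ∀ b, ∑ i, (planeRotation (pairHom hH p b i i)).trace =
        (p b).trace + (p (H.starB b)).trace := by
      intro b
      rw [Matrix.trace, Matrix.trace, ← Finset.sum_add_distrib]
      refine Finset.sum_congr rfl fun i _ => ?_
      rw [trace_planeRotation]
      rfl
    rw [htr]
    rcases Finset.mem_insert.1 hy with rfl | hy
    · rw [hs, map_mul, map_mul, hpx, hpx', one_mul, mul_zero, Matrix.trace_zero, add_zero, hc, ht]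
      simp [CharType.degree]
    · obtain rfl := Finset.mem_singleton.1 hy
      rw [hs', map_mul, map_mul, hpx, hpx', mul_one, zero_mul, Matrix.trace_zero, zero_add, ht',
        ← hH.lB_star, hs', ← hH.central, hc, hcx]
      simp [CharType.degree]
  · intro z
    refine ⟨(centralChar .cp z, centralChar .cm z), ?_, ?_⟩
    · change _ = planeRotation (linChar sextic z, linChar sexticConj z)
      rw [linChar_apply, linChar_apply]
      generalize z.1 = a
      induction a using MonoidAlgebra.induction_linear with
      | zero =>
        simp only [map_zero]
        exact (map_zero planeRotation).symm
      | add a b ha hb =>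
        simp only [map_add, ha, hb]
        rw [← map_add]
        rfl
      | single g w =>
        rw [MonoidAlgebra.lift_single, MonoidAlgebra.lift_single, MonoidAlgebra.lift_single,
          complexifyRep_rotationRep, ← map_smul]
        rfl
    · rw [Finset.sum_pair hne, ht, ht']
      have e1 : p (H.φ (centralChar .cp z • idem x + centralChar .cm z • idem x')) =
          centralChar .cp z • 1 := by
        rw [map_add, map_add, map_smul, map_smul, map_smul, map_smul, hpx, hpx', smul_zero, add_zero]
      have e2 : p (H.starB (H.φ (centralChar .cp z • idem x + centralChar .cm z • idem x'))) =
          centralChar .cm z • 1 := by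
        rw [← hH.φ_star, map_add, map_smul, map_smul, star_idem hH, star_idem hH, hx, hx', map_add,
          map_add, map_smul, map_smul, map_smul, map_smul, hpx, hpx', smul_zero, zero_add]
      refine Matrix.ext fun i j => ?_
      rw [pairHom_apply, e1, e2]
      by_cases h : i = j
      · subst h; simp
      · simp [h, Ne.symm h]

end ComplexRealization

/-! ### Choosing scalars, types and orbit representatives for all characters. -/

section AllBlocks

variable {H : EquippedData.{u, v} ℂ} [IsReduced H.A]

/-- The action of the involution on the characters of `A`. -/
def starChar (hH : IsEquippedCardyFrobenius H) (x : H.A →ₐ[ℂ] ℂ) : H.A →ₐ[ℂ] ℂ :=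
  x.comp (starAHom hH)

omit [IsReduced H.A] in
theorem starChar_apply (hH : IsEquippedCardyFrobenius H) (x : H.A →ₐ[ℂ] ℂ) (a : H.A) :
    starChar hH x a = x (H.starA a) := rfl

omit [IsReduced H.A] in
theorem starChar_starChar (hH : IsEquippedCardyFrobenius H) (x : H.A →ₐ[ℂ] ℂ) :
    starChar hH (starChar hH x) = x := by
  ext a
  rw [starChar_apply, starChar_apply, hH.starA_starA]

/-- Hence `U` vanishes at characters that are not self-dual, and `x(U)` is an inverse square root of
`l_A (idem x)` at self-dual ones. -/
theorem sq_character_U (hH : IsEquippedCardyFrobenius H) (x : H.A →ₐ[ℂ] ℂ) :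
    (x H.U) ^ 2 = (H.lA (idem x))⁻¹ * x (idem (starChar hH x)) := by
  rw [← map_pow, hH.U_sq, hH.frobeniusA.character_casimirStar, star_idem hH]
  rfl

/-- On an orbit `c` is constant up to sign because `l_A` is invariant. On nonzero blocks the sign is
excluded by `l_B (φ (idem x)) = c m` with `m > 0` and the invariance of `l_B`. -/
theorem exists_blocks (hH : IsEquippedCardyFrobenius H) [IsSemisimpleRing H.B] :
    ∃ (m : (H.A →ₐ[ℂ] ℂ) → ℕ) (p : ∀ x, H.B →ₐ[ℂ] Matrix (Fin (m x)) (Fin (m x)) ℂ)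
      (c : (H.A →ₐ[ℂ] ℂ) → ℂ), (∀ x, Function.Surjective (p x)) ∧
      (∀ x b, p x b = 0 ↔ H.φ (idem x) * b = 0) ∧ (∀ x, c x ^ 2 = H.lA (idem x)) ∧
      (∀ x b, H.lB (H.φ (idem x) * b) = c x * (p x b).trace) ∧
      ∀ x, c (starChar hH x) = c x := by
  classical
  choose m p hp hker hc using fun x => exists_block (H := H) hH.toIsCardyFrobenius x
  choose sq hsq using fun z : ℂ => IsAlgClosed.exists_pow_nat_eq z (n := 2) two_pos
  choose c₀ hc₀ hc₁ using hc
  have hlA : ∀ x, H.lA (idem (starChar hH x)) = H.lA (idem x) := fun x => by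
    rw [← hH.lA_star (idem x), star_idem hH]; rfl
  -- Over a zero block any root is allowed; a fixed choice depending only on `l_A (idem x)` is
  -- constant on orbits.
  let c : (H.A →ₐ[ℂ] ℂ) → ℂ := fun x =>
    if h : m x = 0 then sq (H.lA (idem x)) else c₀ x h
  have hcsq : ∀ x, c x ^ 2 = H.lA (idem x) := by
    intro x
    by_cases h : m x = 0
    · simp only [c, dif_pos h, hsq]
    · simp only [c, dif_neg h, hc₀]
  have hctr : ∀ x b, H.lB (H.φ (idem x) * b) = c x * (p x b).trace := by
    intro x b
    by_cases h : m x = 0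
    · have : IsEmpty (Fin (m x)) := by rw [h]; infer_instance
      have h0 : p x b = 0 := Subsingleton.elim _ _
      rw [(hker x b).1 h0, h0, map_zero, Matrix.trace_zero, mul_zero]
    · simp only [c, dif_neg h]
      exact hc₁ x h b
  refine ⟨m, p, c, hp, hker, hcsq, hctr, fun x => ?_⟩
  have h1 : ∀ x, m x ≠ 0 → H.φ (idem x) ≠ 0 := by
    intro x hm h
    have : NeZero (m x) := ⟨hm⟩
    have h2 := (hker x 1).2 (by rw [h, zero_mul])
    rw [map_one] at h2
    exact one_ne_zero h2
  have h2 : ∀ x, m x = 0 → H.φ (idem x) = 0 := by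
    intro x h
    have : IsEmpty (Fin (m x)) := by rw [h]; infer_instance
    rw [← mul_one (H.φ (idem x)), ← hker]
    exact Subsingleton.elim _ _
  have hφ : H.φ (idem (starChar hH x)) = H.starB (H.φ (idem x)) := by
    rw [← hH.φ_star, star_idem hH]; rfl
  by_cases h : m x = 0
  · have h' : m (starChar hH x) = 0 := by
      by_contra hne
      apply h1 _ hne
      rw [hφ, h2 x h, map_zero]
    simp only [c, dif_pos h, dif_pos h', hlA]
  · have e1 := hctr x 1
    have e2 := hctr (starChar hH x) 1
    rw [mul_one, map_one, Matrix.trace_one, Fintype.card_fin] at e1 e2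
    rw [hφ, hH.lB_star, e1] at e2
    have e3 : c (starChar hH x) ^ 2 = c x ^ 2 := by rw [hcsq, hcsq, hlA]
    rcases sq_eq_sq_iff_eq_or_eq_neg.1 e3 with e4 | e4
    · exact e4
    · exfalso
      have hcx : c x ≠ 0 := fun h0 => by
        have := hcsq x
        rw [h0] at this
        exact hH.frobeniusA.apply_idem_ne_zero x (by rw [← this]; simp)
      rw [e4] at e2
      have e5 : c x * ((m x : ℂ) + m (starChar hH x)) = 0 := by linear_combination e2
      have e6 := (mul_eq_zero.1 e5).resolve_left hcx
      have e7 : m x + m (starChar hH x) = 0 := by exact_mod_cast e6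
      omega

open Classical in
/-- Every semi-simple equipped Cardy-Frobenius algebra is a sum of parts realized by
representations of `Q₈ × ℤ/3ℤ`. -/
theorem exists_realizations (hH : IsEquippedCardyFrobenius H) [IsSemisimpleRing H.B]
    [Fintype (H.A →ₐ[ℂ] ℂ)] :
    ∃ (c : (H.A →ₐ[ℂ] ℂ) → ℂ) (t : (H.A →ₐ[ℂ] ℂ) → CharType)
      (rep : (H.A →ₐ[ℂ] ℂ) → (H.A →ₐ[ℂ] ℂ)),
      (∀ x, c x ^ 2 = H.lA (idem x)) ∧ (∀ x, c (starChar hH x) = c x) ∧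
      (∀ x, t (starChar hH x) = (t x).conj) ∧ (∀ x, rep (starChar hH x) = rep x) ∧
      (∀ x, starChar hH x = x → t x = .re ∧ c x * x H.U = 1 ∨ t x = .qu ∧ c x * x H.U = -1) ∧
      (∀ x, starChar hH x ≠ x → t x = .cp ∨ t x = .cm) ∧
      (∀ x y, rep x = rep y → y = x ∨ y = starChar hH x) ∧
      ∀ o, Nonempty (Realization H (Finset.univ.filter fun x => rep x = o) t c) := by
  obtain ⟨m, p, c, hp, hker, hcsq, hctr, hcs⟩ := exists_blocks hH
  have hc0 : ∀ x, c x ≠ 0 := fun x h0 => by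
    have := hcsq x
    rw [h0] at this
    exact hH.frobeniusA.apply_idem_ne_zero x (by rw [← this]; simp)
  let e := Fintype.equivFin (H.A →ₐ[ℂ] ℂ)
  let σ := starChar hH
  have hσσ : ∀ x, σ (σ x) = x := starChar_starChar hH
  -- The representative of an orbit is its smaller element in an arbitrary enumeration.
  let rep : (H.A →ₐ[ℂ] ℂ) → (H.A →ₐ[ℂ] ℂ) := fun x => if e x ≤ e (σ x) then x else σ x
  have hrep : ∀ x, rep x = x ∨ rep x = σ x := fun x => by
    by_cases h : e x ≤ e (σ x)
    · exact Or.inl (if_pos h)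
    · exact Or.inr (if_neg h)
  have hrepσ : ∀ x, rep (σ x) = rep x := fun x => by
    simp only [rep, hσσ]
    by_cases h : e x ≤ e (σ x)
    · rw [if_pos h]
      by_cases h' : e (σ x) ≤ e x
      · rw [if_pos h', e.injective (le_antisymm h' h)]
      · rw [if_neg h']
    · rw [if_neg h, if_pos (le_of_not_ge h)]
  have hrr : ∀ x, rep (rep x) = rep x := fun x => by
    rcases hrep x with h | h
    · rw [h, h]
    · conv_lhs => rw [h, hrepσ]
  have hfix : ∀ x, σ x = x → c x * x H.U = 1 ∨ c x * x H.U = -1 := by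
    intro x hx
    have h := sq_character_U hH x
    change _ = _ * x (idem (σ x)) at h
    rw [hx, character_idem_self, mul_one, ← hcsq] at h
    have h2 : (c x * x H.U) ^ 2 = 1 := by
      rw [mul_pow, h, mul_inv_cancel₀ (pow_ne_zero 2 (hc0 x))]
    exact sq_eq_one_iff.1 h2
  let t : (H.A →ₐ[ℂ] ℂ) → CharType := fun x =>
    if σ x = x then (if c x * x H.U = 1 then .re else .qu) else (if rep x = x then .cp else .cm)
  refine ⟨c, t, rep, hcsq, hcs, ?_, hrepσ, ?_, ?_, ?_, ?_⟩
  · intro x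
    change t (σ x) = _
    by_cases hx : σ x = x
    · rw [hx]
      simp only [t, if_pos hx]
      by_cases h : c x * x H.U = 1
      · rw [if_pos h]; rfl
      · rw [if_neg h]; rfl
    · have hx' : σ (σ x) ≠ σ x := fun h => hx (by rw [hσσ] at h; exact h.symm)
      simp only [t, if_neg hx, if_neg hx', hrepσ]
      rcases hrep x with h | h
      · simp only [h, if_true, if_false, Ne.symm hx]
        rfl
      · have h' : ¬ rep x = x := fun h' => hx (by rw [← h, h'])
        simp only [h, if_true, if_false, hx]
        rfl
  · intro x hx
    change σ x = x at hx
    simp only [t, if_pos hx]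
    rcases hfix x hx with h | h
    · left; exact ⟨if_pos h, h⟩
    · right; exact ⟨if_neg (by rw [h]; norm_num), h⟩
  · intro x hx
    change σ x ≠ x at hx
    simp only [t, if_neg hx]
    by_cases h : rep x = x
    · left; rw [if_pos h]
    · right; rw [if_neg h]
  · intro x y h
    change y = x ∨ y = σ x
    rcases hrep x with hx | hx <;> rcases hrep y with hy | hy <;> rw [hx, hy] at h
    · exact Or.inl h.symm
    · right; rw [h, hσσ]
    · exact Or.inr h.symm
    · left; rw [← hσσ y, ← h, hσσ]
  · intro o
    by_cases ho : rep o = o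
    · have hS : (Finset.univ.filter fun x => rep x = o) = {o, σ o} := by
        ext x
        simp only [Finset.mem_filter, Finset.mem_univ, true_and, Finset.mem_insert,
          Finset.mem_singleton]
        constructor
        · intro h
          rcases hrep x with hx | hx
          · left; rw [← hx, h]
          · right; rw [← h, hx, hσσ]
        · rintro (rfl | rfl)
          · exact ho
          · rw [hrepσ, ho]
      rw [hS]
      by_cases hx : σ o = o
      · rw [hx, Finset.pair_eq_singleton]
        rcases hfix o hx with h | h
        · exact exists_realization_re hH hx (hp o) (hker o) (hc0 o) (hctr o) h
            (by simp only [t, if_pos hx, if_pos h])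
        · exact exists_realization_qu hH hx (hp o) (hker o) (hc0 o) (hctr o) h
            (by simp only [t, if_pos hx]; exact if_neg (by rw [h]; norm_num))
      · have hx' : σ (σ o) ≠ σ o := fun h => hx (by rw [hσσ] at h; exact h.symm)
        exact exists_realization_cp hH rfl (hσσ o) (fun h => hx h.symm) (hp o) (hker o) (hctr o)
          (hcs o) (by simp only [t, if_neg hx, if_pos ho]) (by
            simp only [t, if_neg hx', hrepσ]
            exact if_neg (by rw [ho]; exact fun h => hx h.symm))
    -- An index that represents no orbit receives the zero representation.
    · have hS : (Finset.univ.filter fun x => rep x = o) = ∅ := by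
        rw [Finset.filter_eq_empty_iff]
        rintro x - rfl
        exact ho (hrr x)
      rw [hS]
      exact ⟨Realization.empty⟩

end AllBlocks

/-! ### Functoriality of the centre of the group algebra -/

section CenterMap

variable {G : Type u} [Group G] {K : Type v} [Group K]

theorem mapDomain_mem_center (f : G →* K) (hf : Function.Surjective f) (z : GroupCenter ℂ G) :
    MonoidAlgebra.mapDomainAlgHom ℂ ℂ f z.1 ∈ GroupCenter ℂ K := by
  rw [Subalgebra.mem_center_iff]
  intro y
  induction y using MonoidAlgebra.induction_linear with
  | zero => simp
  | add y y' hy hy' => rw [add_mul, mul_add, hy, hy']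
  | single k d =>
    obtain ⟨g, rfl⟩ := hf k
    have h := Subalgebra.mem_center_iff.1 z.2 (MonoidAlgebra.single g d)
    have h' := congrArg (MonoidAlgebra.mapDomainAlgHom ℂ ℂ f) h
    rw [map_mul, map_mul] at h'
    simpa using h'

/-- The map of centres of group algebras induced by a surjective homomorphism. -/
def centerMap (f : G →* K) (hf : Function.Surjective f) : GroupCenter ℂ G →ₐ[ℂ] GroupCenter ℂ K :=
  ((MonoidAlgebra.mapDomainAlgHom ℂ ℂ f).comp (GroupCenter ℂ G).val).codRestrict _
    (mapDomain_mem_center f hf)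

theorem centerMap_coe (f : G →* K) (hf : Function.Surjective f) (z : GroupCenter ℂ G) :
    (centerMap f hf z : MonoidAlgebra ℂ K) = MonoidAlgebra.mapDomainAlgHom ℂ ℂ f z.1 := rfl

theorem centerMap_centerStar (f : G →* K) (hf : Function.Surjective f) (z : GroupCenter ℂ G) :
    centerMap f hf (centerStar ℂ G z) = centerStar ℂ K (centerMap f hf z) := by
  apply Subtype.ext
  rw [centerMap_coe, centerStar_coe, centerStar_coe, centerMap_coe]
  generalize z.1 = x
  induction x using MonoidAlgebra.induction_linear with
  | zero => simp
  | add x y hx hy => simp only [map_add, hx, hy]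
  | single g c => simp [groupInv_single]

theorem lift_mapDomain {R : Type*} [Ring R] [Algebra ℂ R] (f : G →* K) (η : K →* R)
    (x : MonoidAlgebra ℂ G) :
    MonoidAlgebra.lift ℂ R K η (MonoidAlgebra.mapDomainAlgHom ℂ ℂ f x) =
      MonoidAlgebra.lift ℂ R G (η.comp f) x := by
  induction x using MonoidAlgebra.induction_linear with
  | zero => simp
  | add x y hx hy => simp only [map_add, hx, hy]
  | single g c => simp

variable [Fintype G] [Fintype K]

/-- All fibres of `f` have the same size; both sides are the double sum of `F (f g * k)`. -/
theorem card_smul_sum_comp {M : Type*} [AddCommGroup M] (f : G →* K) (hf : Function.Surjective f)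
    (F : K → M) : Fintype.card K • ∑ g, F (f g) = Fintype.card G • ∑ k, F k := by
  have h : ∀ k, ∑ g, F (f g * k) = ∑ g, F (f g) := fun k => by
    obtain ⟨a, rfl⟩ := hf k
    exact Fintype.sum_equiv (Equiv.mulRight a) _ _ (fun g => by simp)
  calc Fintype.card K • ∑ g, F (f g) = ∑ k, ∑ g, F (f g * k) := by simp [h]
    _ = ∑ g : G, ∑ k, F k := by
      rw [Finset.sum_comm]
      exact Finset.sum_congr rfl fun g _ => Fintype.sum_equiv (Equiv.mulLeft (f g)) _ _ fun _ => rfl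
    _ = Fintype.card G • ∑ k, F k := by simp

theorem card_smul_centerMap_sumSquares (f : G →* K) (hf : Function.Surjective f) :
    Fintype.card K • centerMap f hf (sumSquares ℂ G) = Fintype.card G • sumSquares ℂ K := by
  apply Subtype.ext
  have h := card_smul_sum_comp f hf fun k => MonoidAlgebra.single (k ^ 2) (1 : ℂ)
  simp only [sumSquares, AddSubmonoidClass.coe_nsmul, centerMap_coe, map_sum]
  rw [← h]
  simp

theorem card_smul_centerMap_conjSum (f : G →* K) (hf : Function.Surjective f) (c : G) :
    Fintype.card K • centerMap f hf (conjSum c) = Fintype.card G • conjSum (f c) := by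
  apply Subtype.ext
  have h := card_smul_sum_comp f hf fun k => MonoidAlgebra.single (k * f c * k⁻¹) (1 : ℂ)
  simp only [conjSum, AddSubmonoidClass.coe_nsmul, centerMap_coe, map_sum]
  rw [← h]
  simp

theorem centerChar_ext {x y : GroupCenter ℂ G →ₐ[ℂ] ℂ} (h : ∀ c, x (conjSum c) = y (conjSum c)) :
    x = y := by
  ext z
  have hx := congrArg x (sum_coeff_smul_conjSum z)
  have hy := congrArg y (sum_coeff_smul_conjSum z)
  simp only [map_sum, map_smul, h, smul_eq_mul] at hx hy
  exact mul_left_cancel₀ card_ne_zero_complex (hx.symm.trans hy)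

end CenterMap

/-! ### Characters of the centre of the group algebra -/

section CenterCharacters

variable {G : Type u} [Group G]

/-- The involution of the centre as an algebra homomorphism. -/
def centerStarHom (G : Type u) [Group G] : GroupCenter ℂ G →ₐ[ℂ] GroupCenter ℂ G :=
  AlgHom.ofLinearMap (centerStar ℂ G) centerStar_one centerStar_mul

variable [Fintype G]

theorem centerStar_idem (x : GroupCenter ℂ G →ₐ[ℂ] ℂ) :
    centerStar ℂ G (idem x) = idem (x.comp (centerStarHom G)) := by
  apply ext_character
  intro y
  change (y.comp (centerStarHom G)) (idem x) = _
  by_cases h : y = x.comp (centerStarHom G)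
  · have h' : y.comp (centerStarHom G) = x := by
      rw [h]
      ext z
      exact congrArg x (centerStar_centerStar z)
    rw [h', h, character_idem_self, character_idem_self]
  · have h' : y.comp (centerStarHom G) ≠ x := by
      rintro rfl
      apply h
      ext z
      exact congrArg y (centerStar_centerStar z).symm
    rw [character_idem_of_ne h, character_idem_of_ne h']

omit [Fintype G] in
theorem character_inv_unit (μ : (GroupCenter ℂ G)ˣ) (x : GroupCenter ℂ G →ₐ[ℂ] ℂ) :
    x (↑μ⁻¹ : GroupCenter ℂ G) = (x (μ : GroupCenter ℂ G))⁻¹ := by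
  apply eq_inv_of_mul_eq_one_left
  rw [← map_mul, Units.inv_mul, map_one]

theorem sq_character_sumSquares {μ : (GroupCenter ℂ G)ˣ}
    (hμ : centerStar ℂ G (μ : GroupCenter ℂ G) = μ) (x : GroupCenter ℂ G →ₐ[ℂ] ℂ) :
    (x (↑μ⁻¹ * sumSquares ℂ G)) ^ 2 =
      (centerFunctional μ (idem x))⁻¹ * x (idem (x.comp (centerStarHom G))) := by
  rw [← map_pow, sq_eq_casimirStar μ hμ, ← centerStar_idem]
  exact (isFrobeniusPair_centerFunctional μ).character_casimirStar _ x

/-- At a self-dual character the identity `U² = ` Casimir element gives `l_A (idem x)`, with no use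
of orthogonality relations. -/
theorem centerFunctional_idem_of_selfDual {μ : (GroupCenter ℂ G)ˣ}
    (hμ : centerStar ℂ G (μ : GroupCenter ℂ G) = μ) {x : GroupCenter ℂ G →ₐ[ℂ] ℂ}
    (hx : ∀ z, x (centerStar ℂ G z) = x z) :
    centerFunctional μ (idem x) = (x (μ : GroupCenter ℂ G)) ^ 2 * (x (sumSquares ℂ G) ^ 2)⁻¹ := by
  have h : x.comp (centerStarHom G) = x := AlgHom.ext hx
  have h1 := sq_character_sumSquares hμ x
  rw [h, character_idem_self, mul_one, map_mul, mul_pow, character_inv_unit] at h1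
  rw [← inv_inv (centerFunctional μ (idem x)), ← h1, mul_inv, inv_pow, inv_inv]

theorem centerFunctional_idem_of_linear (μ : (GroupCenter ℂ G)ˣ) (η : G →* ℂ)
    (x : GroupCenter ℂ G →ₐ[ℂ] ℂ)
    (hx : ∀ z : GroupCenter ℂ G, x z = MonoidAlgebra.lift ℂ ℂ G η z.1) :
    centerFunctional μ (idem x) = (x (μ : GroupCenter ℂ G)) ^ 2 * ((Fintype.card G : ℂ) ^ 2)⁻¹ := by
  have h := character_casimirStar_id_of_linear μ η x hx
  have h' := (isFrobeniusPair_centerFunctional μ).character_casimirStar LinearMap.id x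
  rw [LinearMap.id_apply, character_idem_self, mul_one] at h'
  replace h := h'.symm.trans h
  rw [← inv_inv (centerFunctional μ (idem x)), h, mul_inv, inv_inv, mul_comm]

end CenterCharacters

/-! ### Central characters pulled back from the factors of the product group. -/

section ProductCharacters

variable {O : Type}

theorem eval_surjective (o : O) :
    Function.Surjective (Pi.evalMonoidHom (fun _ : O => Q8Z3) o) := fun q => ⟨fun _ => q, rfl⟩

/-- The central character of type `t` of the factor `o` of a product of copies of `Q₈ × ℤ/3ℤ`. -/
def factorChar (o : O) (t : CharType) : GroupCenter ℂ (O → Q8Z3) →ₐ[ℂ] ℂ :=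
  (centralChar t).comp (centerMap (Pi.evalMonoidHom (fun _ : O => Q8Z3) o) (eval_surjective o))

theorem factorChar_centerStar (o : O) (t : CharType) (z : GroupCenter ℂ (O → Q8Z3)) :
    factorChar o t (centerStar ℂ _ z) = factorChar o t.conj z := by
  simp only [factorChar, AlgHom.comp_apply]
  rw [centerMap_centerStar, centralChar_centerStar]

variable [Fintype O] [DecidableEq O]

theorem card_mul_factorChar_conjSum (o : O) (t : CharType) (c : O → Q8Z3) :
    (Fintype.card Q8Z3 : ℂ) * factorChar o t (conjSum c) =
      Fintype.card (O → Q8Z3) * centralChar t (conjSum (c o)) := by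
  have h := congrArg (centralChar t)
    (card_smul_centerMap_conjSum (Pi.evalMonoidHom (fun _ : O => Q8Z3) o) (eval_surjective o) c)
  rw [map_nsmul, map_nsmul, nsmul_eq_mul, nsmul_eq_mul] at h
  exact h

theorem card_mul_factorChar_sumSquares (o : O) (t : CharType) :
    (Fintype.card Q8Z3 : ℂ) * factorChar o t (sumSquares ℂ _) =
      Fintype.card (O → Q8Z3) * centralChar t (sumSquares ℂ _) := by
  have h := congrArg (centralChar t)
    (card_smul_centerMap_sumSquares (Pi.evalMonoidHom (fun _ : O => Q8Z3) o) (eval_surjective o))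
  rw [map_nsmul, map_nsmul, nsmul_eq_mul, nsmul_eq_mul] at h
  exact h

theorem factorChar_re_sumSquares (o : O) :
    factorChar o .re (sumSquares ℂ _) = Fintype.card (O → Q8Z3) := by
  have h := card_mul_factorChar_sumSquares o .re
  rw [centralChar_re_sumSquares, mul_comm] at h
  exact mul_right_cancel₀ card_ne_zero_complex h

theorem factorChar_qu_sumSquares (o : O) :
    factorChar o .qu (sumSquares ℂ _) = -Fintype.card (O → Q8Z3) / 2 := by
  have h := card_mul_factorChar_sumSquares o .qu
  rw [centralChar_qu_sumSquares] at h
  refine mul_left_cancel₀ (card_ne_zero_complex (G := Q8Z3)) (h.trans ?_)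
  ring

/-- Evaluate at the element of factor `o` acting by `-1`: a character from another factor sees the
identity there. -/
theorem eq_of_factorChar_eq {o o' : O} {t t' : CharType} (h : factorChar o t = factorChar o' t') :
    o = o' := by
  by_contra hne
  have h1 := card_mul_factorChar_conjSum o t (Pi.mulSingle o t.negOne)
  have h2 := card_mul_factorChar_conjSum o' t' (Pi.mulSingle o t.negOne)
  rw [h, h2, Pi.mulSingle_eq_same, Pi.mulSingle_eq_of_ne (Ne.symm hne),
    centralChar_conjSum_negOne] at h1
  have h3 := mul_left_cancel₀ card_ne_zero_complex h1
  have h4 : conjSum (1 : Q8Z3) = (Fintype.card Q8Z3 : ℂ) • 1 := by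
    apply Subtype.ext
    simp [conjSum, MonoidAlgebra.one_def]
  rw [h4, map_smul, map_one, smul_eq_mul, mul_one] at h3
  exact card_ne_zero_complex (self_eq_neg.1 h3)

theorem factorChar_cp_ne_cm (o : O) : factorChar o .cp ≠ factorChar o .cm := by
  intro h
  apply centralChar_cp_ne_cm
  apply centerChar_ext
  intro q
  have h1 := card_mul_factorChar_conjSum o .cp fun _ => q
  rw [h, card_mul_factorChar_conjSum] at h1
  exact (mul_left_cancel₀ card_ne_zero_complex h1).symm

/-- The one-dimensional types use the untwisted Casimir element; the quaternionic type is self-dual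
and uses its value on `∑ g²`. -/
theorem centerFunctional_idem_factorChar {μ : (GroupCenter ℂ (O → Q8Z3))ˣ}
    (hμ : centerStar ℂ _ (μ : GroupCenter ℂ (O → Q8Z3)) = μ) (o : O) (t : CharType) :
    centerFunctional μ (idem (factorChar o t)) =
      (factorChar o t (μ : GroupCenter ℂ (O → Q8Z3)) * t.degree / Fintype.card (O → Q8Z3)) ^ 2 := by
  have hlin : ∀ η : Q8Z3 →* ℂ, ∀ x : GroupCenter ℂ (O → Q8Z3) →ₐ[ℂ] ℂ,
      x = (linChar η).comp (centerMap (Pi.evalMonoidHom (fun _ : O => Q8Z3) o)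
        (eval_surjective o)) → centerFunctional μ (idem x) =
      (x (μ : GroupCenter ℂ (O → Q8Z3)) * 1 / Fintype.card (O → Q8Z3)) ^ 2 := by
    rintro η x rfl
    rw [centerFunctional_idem_of_linear μ (η.comp (Pi.evalMonoidHom (fun _ : O => Q8Z3) o)), mul_one,
      div_eq_mul_inv, mul_pow, inv_pow]
    intro z
    rw [AlgHom.comp_apply, linChar_apply, centerMap_coe, lift_mapDomain]
  cases t
  · exact hlin _ _ rfl
  · rw [centerFunctional_idem_of_selfDual hμ (factorChar_centerStar o .qu),
      factorChar_qu_sumSquares, CharType.degree]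
    have := card_ne_zero_complex (G := O → Q8Z3)
    field_simp
  · exact hlin _ _ rfl
  · exact hlin _ _ rfl

end ProductCharacters

/-! ### Products of matrix representations -/

section ProductRepresentation

variable {O : Type} [Fintype O] [DecidableEq O] {K : Type} [Group K] {ι : O → Type}
  [∀ o, Fintype (ι o)] [∀ o, DecidableEq (ι o)]

/-- The external direct sum of matrix representations `R o` of `K`, as a representation of the
product of copies of `K`. -/
def productRep {𝕜 : Type*} [CommRing 𝕜] (R : ∀ o, K →* Matrix (ι o) (ι o) 𝕜) :
    (O → K) →* Matrix (Σ o, ι o) (Σ o, ι o) 𝕜 :=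
  (Matrix.blockDiagonal'RingHom ι 𝕜).toMonoidHom.comp
    (MonoidHom.pi fun o => (R o).comp (Pi.evalMonoidHom _ o))

theorem productRep_apply {𝕜 : Type*} [CommRing 𝕜] (R : ∀ o, K →* Matrix (ι o) (ι o) 𝕜)
    (g : O → K) : productRep R g = Matrix.blockDiagonal' fun o => R o (g o) := rfl

theorem complexifyRep_productRep (R : ∀ o, K →* Matrix (ι o) (ι o) ℝ) :
    complexifyRep (productRep R) = productRep fun o => complexifyRep (R o) := by
  ext1 g
  rw [complexifyRep_apply, productRep_apply, productRep_apply,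
    Matrix.blockDiagonal'_map _ _ Complex.ofReal_zero]
  rfl

theorem productRep_transpose_mul (R : ∀ o, K →* Matrix (ι o) (ι o) ℝ)
    (h : ∀ o g, (R o g).transpose * R o g = 1) (g : O → K) :
    (productRep R g).transpose * productRep R g = 1 := by
  rw [productRep_apply, Matrix.blockDiagonal'_transpose, ← Matrix.blockDiagonal'_mul]
  simp only [h]
  exact Matrix.blockDiagonal'_one

theorem lift_productRep (R : ∀ o, K →* Matrix (ι o) (ι o) ℂ) (x : MonoidAlgebra ℂ (O → K)) :
    MonoidAlgebra.lift ℂ _ _ (productRep R) x = Matrix.blockDiagonal' fun o =>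
      MonoidAlgebra.lift ℂ _ _ (R o)
        (MonoidAlgebra.mapDomainAlgHom ℂ ℂ (Pi.evalMonoidHom (fun _ : O => K) o) x) := by
  induction x using MonoidAlgebra.induction_linear with
  | zero =>
    simp only [map_zero]
    exact Matrix.blockDiagonal'_zero.symm
  | add x y hx hy =>
    simp only [map_add, hx, hy]
    exact (Matrix.blockDiagonal'_add _ _).symm
  | single g c =>
    rw [MonoidAlgebra.lift_single, productRep_apply, ← Matrix.blockDiagonal'_smul]
    congr 1
    ext1 o
    simp [MonoidAlgebra.lift_single]

/-- The group element acting by `-1` in block `o` and by `1` in the others kills the off-diagonal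
blocks of anything commuting with it. -/
theorem eq_blockDiagonal'_of_commute (R : ∀ o, K →* Matrix (ι o) (ι o) ℂ)
    (hneg : ∀ o, ∃ h, R o h = -1) (T : Matrix (Σ o, ι o) (Σ o, ι o) ℂ)
    (hT : ∀ g, T * productRep R g = productRep R g * T) :
    T = Matrix.blockDiagonal' fun o => T.blockDiag' o := by
  ext ⟨o, i⟩ ⟨o', j⟩
  by_cases hoo : o = o'
  · subst hoo
    rw [Matrix.blockDiagonal'_apply_eq]
    rfl
  · rw [Matrix.blockDiagonal'_apply_ne _ _ _ hoo]
    obtain ⟨h, hh⟩ := hneg o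
    have hd : productRep R (Pi.mulSingle o h) =
        Matrix.diagonal fun a : Σ o, ι o => if a.1 = o then (-1 : ℂ) else 1 := by
      rw [productRep_apply, ← Matrix.blockDiagonal'_diagonal fun p (_ : ι p) =>
        if p = o then (-1 : ℂ) else 1]
      congr 1
      ext1 p
      by_cases hp : p = o
      · subst hp
        simp only [Pi.mulSingle_eq_same, if_true, hh]
        rw [← Matrix.diagonal_one, Matrix.diagonal_neg]
      · simp only [Pi.mulSingle_eq_of_ne hp, map_one, if_neg hp]
        exact Matrix.diagonal_one.symm
    have h1 := congrFun (congrFun (hT (Pi.mulSingle o h)) ⟨o, i⟩) ⟨o', j⟩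
    rw [hd, Matrix.mul_diagonal, Matrix.diagonal_mul] at h1
    simp only [if_true, if_neg (Ne.symm hoo), mul_one, neg_mul, one_mul] at h1
    exact self_eq_neg.1 h1

theorem blockDiag'_commute (R : ∀ o, K →* Matrix (ι o) (ι o) ℂ)
    (hneg : ∀ o, ∃ h, R o h = -1) (T : Matrix (Σ o, ι o) (Σ o, ι o) ℂ)
    (hT : ∀ g, T * productRep R g = productRep R g * T) (o : O) (k : K) :
    T.blockDiag' o * R o k = R o k * T.blockDiag' o := by
  have h := hT fun _ => k
  rw [eq_blockDiagonal'_of_commute R hneg T hT, productRep_apply, ← Matrix.blockDiagonal'_mul,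
    ← Matrix.blockDiagonal'_mul] at h
  have h' := congrFun (Matrix.blockDiagonal'_injective h) o
  simpa only [Matrix.blockDiag'_blockDiagonal'] using h'

end ProductRepresentation

/-! ### Representations on coordinate spaces -/

section Coordinates

variable {G : Type u} [Group G] {ι : Type} [Fintype ι] [DecidableEq ι]

/-- The representation on `ι → ℝ` given by a matrix representation. -/
def matrixRep (R : G →* Matrix ι ι ℝ) : Representation ℝ G (ι → ℝ) :=
  (Matrix.toLinAlgEquiv' : Matrix ι ι ℝ ≃ₐ[ℝ] _).toAlgHom.toRingHom.toMonoidHom.comp R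

theorem matrixRep_apply (R : G →* Matrix ι ι ℝ) (g : G) (a : ι → ℝ) :
    matrixRep R g a = (R g).mulVec a := rfl

/-- The standard form on `ι → ℝ`, invariant under an orthogonal representation. -/
def dotForm (R : G →* Matrix ι ι ℝ) (hR : ∀ g, (R g).transpose * R g = 1) :
    InvariantForm (matrixRep R) where
  form := Matrix.toBilin' 1
  symm := ⟨fun a b => by
    simp only [Matrix.toBilin'_apply', Matrix.one_mulVec]
    exact dotProduct_comm _ _⟩
  nondegenerate := by
    rw [LinearMap.BilinForm.nondegenerate_toBilin'_iff_det_ne_zero]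
    simp
  invariant g a b := by
    simp only [Matrix.toBilin'_apply', Matrix.one_mulVec, matrixRep_apply]
    rw [Matrix.dotProduct_mulVec, Matrix.vecMul_mulVec, hR, Matrix.vecMul_one]

/-- The basis of the complexification of `ι → ℝ`. -/
def complexBasis (ι : Type) [Fintype ι] [DecidableEq ι] : Module.Basis ι ℂ (ℂ ⊗[ℝ] (ι → ℝ)) :=
  (Pi.basisFun ℝ ι).baseChange ℂ

/-- The matrix of an operator on the complexification of `ι → ℝ`. -/
def complexMatrix (ι : Type) [Fintype ι] [DecidableEq ι] :
    Module.End ℂ (ℂ ⊗[ℝ] (ι → ℝ)) ≃ₐ[ℂ] Matrix ι ι ℂ :=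
  LinearMap.toMatrixAlgEquiv (complexBasis ι)

theorem complexMatrix_complexify (R : G →* Matrix ι ι ℝ) (g : G) :
    complexMatrix ι (complexify (matrixRep R) g) = complexifyRep R g := by
  ext i j
  rw [complexMatrix, LinearMap.toMatrixAlgEquiv_apply, complexBasis, Module.Basis.baseChange_apply,
    complexify_tmul, Module.Basis.baseChange_repr_tmul, matrixRep_apply]
  simp [complexifyRep_apply]

theorem complexMatrix_asAlgebraHom (R : G →* Matrix ι ι ℝ) (x : MonoidAlgebra ℂ G) :
    complexMatrix ι ((complexify (matrixRep R)).asAlgebraHom x) =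
      MonoidAlgebra.lift ℂ _ _ (complexifyRep R) x := by
  induction x using MonoidAlgebra.induction_linear with
  | zero => simp
  | add x y hx hy => simp only [map_add, hx, hy]
  | single g c =>
    rw [Representation.asAlgebraHom_single, map_smul, complexMatrix_complexify,
      MonoidAlgebra.lift_single]

theorem trace_complexMatrix (x : Module.End ℂ (ℂ ⊗[ℝ] (ι → ℝ))) :
    (complexMatrix ι x).trace = LinearMap.trace ℂ _ x :=
  (LinearMap.trace_eq_matrix_trace ℂ (complexBasis ι) x).symm

theorem dotForm_baseChange (R : G →* Matrix ι ι ℝ) (hR : ∀ g, (R g).transpose * R g = 1)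
    (i : ι) (a : ℂ ⊗[ℝ] (ι → ℝ)) :
    (dotForm R hR).form.baseChange ℂ (complexBasis ι i) a = (complexBasis ι).repr a i := by
  have h : (dotForm R hR).form.baseChange ℂ (complexBasis ι i) = (complexBasis ι).coord i := by
    refine (complexBasis ι).ext fun j => ?_
    rw [Module.Basis.coord_apply, Module.Basis.repr_self, complexBasis,
      Module.Basis.baseChange_apply, Module.Basis.baseChange_apply,
      LinearMap.BilinForm.baseChange_tmul]
    simp only [dotForm, Matrix.toBilin'_apply', Matrix.one_mulVec, Pi.basisFun_apply]
    by_cases h : i = j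
    · subst h; simp
    · simp [h, Ne.symm h]
  rw [h, Module.Basis.coord_apply]

/-- The coordinate basis is orthonormal for the complexified form, so the adjoint is the transpose.
-/
theorem complexMatrix_adjointMap (R : G →* Matrix ι ι ℝ) (hR : ∀ g, (R g).transpose * R g = 1)
    (x : Module.End ℂ (ℂ ⊗[ℝ] (ι → ℝ))) :
    complexMatrix ι (adjointMap ((dotForm R hR).form.baseChange ℂ)
      (baseChange_nondegenerate _ (dotForm R hR).nondegenerate) x) =
      (complexMatrix ι x).transpose := by
  have hsymm : ∀ a b, (dotForm R hR).form.baseChange ℂ a b =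
      (dotForm R hR).form.baseChange ℂ b a := fun a b => by
    have h : (dotForm R hR).form.baseChange ℂ = ((dotForm R hR).form.baseChange ℂ).flip := by
      refine LinearMap.BilinForm.ext_basis (complexBasis ι) fun i j => ?_
      change _ = (dotForm R hR).form.baseChange ℂ (complexBasis ι j) (complexBasis ι i)
      rw [dotForm_baseChange, dotForm_baseChange,
        Module.Basis.repr_self, Module.Basis.repr_self]
      simp only [Finsupp.single_apply, eq_comm]
    exact LinearMap.congr_fun₂ h a b
  ext i j
  rw [Matrix.transpose_apply, complexMatrix, LinearMap.toMatrixAlgEquiv_apply,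
    LinearMap.toMatrixAlgEquiv_apply, ← dotForm_baseChange R hR, ← dotForm_baseChange R hR,
    hsymm, adjointMap_apply]

theorem mem_intertwiners_iff (R : G →* Matrix ι ι ℝ) (x : Module.End ℂ (ℂ ⊗[ℝ] (ι → ℝ))) :
    x ∈ intertwiners (complexify (matrixRep R)) ↔
      ∀ g, complexMatrix ι x * complexifyRep R g = complexifyRep R g * complexMatrix ι x := by
  rw [Subalgebra.mem_centralizer_iff, Set.forall_mem_range]
  refine forall_congr' fun g => ?_
  rw [← complexMatrix_complexify, ← map_mul, ← map_mul, (complexMatrix ι).injective.eq_iff, eq_comm]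

end Coordinates

/-! ### Isomorphisms with algebras of matrix representations -/

section Comparison

variable {G : Type u} [Group G] {ι : Type} [Fintype ι] [DecidableEq ι]

/-- An embedding of an algebra `B` in the matrices onto the commutant of a representation gives
an isomorphism of the intertwining algebra with `B`. -/
def intertwinersEquiv (R : G →* Matrix ι ι ℝ) {B : Type v} [Ring B] [Algebra ℂ B]
    (Ψ : B →ₐ[ℂ] Matrix ι ι ℂ) (hinj : Function.Injective Ψ)
    (hcomm : ∀ b g, Ψ b * complexifyRep R g = complexifyRep R g * Ψ b)
    (hsurj : ∀ T, (∀ g, T * complexifyRep R g = complexifyRep R g * T) → ∃ b, Ψ b = T) :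
    intertwiners (complexify (matrixRep R)) ≃ₐ[ℂ] B :=
  (AlgEquiv.ofBijective ((((complexMatrix ι).symm : _ →ₐ[ℂ] _).comp Ψ).codRestrict
    (intertwiners (complexify (matrixRep R))) fun b => by
      rw [mem_intertwiners_iff]
      simpa using hcomm b)
    ⟨fun b b' h => by
      have h' : (complexMatrix ι).symm (Ψ b) = (complexMatrix ι).symm (Ψ b') :=
        congrArg Subtype.val h
      exact hinj ((complexMatrix ι).symm.injective h'), fun x => by
      obtain ⟨b, hb⟩ := hsurj _ ((mem_intertwiners_iff R x.1).1 x.2)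
      refine ⟨b, Subtype.ext ?_⟩
      change (complexMatrix ι).symm (Ψ b) = x.1
      rw [hb, AlgEquiv.symm_apply_apply]⟩).symm

theorem intertwinersEquiv_spec (R : G →* Matrix ι ι ℝ) {B : Type v} [Ring B] [Algebra ℂ B]
    (Ψ : B →ₐ[ℂ] Matrix ι ι ℂ) (hinj : Function.Injective Ψ)
    (hcomm : ∀ b g, Ψ b * complexifyRep R g = complexifyRep R g * Ψ b)
    (hsurj : ∀ T, (∀ g, T * complexifyRep R g = complexifyRep R g * T) → ∃ b, Ψ b = T)
    (x : intertwiners (complexify (matrixRep R))) :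
    Ψ (intertwinersEquiv R Ψ hinj hcomm hsurj x) = complexMatrix ι x.1 := by
  obtain ⟨b, rfl⟩ := (intertwinersEquiv R Ψ hinj hcomm hsurj).symm.surjective x
  rw [AlgEquiv.apply_symm_apply]
  change _ = complexMatrix ι ((complexMatrix ι).symm (Ψ b))
  rw [AlgEquiv.apply_symm_apply]

/-- Since `H'.B` is zero, the isomorphism on `B` is inverse to `Ψ`, and the relations for `φ` and
`⋆` may be checked after applying the injective `Ψ`. -/
theorem nonempty_iso [Fintype G] (H : EquippedData.{v, w} ℂ) (H' : EquippedData.{0, 0} ℂ)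
    [Subsingleton H'.B] (R : G →* Matrix ι ι ℝ) (hR : ∀ g, (R g).transpose * R g = 1)
    (μ : (GroupCenter ℂ G)ˣ)
    (eA : GroupCenter ℂ G ≃ₐ[ℂ] H.A × H'.A)
    (hlA : ∀ z, H.lA (eA z).1 + H'.lA (eA z).2 = centerFunctional μ z)
    (hU : eA (↑μ⁻¹ * sumSquares ℂ G) = (H.U, H'.U))
    (hstarA : ∀ z, (H.starA (eA z).1, H'.starA (eA z).2) = eA (centerStar ℂ G z))
    (Ψ : H.B →ₐ[ℂ] Matrix ι ι ℂ) (hinj : Function.Injective Ψ)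
    (hcomm : ∀ b g, Ψ b * complexifyRep R g = complexifyRep R g * Ψ b)
    (hsurj : ∀ T, (∀ g, T * complexifyRep R g = complexifyRep R g * T) → ∃ b, Ψ b = T)
    (hstar : ∀ b, Ψ (H.starB b) = (Ψ b).transpose)
    (hlB : ∀ b, H.lB b = (Fintype.card G : ℂ)⁻¹ *
      (MonoidAlgebra.lift ℂ _ _ (complexifyRep R) (μ : GroupCenter ℂ G).1 * Ψ b).trace)
    (hφ : ∀ z : GroupCenter ℂ G,
      MonoidAlgebra.lift ℂ _ _ (complexifyRep R) z.1 = Ψ (H.φ (eA z).1)) :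
    Nonempty (Iso (representationAlgebra (matrixRep R) (dotForm R hR) μ) (directSum H H')) := by
  let e := intertwinersEquiv R Ψ hinj hcomm hsurj
  have he : ∀ x, Ψ (e x) = complexMatrix ι x.1 := intertwinersEquiv_spec R Ψ hinj hcomm hsurj
  let f : intertwiners (complexify (matrixRep R)) →ₐ[ℂ] H'.B :=
    AlgHom.ofLinearMap 0 (Subsingleton.elim _ _) (fun _ _ => Subsingleton.elim _ _)
  let eB : intertwiners (complexify (matrixRep R)) ≃ₐ[ℂ] H.B × H'.B :=
    AlgEquiv.ofBijective ((e : _ →ₐ[ℂ] _).prod f)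
      ⟨fun x y h => by
        have h' : e x = e y := congrArg Prod.fst h
        exact e.injective h', fun y =>
        ⟨e.symm y.1, Prod.ext (e.apply_symm_apply _) (Subsingleton.elim _ _)⟩⟩
  refine ⟨⟨eA, eB, hlA, ?_, ?_, hU, hstarA, ?_⟩⟩
  · intro (x : intertwiners (complexify (matrixRep R)))
    change H.lB (e x) + H'.lB (f x) = intertwinerFunctional (complexify (matrixRep R)) μ x
    rw [Subsingleton.elim (f x) 0, map_zero, add_zero, hlB, he, ← complexMatrix_asAlgebraHom,
      ← map_mul, trace_complexMatrix]
    rfl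
  · intro (z : GroupCenter ℂ G)
    refine Prod.ext (hinj ?_) (Subsingleton.elim _ _)
    change Ψ (H.φ (eA z).1) = Ψ (e (centerAction (complexify (matrixRep R)) z))
    rw [he, ← hφ, ← complexMatrix_asAlgebraHom]
    rfl
  · intro (x : intertwiners (complexify (matrixRep R)))
    refine Prod.ext (hinj ?_) (Subsingleton.elim _ _)
    change Ψ (H.starB (e x)) = Ψ (e (intertwinerStar _ _ _ (complexify_invariant _ (dotForm R hR)) x))
    rw [hstar, he, he]
    exact (complexMatrix_adjointMap R hR x.1).symm

end Comparison

/-! ### The summand of `Z(ℂ[G])` on a set of characters -/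

section CharacterSummand

variable {G : Type} [Group G] [Fintype G]

omit [Fintype G] in
theorem coeff_one_groupInv (x : MonoidAlgebra ℂ G) : (groupInv ℂ G x).coeff 1 = x.coeff 1 := by
  induction x using MonoidAlgebra.induction_linear with
  | zero => simp
  | add x y hx hy => simp [hx, hy]
  | single g c =>
    rw [groupInv_single, MonoidAlgebra.coeff_single, MonoidAlgebra.coeff_single]
    by_cases h : g = 1
    · simp [h]
    · simp [h]

theorem centerFunctional_centerStar {μ : (GroupCenter ℂ G)ˣ}
    (hμ : centerStar ℂ G (μ : GroupCenter ℂ G) = μ) (z : GroupCenter ℂ G) :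
    centerFunctional μ (centerStar ℂ G z) = centerFunctional μ z := by
  have h : (μ : GroupCenter ℂ G) ^ 2 * centerStar ℂ G z =
      centerStar ℂ G ((μ : GroupCenter ℂ G) ^ 2 * z) := by
    rw [sq, centerStar_mul, centerStar_mul, hμ]
  rw [centerFunctional_apply, centerFunctional_apply, h, centerStar_coe, coeff_one_groupInv]

omit [Fintype G] in
theorem comp_centerStarHom_comp (x : GroupCenter ℂ G →ₐ[ℂ] ℂ) :
    (x.comp (centerStarHom G)).comp (centerStarHom G) = x := by
  ext z
  exact congrArg x (centerStar_centerStar z)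

variable (μ : (GroupCenter ℂ G)ˣ) (S : Set (GroupCenter ℂ G →ₐ[ℂ] ℂ)) [Fintype S]
  (hS : ∀ y ∈ S, y.comp (centerStarHom G) ∈ S)

/-- The summand of `Z(ℂ[G])` on a set `S` of characters invariant under the involution, with
trivial algebra `B`. -/
def characterSummand : EquippedData.{0, 0} ℂ where
  A := S → ℂ
  B := PUnit
  lA := ∑ y : S, centerFunctional μ (idem y.1) • LinearMap.proj y
  lB := 0
  φ := AlgHom.ofLinearMap 0 rfl fun _ _ => rfl
  U y := y.1 (↑μ⁻¹ * sumSquares ℂ G)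
  starA := LinearMap.funLeft ℂ ℂ fun y : S => (⟨y.1.comp (centerStarHom G), hS y.1 y.2⟩ : S)
  starB := 0

theorem characterSummand_lA (f : S → ℂ) :
    (characterSummand μ S hS).lA f = ∑ y : S, centerFunctional μ (idem y.1) * f y := by
  change (∑ y : S, centerFunctional μ (idem y.1) • LinearMap.proj (R := ℂ) (φ := fun _ => ℂ) y) f = _
  simp

theorem isFrobeniusPair_characterSummand : IsFrobeniusPair (characterSummand μ S hS).lA where
  symm x y := by rw [mul_comm]
  nondegenerate := by
    classical
    intro (x : S → ℂ) hx
    funext y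
    have h := (characterSummand_lA μ S hS (x * Pi.single y 1)).symm.trans (hx (Pi.single y (1 : ℂ)))
    rw [Finset.sum_eq_single y (fun z _ hz => by
      change _ * (x z * (Pi.single y (1 : ℂ) : S → ℂ) z) = 0
      rw [Pi.single_eq_of_ne hz, mul_zero, mul_zero]) (by simp)] at h
    change _ * (x y * (Pi.single y (1 : ℂ) : S → ℂ) y) = 0 at h
    rw [Pi.single_eq_same, mul_one] at h
    exact (mul_eq_zero.1 h).resolve_left
      ((isFrobeniusPair_centerFunctional μ).apply_idem_ne_zero y.1)

/-- The axioms on the zero algebra `B` are empty; the formula for `U²` is inherited character by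
character from `Z(ℂ[G])`. -/
theorem isEquippedCardyFrobenius_characterSummand
    (hμ : centerStar ℂ G (μ : GroupCenter ℂ G) = μ) :
    IsEquippedCardyFrobenius (characterSummand μ S hS) where
  frobeniusA := isFrobeniusPair_characterSummand μ S hS
  frobeniusB := ⟨fun _ _ => rfl, fun _ _ => rfl⟩
  central _ _ := rfl
  cardy := by
    refine ⟨0, fun _ a => by
      rw [LinearMap.zero_apply, zero_mul, map_zero]
      rfl, fun b' b'' => ?_⟩
    have h : LinearMap.mulLeft ℂ b' ∘ₗ LinearMap.mulRight ℂ b'' = 0 := LinearMap.ext fun _ => rfl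
    rw [h, map_zero, LinearMap.zero_apply, zero_mul, map_zero]
  starA_starA a := by
    funext y
    exact congrArg a (Subtype.ext (comp_centerStarHom_comp y.1))
  starB_starB _ := rfl
  starA_mul a a' := by
    rw [mul_comm]
    rfl
  starB_mul _ _ := rfl
  lA_star := by
    intro (a : S → ℂ)
    have h1 := characterSummand_lA μ S hS a
    have h2 := characterSummand_lA μ S hS ((characterSummand μ S hS).starA a)
    refine h2.trans (Eq.trans ?_ h1.symm)
    let σ : S → S := fun y => ⟨y.1.comp (centerStarHom G), hS y.1 y.2⟩
    have hσ : Function.Involutive σ := fun y => Subtype.ext (comp_centerStarHom_comp y.1)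
    refine Fintype.sum_equiv hσ.toPerm _ _ fun y => ?_
    change _ = centerFunctional μ (idem (y.1.comp (centerStarHom G))) * a (σ y)
    rw [← centerStar_idem, centerFunctional_centerStar hμ]
    rfl
  lB_star _ := rfl
  φ_star _ := rfl
  U_sq := by
    classical
    funext y
    have hl := isFrobeniusPair_characterSummand μ S hS
    have h0 := (isFrobeniusPair_centerFunctional μ).apply_idem_ne_zero y.1
    let e : (characterSummand μ S hS).A := (Pi.single y (1 : ℂ) : S → ℂ)
    have h := hl.sum_mul_eq_mul_casimirStar (characterSummand μ S hS).starA (T := Unit)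
      (fun _ => e) (fun _ => (centerFunctional μ (idem y.1))⁻¹ • e) e fun r => by
        rw [Finset.univ_unique, Finset.sum_singleton, smul_mul_assoc, map_smul]
        have h1 := characterSummand_lA μ S hS (e * r)
        rw [Finset.sum_eq_single y (fun z _ hz => by
          change _ * ((Pi.single y (1 : ℂ) : S → ℂ) z * _) = 0
          simp [hz]) (by simp)] at h1
        refine (congrArg (fun c => (_ • c) • e) h1).trans ?_
        funext z
        by_cases hz : z = y
        · subst hz
          change ((centerFunctional μ (idem z.1))⁻¹ * (centerFunctional μ (idem z.1) *
            ((Pi.single z (1 : ℂ) : S → ℂ) z * r z))) * (Pi.single z (1 : ℂ) : S → ℂ) z =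
            (Pi.single z (1 : ℂ) : S → ℂ) z * r z
          rw [Pi.single_eq_same]
          field_simp
        · change _ * (Pi.single y (1 : ℂ) : S → ℂ) z = (Pi.single y (1 : ℂ) : S → ℂ) z * r z
          rw [Pi.single_eq_of_ne hz, mul_zero, zero_mul]
    rw [Finset.univ_unique, Finset.sum_singleton, map_smul] at h
    have h' := congrFun h y
    change (Pi.single y (1 : ℂ) : S → ℂ) y * ((centerFunctional μ (idem y.1))⁻¹ *
      (Pi.single y (1 : ℂ) : S → ℂ) ⟨y.1.comp (centerStarHom G), hS y.1 y.2⟩) =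
      (Pi.single y (1 : ℂ) : S → ℂ) y * _ at h'
    rw [Pi.single_eq_same, one_mul, one_mul] at h'
    refine Eq.trans ?_ h'
    change (y.1 (↑μ⁻¹ * sumSquares ℂ G)) ^ 2 = _
    rw [sq_character_sumSquares hμ]
    congr 1
    by_cases hy : y.1.comp (centerStarHom G) = y.1
    · have : (⟨y.1.comp (centerStarHom G), hS y.1 y.2⟩ : S) = y := Subtype.ext hy
      rw [this, hy, Pi.single_eq_same, character_idem_self]
    · rw [Pi.single_eq_of_ne fun h => hy (congrArg Subtype.val h),
        character_idem_of_ne (Ne.symm hy)]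
  φ_U := rfl

theorem isSemisimple_characterSummand : IsSemisimple (characterSummand μ S hS) :=
  ⟨(inferInstance : IsSemisimpleRing (S → ℂ)), (inferInstance : IsSemisimpleRing PUnit)⟩

end CharacterSummand

/-! ### Splitting off the centre -/

section Splitting

variable {G : Type} [Group G] [Fintype G] {A : Type u} [CommRing A] [Algebra ℂ A]
  [FiniteDimensional ℂ A] [IsReduced A]
  {ψ : (A →ₐ[ℂ] ℂ) → (GroupCenter ℂ G →ₐ[ℂ] ℂ)}

/-- An injection of the characters of `A` in those of the centre of the group algebra exhibits
`A` as a direct summand of the centre. -/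
theorem exists_splitting (hψ : Function.Injective ψ) :
    ∃ e : GroupCenter ℂ G ≃ₐ[ℂ] A × (↥(Set.range ψ)ᶜ → ℂ),
      ∀ z, (∀ x, x (e z).1 = ψ x z) ∧ ∀ y, (e z).2 y = y.1 z := by
  classical
  let f : GroupCenter ℂ G →ₐ[ℂ] A × (↥(Set.range ψ)ᶜ → ℂ) :=
    (((gelfand (A := A)).symm : _ →ₐ[ℂ] A).comp (AlgHom.pi fun x => ψ x)).prod
      (AlgHom.pi fun y : ↥(Set.range ψ)ᶜ => y.1)
  have h1 : ∀ z x, x (f z).1 = ψ x z := fun z x => character_gelfand_symm x _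
  have h2 : ∀ z y, (f z).2 y = y.1 z := fun z y => rfl
  have hf : Function.Bijective f := by
    constructor
    · intro z w h
      apply ext_character
      intro y
      by_cases hy : y ∈ Set.range ψ
      · obtain ⟨x, rfl⟩ := hy
        rw [← h1, ← h1, h]
      · exact (h2 z ⟨y, hy⟩).symm.trans ((congrFun (congrArg Prod.snd h) ⟨y, hy⟩).trans
          (h2 w ⟨y, hy⟩))
    · rintro ⟨a, b⟩
      let g : (GroupCenter ℂ G →ₐ[ℂ] ℂ) → ℂ := Function.extend ψ (fun x => x a)
        fun y => if hy : y ∈ (Set.range ψ)ᶜ then b ⟨y, hy⟩ else 0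
      refine ⟨gelfand.symm g, Prod.ext (ext_character fun x => ?_) (funext fun y => ?_)⟩
      · rw [h1, character_gelfand_symm]
        exact hψ.extend_apply _ _ x
      · rw [h2, character_gelfand_symm]
        refine (Function.extend_apply' _ _ _ y.2).trans ?_
        rw [dif_pos y.2]
  exact ⟨AlgEquiv.ofBijective f hf, fun z => ⟨h1 z, h2 z⟩⟩

omit [FiniteDimensional ℂ A] [IsReduced A] in
theorem apply_eq_sum_add_sum [Fintype (A →ₐ[ℂ] ℂ)] [Fintype ↥(Set.range ψ)ᶜ]
    (hψ : Function.Injective ψ) (l : GroupCenter ℂ G →ₗ[ℂ] ℂ) (z : GroupCenter ℂ G) :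
    l z = ∑ x, ψ x z * l (idem (ψ x)) + ∑ y : ↥(Set.range ψ)ᶜ, y.1 z * l (idem y.1) := by
  classical
  have : Fintype (GroupCenter ℂ G →ₐ[ℂ] ℂ) := Fintype.ofFinite _
  rw [apply_eq_sum l z]
  let e : (A →ₐ[ℂ] ℂ) ⊕ ↥(Set.range ψ)ᶜ ≃ (GroupCenter ℂ G →ₐ[ℂ] ℂ) :=
    (Equiv.sumCongr (Equiv.ofInjective ψ hψ) (Equiv.refl _)).trans (Equiv.Set.sumCompl _)
  rw [← e.sum_comp, Fintype.sum_sum_type]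
  rfl

omit [IsReduced A] in
-- Values on characters may be prescribed freely: `m` on the image of `ψ` and `1` elsewhere is
-- nowhere zero and invariant.
theorem exists_invariant_unit (hψ : Function.Injective ψ) {σ : (A →ₐ[ℂ] ℂ) → (A →ₐ[ℂ] ℂ)}
    (hψσ : ∀ x, (ψ x).comp (centerStarHom G) = ψ (σ x))
    (m : (A →ₐ[ℂ] ℂ) → ℂ) (hm : ∀ x, m x ≠ 0) (hmσ : ∀ x, m (σ x) = m x) :
    ∃ μ : (GroupCenter ℂ G)ˣ, (∀ x, ψ x (μ : GroupCenter ℂ G) = m x) ∧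
      centerStar ℂ G (μ : GroupCenter ℂ G) = μ := by
  let g : (GroupCenter ℂ G →ₐ[ℂ] ℂ) → ℂ := Function.extend ψ m fun _ => 1
  have hg : ∀ x, g (ψ x) = m x := hψ.extend_apply _ _
  have hg' : ∀ y, y ∉ Set.range ψ → g y = 1 := fun y hy => Function.extend_apply' _ _ y hy
  have hg0 : ∀ y, g y ≠ 0 := fun y => by
    by_cases hy : y ∈ Set.range ψ
    · obtain ⟨x, rfl⟩ := hy
      rw [hg]
      exact hm x
    · rw [hg' y hy]
      exact one_ne_zero
  have hgσ : ∀ y, g (y.comp (centerStarHom G)) = g y := fun y => by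
    by_cases hy : y ∈ Set.range ψ
    · obtain ⟨x, rfl⟩ := hy
      rw [hψσ, hg, hg, hmσ]
    · rw [hg' y hy, hg']
      rintro ⟨x, hx⟩
      exact hy ⟨σ x, by rw [← hψσ, hx, comp_centerStarHom_comp]⟩
  let e := gelfand (A := GroupCenter ℂ G)
  have hmul : ∀ a b : (GroupCenter ℂ G →ₐ[ℂ] ℂ) → ℂ, a * b = 1 → e.symm a * e.symm b = 1 :=
    fun a b h => by rw [← map_mul, h, map_one]
  refine ⟨⟨e.symm g, e.symm g⁻¹, hmul _ _ (funext fun y => mul_inv_cancel₀ (hg0 y)),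
    hmul _ _ (funext fun y => inv_mul_cancel₀ (hg0 y))⟩, fun x => ?_, ?_⟩
  · exact (character_gelfand_symm _ _).trans (hg x)
  · apply ext_character
    intro y
    change (y.comp (centerStarHom G)) (e.symm g) = y (e.symm g)
    rw [character_gelfand_symm, character_gelfand_symm, hgσ]

end Splitting

/-! ### Assembling the realizations into a representation of the product group. -/

section GlobalRealization

variable {O : Type} [Fintype O] [DecidableEq O] {H : EquippedData.{u, v} ℂ} [IsReduced H.A]
  {t : (H.A →ₐ[ℂ] ℂ) → CharType} {c : (H.A →ₐ[ℂ] ℂ) → ℂ}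
  {S : O → Finset (H.A →ₐ[ℂ] ℂ)} (r : ∀ o, Realization H (S o) t c)

/-- The representation of a product of copies of `Q₈ × ℤ/3ℤ` assembled from realizations. -/
def globalRep : (O → Q8Z3) →* Matrix (Σ o, (r o).ι) (Σ o, (r o).ι) ℝ :=
  productRep fun o => (r o).R

/-- The embedding of `B` in block diagonal matrices assembled from realizations. -/
def globalMap : H.B →ₐ[ℂ] Matrix (Σ o, (r o).ι) (Σ o, (r o).ι) ℂ :=
  AlgHom.ofLinearMap
    { toFun := fun b => Matrix.blockDiagonal' fun o => (r o).Ψ b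
      map_add' := fun a b => by
        simp only [map_add]
        exact Matrix.blockDiagonal'_add _ _
      map_smul' := fun a b => by
        simp only [map_smul]
        exact Matrix.blockDiagonal'_smul a _ }
    (by
      simp only [LinearMap.coe_mk, AddHom.coe_mk, map_one]
      exact Matrix.blockDiagonal'_one)
    (fun a b => by
      simp only [LinearMap.coe_mk, AddHom.coe_mk, map_mul]
      exact Matrix.blockDiagonal'_mul _ _)

theorem globalMap_apply (b : H.B) :
    globalMap r b = Matrix.blockDiagonal' fun o => (r o).Ψ b := rfl

theorem globalMap_commute (b : H.B) (g : O → Q8Z3) :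
    globalMap r b * complexifyRep (globalRep r) g =
      complexifyRep (globalRep r) g * globalMap r b := by
  rw [globalRep, complexifyRep_productRep, productRep_apply, globalMap_apply,
    ← Matrix.blockDiagonal'_mul, ← Matrix.blockDiagonal'_mul]
  simp only [(r _).commute]

theorem globalMap_star (b : H.B) : globalMap r (H.starB b) = (globalMap r b).transpose := by
  rw [globalMap_apply, globalMap_apply, Matrix.blockDiagonal'_transpose]
  simp only [(r _).star]

/-- A realization over `S` sees only the components of `a` at the characters in `S`. -/
theorem Realization.Ψ_eq {S : Finset (H.A →ₐ[ℂ] ℂ)} (r : Realization H S t c) (a : H.A) (b : H.B) :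
    r.Ψ (H.φ a * b) = r.Ψ (H.φ (∑ x ∈ S, x a • idem x) * b) := by
  rw [← sub_eq_zero, ← map_sub, ← sub_mul, ← map_sub, r.ker]
  intro y hy
  rw [← mul_assoc, ← map_mul, mul_comm (idem y), mul_idem, map_sub, map_sum]
  rw [Finset.sum_eq_single_of_mem y hy fun x _ hx => by
    rw [map_smul, character_idem_of_ne (Ne.symm hx), smul_zero]]
  simp only [map_smul, character_idem_self, smul_eq_mul, mul_one, sub_self, zero_smul]
  rw [map_zero, zero_mul]

variable [Fintype (H.A →ₐ[ℂ] ℂ)] {κ : (H.A →ₐ[ℂ] ℂ) → O} (hS : ∀ o x, x ∈ S o ↔ κ x = o)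

include hS

theorem globalMap_injective : Function.Injective (globalMap r) := by
  rw [injective_iff_map_eq_zero]
  intro b hb
  rw [globalMap_apply, ← Matrix.blockDiagonal'_zero] at hb
  have h := Matrix.blockDiagonal'_injective hb
  have h1 : ∀ x, H.φ (idem x) * b = 0 := fun x =>
    ((r (κ x)).ker b).1 (congrFun h (κ x)) x ((hS _ x).2 rfl)
  calc b = H.φ (∑ x, idem x) * b := by rw [sum_idem, map_one, one_mul]
    _ = 0 := by rw [map_sum, Finset.sum_mul, Finset.sum_eq_zero fun x _ => h1 x]

theorem globalMap_surjective (T : Matrix (Σ o, (r o).ι) (Σ o, (r o).ι) ℂ)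
    (hT : ∀ g, T * complexifyRep (globalRep r) g = complexifyRep (globalRep r) g * T) :
    ∃ b, globalMap r b = T := by
  rw [globalRep, complexifyRep_productRep] at hT
  have hneg : ∀ o, ∃ h, complexifyRep (r o).R h = -1 := fun o => by
    obtain ⟨h, hh⟩ := (r o).neg
    refine ⟨h, ?_⟩
    rw [complexifyRep_apply, hh]
    ext i j
    by_cases hij : i = j
    · subst hij; simp
    · simp [hij]
  choose b hb using fun o => (r o).surj (T.blockDiag' o)
    fun g => blockDiag'_commute (fun o => complexifyRep (r o).R) hneg T hT o g
  -- Each diagonal block lifts separately; the idempotents keep from each lift only the part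
  -- belonging to its own factor.
  refine ⟨∑ x, H.φ (idem x) * b (κ x), ?_⟩
  rw [eq_blockDiagonal'_of_commute (fun o => complexifyRep (r o).R) hneg T hT, globalMap_apply]
  congr 1
  funext o
  rw [← hb, ← sub_eq_zero, ← map_sub, (r o).ker]
  intro y hy
  rw [mul_sub, Finset.mul_sum, Finset.sum_eq_single y, ← mul_assoc, ← map_mul, idem_mul_self,
    (hS o y).1 hy, sub_self]
  · intro x _ hx
    rw [← mul_assoc, ← map_mul, idem_mul_of_ne (Ne.symm hx), map_zero, zero_mul]
  · simp

omit [Fintype (H.A →ₐ[ℂ] ℂ)] in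
theorem lift_globalRep (z : GroupCenter ℂ (O → Q8Z3)) (a : H.A)
    (ha : ∀ x, x a = factorChar (κ x) (t x) z) :
    MonoidAlgebra.lift ℂ _ _ (complexifyRep (globalRep r)) z.1 = globalMap r (H.φ a) := by
  rw [globalRep, complexifyRep_productRep, lift_productRep, globalMap_apply]
  congr 1
  funext o
  have h := (r o).center (centerMap (Pi.evalMonoidHom (fun _ : O => Q8Z3) o) (eval_surjective o) z)
  rw [centerMap_coe] at h
  rw [h]
  have h2 := (r o).Ψ_eq a 1
  rw [mul_one, mul_one] at h2
  rw [h2]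
  congr 2
  refine Finset.sum_congr rfl fun x hx => ?_
  rw [ha, (hS o x).1 hx]
  rfl

/-- Applied with `a` the image of `μ`: the degree in the trace identity of the blocks cancels the
one in the choice of `μ`. -/
theorem trace_globalMap (a : H.A) (N : ℂ)
    (hN : N ≠ 0) (ha : ∀ x, x a * (t x).degree / N = c x) (b : H.B) :
    H.lB b = N⁻¹ * (globalMap r (H.φ a) * globalMap r b).trace := by
  rw [← map_mul, globalMap_apply, Matrix.trace_blockDiagonal']
  have h1 : ∀ o, ((r o).Ψ (H.φ a * b)).trace = ∑ x ∈ S o, N * H.lB (H.φ (idem x) * b) := by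
    intro o
    rw [(r o).Ψ_eq, map_sum, Finset.sum_mul, map_sum, Matrix.trace_sum]
    refine Finset.sum_congr rfl fun x hx => ?_
    have h2 := (r o).trace x hx b
    have h3 := (t x).degree_ne_zero
    rw [map_smul, smul_mul_assoc, map_smul, Matrix.trace_smul, smul_eq_mul]
    apply mul_left_cancel₀ h3
    rw [← mul_left_comm N, ← h2, ← ha]
    field_simp
  simp only [h1]
  have h4 : ∀ F : (H.A →ₐ[ℂ] ℂ) → ℂ, ∑ o, ∑ x ∈ S o, F x = ∑ x, F x := fun F => by
    rw [← Finset.sum_fiberwise Finset.univ κ F]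
    refine Finset.sum_congr rfl fun o _ => Finset.sum_congr ?_ fun _ _ => rfl
    ext x
    simp [hS]
  rw [h4, ← Finset.mul_sum, inv_mul_cancel_left₀ hN, ← map_sum, ← Finset.sum_mul, ← map_sum,
    sum_idem, map_one, one_mul]

end GlobalRealization

/-- Every semi-simple equipped Cardy-Frobenius algebra is a direct summand of the algebra of a
representation of a product of copies of `Q₈ × ℤ/3ℤ`. -/
theorem exists_representation_summand (H : EquippedData.{u, v} ℂ)
    (hH : IsEquippedCardyFrobenius H) (hss : IsSemisimple H) :
    ∃ (k : ℕ) (V : Type) (_ : AddCommGroup V) (_ : Module ℝ V) (_ : FiniteDimensional ℝ V)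
      (ρ : Representation ℝ (Q8Z3Power k) V) (β : InvariantForm ρ)
      (μ : (GroupCenter ℂ (Q8Z3Power k))ˣ) (H' : EquippedData.{0, 0} ℂ),
      centerStar ℂ (Q8Z3Power k) (μ : GroupCenter ℂ _) = μ ∧
      IsEquippedCardyFrobenius H' ∧ IsSemisimple H' ∧
      Nonempty (Iso (representationAlgebra ρ β μ) (directSum H H')) := by
  classical
  have := hss.1
  have := hss.2
  have hred : IsReduced H.A := inferInstance
  have : Fintype (H.A →ₐ[ℂ] ℂ) := Fintype.ofFinite _
  obtain ⟨c, t, rep, hc, hcσ, htσ, hrepσ, hself, hnself, hrep, hr⟩ := exists_realizations hH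
  have hc0 : ∀ x, c x ≠ 0 := fun x h0 => by
    have := hc x
    rw [h0] at this
    exact hH.frobeniusA.apply_idem_ne_zero x (by rw [← this]; simp)
  -- One factor per character rather than per orbit; the spare factors act on the zero space.
  let n := Fintype.card (H.A →ₐ[ℂ] ℂ)
  let e : (H.A →ₐ[ℂ] ℂ) ≃ Fin n := Fintype.equivFin _
  let N : ℂ := Fintype.card (Fin n → Q8Z3)
  have hN : N ≠ 0 := card_ne_zero_complex
  let κ : (H.A →ₐ[ℂ] ℂ) → Fin n := fun x => e (rep x)
  let S : Fin n → Finset (H.A →ₐ[ℂ] ℂ) := fun o => Finset.univ.filter fun x => rep x = e.symm o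
  have hS : ∀ o x, x ∈ S o ↔ κ x = o := fun o x => by simp [S, κ, Equiv.eq_symm_apply]
  let r : ∀ o, Realization H (S o) t c := fun o => (hr (e.symm o)).some
  let ψ : (H.A →ₐ[ℂ] ℂ) → (GroupCenter ℂ (Fin n → Q8Z3) →ₐ[ℂ] ℂ) :=
    fun x => factorChar (κ x) (t x)
  -- Different factors give different characters, so only two members of one orbit could collide;
  -- these have the two distinct complex types.
  have hψ : Function.Injective ψ := by
    intro x y h
    rcases hrep x y (e.injective (eq_of_factorChar_eq h)) with hxy | hxy
    · exact hxy.symm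
    · by_cases hx : starChar hH x = x
      · rw [hxy, hx]
      · exfalso
        have hκ : κ y = κ x := by simp only [κ, hxy, hrepσ]
        have hty : t y = (t x).conj := by rw [hxy, htσ]
        simp only [ψ, hκ, hty] at h
        rcases hnself x hx with h' | h' <;> rw [h'] at h
        · exact factorChar_cp_ne_cm _ h
        · exact factorChar_cp_ne_cm _ h.symm
  have hψσ : ∀ x, (ψ x).comp (centerStarHom _) = ψ (starChar hH x) := fun x => by
    ext z
    refine (factorChar_centerStar (κ x) (t x) z).trans ?_
    simp only [ψ, κ, hrepσ, htσ]
  -- This value of `μ` is forced, up to sign, by `l_A (idem x) = (μ d / N)² = c²`; the sign is the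
  -- one that also matches `l_B` and `U`.
  obtain ⟨μ, hμ, hμs⟩ := exists_invariant_unit hψ hψσ (fun x => c x * N / (t x).degree)
    (fun x => div_ne_zero (mul_ne_zero (hc0 x) hN) (t x).degree_ne_zero)
    (fun x => by rw [hcσ, htσ, CharType.degree_conj])
  have hμd : ∀ x, ψ x (μ : GroupCenter ℂ _) * (t x).degree / N = c x := fun x => by
    have := (t x).degree_ne_zero
    rw [hμ]
    field_simp
  have hidem : ∀ x, centerFunctional μ (idem (ψ x)) = H.lA (idem x) := fun x => by
    rw [← hc, ← hμd, centerFunctional_idem_factorChar hμs]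
  have hU : ∀ x, ψ x (↑μ⁻¹ * sumSquares ℂ (Fin n → Q8Z3)) = x H.U := by
    intro x
    by_cases hx : starChar hH x = x
    · rw [map_mul, character_inv_unit, hμ]
      have h0 := hc0 x
      rcases hself x hx with ⟨h1, h2⟩ | ⟨h1, h2⟩
      · have h3 : ψ x (sumSquares ℂ _) = N := by
          simp only [ψ, h1, factorChar_re_sumSquares, N]
        rw [h3, h1, show CharType.re.degree = 1 from rfl, div_one]
        apply mul_left_cancel₀ h0
        rw [h2]
        field_simp
      · have h3 : ψ x (sumSquares ℂ _) = -N / 2 := by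
          simp only [ψ, h1, factorChar_qu_sumSquares, N]
        rw [h3, h1, show CharType.qu.degree = 2 from rfl]
        apply mul_left_cancel₀ h0
        rw [h2]
        field_simp
    -- At a character that is not self-dual both values of `U` have square zero.
    · have h1 : (x H.U) ^ 2 = 0 := by
        rw [sq_character_U hH, character_idem_of_ne (Ne.symm hx), mul_zero]
      have h2 : (ψ x (↑μ⁻¹ * sumSquares ℂ (Fin n → Q8Z3))) ^ 2 = 0 := by
        rw [sq_character_sumSquares hμs, hψσ,
          character_idem_of_ne fun h => hx (hψ h).symm, mul_zero]
      rw [pow_eq_zero_iff two_ne_zero] at h1 h2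
      rw [h1, h2]
  have hJ : ∀ y ∈ (Set.range ψ)ᶜ, y.comp (centerStarHom _) ∈ (Set.range ψ)ᶜ := by
    rintro y hy ⟨x, hx⟩
    exact hy ⟨starChar hH x, by rw [← hψσ, hx, comp_centerStarHom_comp]⟩
  have hfin : Fintype ↥(Set.range ψ)ᶜ := Fintype.ofFinite _
  let H' := characterSummand μ (Set.range ψ)ᶜ hJ
  obtain ⟨eA, heA, heA'⟩ : ∃ e : GroupCenter ℂ (Fin n → Q8Z3) ≃ₐ[ℂ] H.A × H'.A,
      (∀ z x, x (e z).1 = ψ x z) ∧ ∀ z (y : ↥(Set.range ψ)ᶜ),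
        (show ↥(Set.range ψ)ᶜ → ℂ from (e z).2) y = y.1 z := by
    obtain ⟨e, he⟩ := exists_splitting hψ
    exact ⟨e, fun z => (he z).1, fun z => (he z).2⟩
  have hsub : Subsingleton H'.B :=
    (inferInstance : Subsingleton PUnit)
  refine ⟨n, (Σ o, (r o).ι) → ℝ, inferInstance, inferInstance, inferInstance,
    matrixRep (globalRep r), dotForm (globalRep r)
      (productRep_transpose_mul (fun o => (r o).R) fun o => (r o).orthogonal), μ,
    H', hμs,
    isEquippedCardyFrobenius_characterSummand μ _ hJ hμs, isSemisimple_characterSummand μ _ hJ,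
    nonempty_iso H H' (globalRep r) _ μ eA ?_ ?_ ?_ (globalMap r) (globalMap_injective r hS)
      (globalMap_commute r) (globalMap_surjective r hS) (globalMap_star r) ?_ ?_⟩
  · intro z
    rw [apply_eq_sum_add_sum hψ (centerFunctional μ) z, apply_eq_sum H.lA]
    refine congrArg₂ (· + ·) (Finset.sum_congr rfl fun x _ => by rw [heA, hidem]) ?_
    refine (characterSummand_lA μ _ hJ _).trans (Finset.sum_congr rfl fun y _ => ?_)
    rw [mul_comm]
    exact congrArg (· * _) (heA' z y)
  · refine Prod.ext (ext_character fun x => ?_) (funext fun y => heA' _ y)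
    rw [heA, hU]
  · intro z
    refine Prod.ext (ext_character fun x => ?_) (funext fun y => ?_)
    · change starChar hH x (eA z).1 = _
      rw [heA, heA, ← hψσ]
      rfl
    · exact (heA' z ⟨y.1.comp (centerStarHom _), hJ y.1 y.2⟩).trans (heA' _ y).symm
  · intro b
    rw [lift_globalRep r hS μ.1 (eA μ).1 (heA _)]
    exact trace_globalMap r hS _ N hN (fun x => by rw [heA, hμd]) b
  · exact fun z => lift_globalRep r hS z (eA z).1 (heA z)

end KleinTFT

end

theorem mainTheorem6 (H : KleinTFT.EquippedData ℂ)
    (hH : KleinTFT.IsEquippedCardyFrobenius H) (hss : KleinTFT.IsSemisimple H) :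
    ∃ (k : ℕ) (V : Type) (_ : AddCommGroup V) (_ : Module ℝ V) (_ : FiniteDimensional ℝ V)
      (ρ : Representation ℝ (KleinTFT.Q8Z3Power k) V) (β : KleinTFT.InvariantForm ρ)
      (μ : (KleinTFT.GroupCenter ℂ (KleinTFT.Q8Z3Power k))ˣ)
      (H' : KleinTFT.EquippedData.{0, 0} ℂ),
      KleinTFT.centerStar ℂ (KleinTFT.Q8Z3Power k) (μ : KleinTFT.GroupCenter ℂ _) = μ ∧
      KleinTFT.IsEquippedCardyFrobenius H' ∧ KleinTFT.IsSemisimple H' ∧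
      Nonempty (KleinTFT.Iso (KleinTFT.representationAlgebra ρ β μ)
        (KleinTFT.directSum H H')) :=
  KleinTFT.exists_representation_summand H hH hss
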